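/- Let $M$ be a smooth compact Hausdorff manifold without boundary, of dimension $n$, let $g$ be a smooth Riemannian metric on $M$, and let $p(x,\xi)=\sum_{i,j} g^{ij}(x)\xi_i\xi_j$ be its symbol on $T^*M$. For a function $q$ on $T^*M$, let $H_q=\sum_j\left(\frac{\partial q}{\partial \xi_j}\frac{\partial}{\partial x_j}-\frac{\partial q}{\partial x_j}\frac{\partial}{\partial \xi_j}\right)$ be its Hamilton vector field (in canonical coordinates), and for a vector field $X$ on $T^*M$ let $\exp(X)$ denote its time-one flow. Suppose $(x_0,\xi_0)\in T^*M$ with $\xi_0\neq 0$ satisfies $$\exp\left(\tfrac t2 H_p\right)(x_0,\xi_0)\neq(x_0,\xi_0)\quad\text{for all } t\in(0,1].$$ Then there exist an open set $U\subset M$, an open neighborhood $S$ of the origin in $\mathbb R^{2n-1}$, and a function $(s,x)\mapsto f_s(x)$, smooth on $S\times M$, such that the $f_s$, $s\in S$, all vanish outside a common compact subset of $U$, $f_0=0$, $1+f_s>0$ on $M$ for all $s\in S$, and such that the map $$(\tau,s)\mapsto \exp\left(\tfrac12 H_{(1+f_s)p}\right)(x_0,\tau\xi_0)\in T^*M$$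 is well defined for $(\tau,s)$ in a neighborhood of $(1,0)\in\mathbb R\times\mathbb R^{2n-1}$, takes the value $(y_0,\eta_0)=\exp\left(\tfrac12 H_p\right)(x_0,\xi_0)$ at $(1,0)$, and is differentiable at $(1,0)$ with surjective differential $\mathbb R^{1+(2n-1)}\to T_{(y_0,\eta_0)}T^*M$. -/

import Mathlib

open Set Filter Topology Bundle
open scoped Manifold ContDiff

noncomputable section

/-- The model space `ℝⁿ`. -/
abbrev Rn (n : ℕ) : Type := EuclideanSpace ℝ (Fin n)

/-- The cotangent space `T*ₓM`. -/
abbrev CotangentSpace (n : ℕ) {M : Type*} [TopologicalSpace M] [ChartedSpace (Rn n) M]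
    (x : M) : Type :=
  TangentSpace (𝓡 n) x →L[ℝ] Bundle.Trivial M ℝ x

/-- The cotangent bundle `T*M`, with the smooth structure of the bundle of continuous linear maps
from `TM` to `ℝ`. Its preferred chart at `z` is the system of canonical coordinates `(x, ξ)` induced
by the chart of `M` at `z.proj`; accordingly the tangent space of `T*M` at `z` is `ℝⁿ × (ℝⁿ)*`. -/
abbrev CotangentBundle (n : ℕ) (M : Type*) [TopologicalSpace M] [ChartedSpace (Rn n) M]
    [IsManifold (𝓡 n) ∞ M] : Type _ :=
  TotalSpace (Rn n →L[ℝ] ℝ) (fun x : M => TangentSpace (𝓡 n) x →L[ℝ] Bundle.Trivial M ℝ x)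

/-- The model with corners of `T*M`. -/
abbrev cotModel (n : ℕ) :
    ModelWithCorners ℝ (Rn n × (Rn n →L[ℝ] ℝ)) (ModelProd (Rn n) (Rn n →L[ℝ] ℝ)) :=
  (𝓡 n).prod 𝓘(ℝ, Rn n →L[ℝ] ℝ)

/-- Smooth Riemannian metrics on `M`. -/
abbrev SmoothMetric (n : ℕ) (M : Type*) [TopologicalSpace M] [ChartedSpace (Rn n) M]
    [IsManifold (𝓡 n) ∞ M] : Type _ :=
  ContMDiffRiemannianMetric (𝓡 n) ∞ (Rn n) (fun x : M => TangentSpace (𝓡 n) x)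

section

variable {n : ℕ} {M : Type*} [TopologicalSpace M] [ChartedSpace (Rn n) M] [IsManifold (𝓡 n) ∞ M]

/-- The `i`-th coordinate vector `∂/∂xᵢ` at `x`, in the preferred chart at `x`. -/
def coordVec (x : M) (i : Fin n) : TangentSpace (𝓡 n) x :=
  (EuclideanSpace.single i (1 : ℝ) : Rn n)

/-- The matrix `(g_ij(x))` of the metric in the preferred chart at `x`. -/
def metricMatrix (g : SmoothMetric n M) (x : M) : Matrix (Fin n) (Fin n) ℝ :=
  Matrix.of fun i j => g.inner x (coordVec x i) (coordVec x j)

/-- The symbol `p_g(x, ξ) = ∑ g^{ij}(x) ξᵢ ξⱼ`. It does not depend on the chart used. -/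
def symbol (g : SmoothMetric n M) (z : CotangentBundle n M) : ℝ :=
  ∑ i, ∑ j, (metricMatrix g z.proj)⁻¹ i j * z.snd (coordVec z.proj i) * z.snd (coordVec z.proj j)

/-- Differential of a function on `T*M`, in the canonical coordinates `(x, ξ)` at `z`. -/
def cotDeriv (q : CotangentBundle n M → ℝ) (z : CotangentBundle n M) :
    (Rn n × (Rn n →L[ℝ] ℝ)) →L[ℝ] ℝ :=
  mfderiv (cotModel n) 𝓘(ℝ, ℝ) q z

/-- The Hamilton vector field `H_q = ∑ⱼ (∂q/∂ξⱼ ∂/∂xⱼ - ∂q/∂xⱼ ∂/∂ξⱼ)` on `T*M`. Its component along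
the fibre, `-∑ⱼ ∂q/∂xⱼ dxⱼ`, is the covector `v ↦ - dq(v, 0)`. -/
def hamiltonField (q : CotangentBundle n M → ℝ) (z : CotangentBundle n M) :
    TangentSpace (cotModel n) z :=
  ((∑ j, cotDeriv q z (0, EuclideanSpace.proj j) • EuclideanSpace.single j (1 : ℝ),
    -((cotDeriv q z).comp (ContinuousLinearMap.inl ℝ (Rn n) (Rn n →L[ℝ] ℝ)))) :
    Rn n × (Rn n →L[ℝ] ℝ))

/-- `γ` is an integral curve, over the time interval `[0, 1]`, of the vector field `X` on `T*M`,
starting at `z`. -/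
def IsUnitTimeCurve (X : (z : CotangentBundle n M) → TangentSpace (cotModel n) z)
    (z : CotangentBundle n M) (γ : ℝ → CotangentBundle n M) : Prop :=
  γ 0 = z ∧ IsMIntegralCurveOn (I := cotModel n) γ X (Icc 0 1)

open Classical in
/-- The time-one flow `exp(X)` of a vector field `X` on `T*M`: the endpoint at time `1` of the
integral curve of `X` starting at `z` (and, by convention, `z` if that curve does not exist up to
time `1`). -/
def expField (X : (z : CotangentBundle n M) → TangentSpace (cotModel n) z)
    (z : CotangentBundle n M) : CotangentBundle n M :=
  if h : ∃ γ, IsUnitTimeCurve X z γ then h.choose 1 else z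

/-- The conformally perturbed symbol `(1 + f) p_g`, which is the symbol of the metric
`(1 + f)⁻¹ g` where `1 + f > 0`. -/
def conformalSymbol (g : SmoothMetric n M) (f : M → ℝ) (z : CotangentBundle n M) : ℝ :=
  (1 + f z.proj) * symbol g z

end

end

/-! Write $X$ for half the Hamilton field of $p$ and $\gamma=(x,\xi)$ for its integral curve from
$(x_0,\xi_0)$. The non-periodicity hypothesis makes $\gamma$ injective on $[0,1]$
(`IsUnitTimeCurve.injOn`). Projected self-intersections are transversal: by conservation of $p$,
parallel velocities at the same point force equal or opposite covectors. Equality contradicts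
injectivity; opposition makes the arc its own time reversal, so its covector vanishes at the
midpoint (`IsMIntegralCurveOn.eq_zero_of_smul_velocity_eq`). Hence, for a short time $e$, there is
$t_1<e$ such that $x(t_1)$ is met at no other time in $[0,1]$
(`IsMIntegralCurveOn.exists_simple_time`, `IsMIntegralCurveOn.eventually_proj_ne`,
`IsMIntegralCurveOn.eventually_injOn_proj`). Perturbations supported near $x(t_1)$ act only on
$[0,e]$, inside one chart. From $e$ to $1$ the free flow is used; its differential is surjective
(`IsMIntegralCurveOn.submersiveFlowOn`).

In the chart, the first variation at time $e$, pulled back to time $0$ by the inverse $Z$ of the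
linearised flow, is $\int Z_t(X_f-X)(\gamma(t))\,dt$, where $X_f$ is the perturbed field. Let a
functional $l$ annihilate these vectors for all test functions $f$, and also the radial vector
$(0,\xi_0)$. The vector $u(t)$ symplectically dual to $l\circ Z_t$ solves the linearised equation,
and $\kappa=dp(u)$ is constant. With $\beta$ the base component of $u$, annihilation says
$$\int\bigl(df(\beta)+\tfrac{\kappa}{p}f\bigr)\,dt=0\quad\text{for all } f \text{ supported near }
x(t_1).$$ Concentrating $f$ gives $\beta=r\dot x$ and $r'=\kappa/p$ there
(`exists_eq_smul_of_integral_eq_zero`, `eq_of_integral_eq_zero`). Comparing derivatives yields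
$u=rX+r'(0,\xi)$ at $t_1$. Applying $dp$ gives $\kappa=2\kappa$, so $\kappa=0$, and by uniqueness
$u$ is a constant multiple of $X$. The radial vector pairs with $X$ to $p>0$, so the multiple is
zero and $l=0$ (`IsChartGeodesic.eq_zero_of_annihilates`).

By duality the first variations and the radial vector span the $2n$-dimensional phase space. A basis
containing the radial vector selects $2n-1$ functions $f_i$, and $f_s=\sum s_if_i$ is the family
sought. -/

noncomputable section

/-! ### Linear differential equations and Gronwall uniqueness. -/

section ODEFlows

open scoped NNReal

variable {E : Type*} [NormedAddCommGroup E] [NormedSpace ℝ E]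

theorem HasDerivWithinAt.Ici_of_Icc {f : ℝ → E} {f' : E} {a b t : ℝ}
    (h : HasDerivWithinAt f f' (Icc a b) t) (ht : t ∈ Ico a b) :
    HasDerivWithinAt f f' (Ici t) t :=
  h.mono_of_mem_nhdsWithin (Icc_mem_nhdsGE_of_mem ht)

/-- A bounded, globally Lipschitz time-dependent vector field has solutions on any compact
interval. -/
theorem exists_solution_of_bounded_of_lipschitz [CompleteSpace E] {f : ℝ → E → E} {K L : ℝ≥0}
    {a b : ℝ} (hab : a ≤ b) (hf : ∀ t ∈ Icc a b, LipschitzWith K (f t))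
    (hc : ∀ x, ContinuousOn (f · x) (Icc a b)) (hb : ∀ t ∈ Icc a b, ∀ x, ‖f t x‖ ≤ L) (x : E) :
    ∃ α : ℝ → E, α a = x ∧ ∀ t ∈ Icc a b, HasDerivWithinAt α (f t (α t)) (Icc a b) t := by
  have h : IsPicardLindelof f (tmin := a) (tmax := b) ⟨a, left_mem_Icc.2 hab⟩ x
      (L * (b - a).toNNReal) 0 L K :=
    { lipschitzOnWith := fun t ht => (hf t ht).lipschitzOnWith
      continuousOn := fun x _ => hc x
      norm_le := fun t ht x _ => hb t ht x
      mul_max_le := by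
        have : 0 ≤ b - a := by linarith
        simp [this] }
  exact h.exists_eq_forall_mem_Icc_hasDerivWithinAt₀

/-- Linear equations have solutions on any compact interval. -/
theorem exists_solution_linear [FiniteDimensional ℝ E] {A : ℝ → E →L[ℝ] E} {a b : ℝ}
    (hab : a ≤ b) (hA : ContinuousOn A (Icc a b)) (x : E) :
    ∃ w : ℝ → E, w a = x ∧ ∀ t ∈ Icc a b, HasDerivWithinAt w (A t (w t)) (Icc a b) t := by
  have : CompleteSpace E := FiniteDimensional.complete ℝ E
  obtain ⟨C, hC⟩ := isCompact_Icc.exists_bound_of_continuousOn hA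
  have hC0 : 0 ≤ C := (norm_nonneg _).trans (hC a (left_mem_Icc.2 hab))
  -- Gronwall's a priori bound for the linear equation. The cutoff `ρ` makes the field bounded and
  -- Lipschitz and never lengthens a vector, so the same bound holds for the truncated equation and
  -- its solution stays where the cutoff is one.
  set R : ℝ := ‖x‖ * Real.exp (C * (b - a)) with hR
  have hR0 : 0 ≤ R := by positivity
  let χ : ContDiffBump (0 : E) := ⟨R + 1, R + 2, by linarith, by linarith⟩
  let ρ : E → E := fun w => χ w • w
  have hρs : ContDiff ℝ 1 ρ := χ.contDiff.smul contDiff_id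
  have hρc : HasCompactSupport ρ := χ.hasCompactSupport.smul_right
  obtain ⟨K, hK⟩ := hρs.lipschitzWith_of_hasCompactSupport hρc (by norm_num)
  obtain ⟨B, hB⟩ := hρs.continuous.bounded_above_of_compact_support hρc
  have hB0 : 0 ≤ B := (norm_nonneg _).trans (hB 0)
  have hρle : ∀ w, ‖ρ w‖ ≤ ‖w‖ := fun w => by
    rw [norm_smul, Real.norm_of_nonneg χ.nonneg]
    exact mul_le_of_le_one_left (norm_nonneg _) χ.le_one
  obtain ⟨w, hw0, hw⟩ := exists_solution_of_bounded_of_lipschitz (f := fun t w => A t (ρ w))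
    (K := C.toNNReal * K) (L := (C * B).toNNReal) hab
    (fun t ht => LipschitzWith.comp
      ((A t).lipschitz.weaken (by
        rw [← NNReal.coe_le_coe, coe_nnnorm, Real.coe_toNNReal _ hC0]; exact hC t ht)) hK)
    (fun x => hA.clm_apply continuousOn_const)
    (fun t ht x => by
      rw [Real.coe_toNNReal _ (by positivity)]
      exact ((A t).le_opNorm _).trans (mul_le_mul (hC t ht) (hB x) (norm_nonneg _) hC0)) x
  have hbound : ∀ t ∈ Icc a b, ‖w t‖ ≤ gronwallBound ‖x‖ C 0 (t - a) :=
    norm_le_gronwallBound_of_norm_deriv_right_le (fun t ht => (hw t ht).continuousWithinAt)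
      (fun t ht => (hw t (Ico_subset_Icc_self ht)).Ici_of_Icc ht) (by rw [hw0])
      (fun t ht => by
        rw [add_zero]
        exact ((A t).le_opNorm _).trans
          (mul_le_mul (hC t (Ico_subset_Icc_self ht)) (hρle _) (norm_nonneg _) hC0))
  refine ⟨w, hw0, fun t ht => ?_⟩
  have hχ : χ (w t) = 1 := by
    apply χ.one_of_mem_closedBall
    rw [mem_closedBall_zero_iff]
    have h1 := hbound t ht
    rw [gronwallBound_ε0] at h1
    have h2 : ‖x‖ * Real.exp (C * (t - a)) ≤ R := by
      rw [hR]; gcongr; exact ht.2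
    show ‖w t‖ ≤ R + 1
    linarith
  have := hw t ht
  simpa only [ρ, hχ, one_smul] using this

/-- Solutions of a linear inequality `‖w'‖ ≤ C ‖w‖` which vanish somewhere vanish identically. -/
theorem eq_zero_of_norm_deriv_le {w w' : ℝ → E} {C a b s : ℝ} (hs : s ∈ Icc a b)
    (hw : ∀ t ∈ Icc a b, HasDerivWithinAt w (w' t) (Icc a b) t)
    (hC : ∀ t ∈ Icc a b, ‖w' t‖ ≤ C * ‖w t‖) (h0 : w s = 0) : ∀ t ∈ Icc a b, w t = 0 := by
  intro t ht
  have hcont : ContinuousOn w (Icc a b) := fun t ht => (hw t ht).continuousWithinAt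
  rcases le_total s t with hst | hts
  · refine eq_zero_of_abs_deriv_le_mul_abs_self_of_eq_zero_right (f := w) (f' := w') (K := C)
      (a := s) (b := b) (hcont.mono (Icc_subset_Icc_left hs.1)) (fun x hx => ?_) h0
      (fun x hx => hC x ⟨hs.1.trans hx.1, hx.2.le⟩) t ⟨hst, ht.2⟩
    exact (hw x ⟨hs.1.trans hx.1, hx.2.le⟩).Ici_of_Icc ⟨hs.1.trans hx.1, hx.2⟩
  · have hmaps : MapsTo (fun u : ℝ => -u) (Icc (-s) (-a)) (Icc a b) := fun u hu =>
      ⟨by linarith [hu.2], by linarith [hu.1, hs.2]⟩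
    have key := eq_zero_of_abs_deriv_le_mul_abs_self_of_eq_zero_right (f := fun u => w (-u))
      (f' := fun u => -w' (-u)) (K := C) (a := -s) (b := -a)
      (hcont.comp continuousOn_neg hmaps) (fun x hx => ?_) (by simpa using h0)
      (fun x hx => by rw [norm_neg]; exact hC _ (hmaps (Ico_subset_Icc_self hx)))
      (-t) ⟨by linarith, by linarith [ht.1]⟩
    · simpa using key
    · have h1 := (hw (-x) (hmaps (Ico_subset_Icc_self hx)))
      have h2 := HasDerivWithinAt.scomp (t' := Icc a b) x h1
        ((hasDerivAt_neg x).hasDerivWithinAt (s := Icc (-s) (-a))) hmaps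
      simp only [neg_smul, one_smul] at h2
      exact h2.Ici_of_Icc hx

/-- The fundamental solution of a linear equation, together with its inverse. -/
theorem exists_fundamental_solution [FiniteDimensional ℝ E] {A : ℝ → E →L[ℝ] E} {a b : ℝ}
    (hab : a ≤ b) (hA : ContinuousOn A (Icc a b)) :
    ∃ Y Z : ℝ → E →L[ℝ] E, Y a = ContinuousLinearMap.id ℝ E ∧ Z a = ContinuousLinearMap.id ℝ E ∧
      (∀ t ∈ Icc a b, HasDerivWithinAt Y (A t ∘L Y t) (Icc a b) t) ∧
      (∀ t ∈ Icc a b, HasDerivWithinAt Z (-(Z t ∘L A t)) (Icc a b) t) ∧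
      ∀ t ∈ Icc a b, (∀ v, Z t (Y t v) = v) ∧ ∀ v, Y t (Z t v) = v := by
  obtain ⟨Y, hY0, hY⟩ := exists_solution_linear
    (A := fun t => ContinuousLinearMap.compL ℝ E E E (A t)) hab
    ((ContinuousLinearMap.compL ℝ E E E).continuous.comp_continuousOn hA)
    (ContinuousLinearMap.id ℝ E)
  obtain ⟨Z, hZ0, hZ⟩ := exists_solution_linear
    (A := fun t => -(ContinuousLinearMap.compL ℝ E E E).flip (A t)) hab
    (((ContinuousLinearMap.compL ℝ E E E).flip.continuous.comp_continuousOn hA).neg)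
    (ContinuousLinearMap.id ℝ E)
  simp only [ContinuousLinearMap.compL_apply, neg_apply,
    ContinuousLinearMap.flip_apply] at hY hZ
  refine ⟨Y, Z, hY0, hZ0, hY, hZ, fun t ht => ?_⟩
  have hZY : Z t ∘L Y t = ContinuousLinearMap.id ℝ E := by
    have hconst : ∀ t ∈ Icc a b, Z t ∘L Y t - ContinuousLinearMap.id ℝ E = 0 := by
      refine eq_zero_of_norm_deriv_le (w' := fun _ => 0) (C := 0) (left_mem_Icc.2 hab)
        (fun t ht => ?_) (by simp) (by simp [hY0, hZ0])
      have h := ((hZ t ht).clm_comp (hY t ht)).sub_const (ContinuousLinearMap.id ℝ E)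
      convert h using 1
      ext v
      simp
    exact sub_eq_zero.1 (hconst t ht)
  have h1 : ∀ v, Z t (Y t v) = v := fun v => by
    have := congrArg (fun L : E →L[ℝ] E => L v) hZY
    simpa using this
  refine ⟨h1, fun v => ?_⟩
  -- The differential equations only give the left inverse; the right inverse comes from finite
  -- dimension.
  have hinj : Function.Injective (Y t : E →ₗ[ℝ] E) := fun v v' h => by
    rw [← h1 v, ← h1 v']; exact congrArg (Z t) h
  obtain ⟨u, hu⟩ := LinearMap.injective_iff_surjective.1 hinj v
  have hu' : Y t u = v := hu
  rw [← hu', h1]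

end ODEFlows

/-! ### Differentiability of a flow in its initial value. -/

section ODEFlows

open scoped NNReal

variable {E : Type*} [NormedAddCommGroup E] [NormedSpace ℝ E] [FiniteDimensional ℝ E]

/-- A vector field of class `C¹` on an open set agrees, near any compact subset of it, with a
compactly supported vector field of class `C¹` on the whole space. -/
theorem exists_contDiff_hasCompactSupport_eqOn {V : E → E} {Ω K : Set E} (hΩ : IsOpen Ω)
    (hV : ContDiffOn ℝ 1 V Ω) (hK : IsCompact K) (hKΩ : K ⊆ Ω) :
    ∃ V' : E → E, ContDiff ℝ 1 V' ∧ HasCompactSupport V' ∧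
      ∃ N, IsOpen N ∧ K ⊆ N ∧ N ⊆ Ω ∧ EqOn V' V N := by
  obtain ⟨L, hL, hKL, hLΩ⟩ := exists_compact_between hK hΩ hKΩ
  obtain ⟨χ, hχ1, hχ0, -⟩ := exists_contMDiffMap_one_nhds_of_subset_interior 𝓘(ℝ, E) (n := 1)
    hK.isClosed hKL
  have hχs : ContDiff ℝ 1 χ := χ.contMDiff.contDiff
  have hsupp : tsupport (fun x => χ x • V x) ⊆ L := by
    refine closure_minimal (fun x hx => ?_) hL.isClosed
    by_contra h
    exact hx (by simp [hχ0 x h])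
  obtain ⟨N, hN, hKN, hN1⟩ := mem_nhdsSet_iff_exists.1 hχ1
  refine ⟨fun x => χ x • V x, ?_, hL.of_isClosed_subset (isClosed_tsupport _) hsupp,
    N ∩ Ω, hN.inter hΩ, subset_inter hKN hKΩ, inter_subset_right, fun x hx => ?_⟩
  · refine contDiff_iff_contDiffAt.2 fun x => ?_
    by_cases hx : x ∈ Ω
    · exact hχs.contDiffAt.smul (hV.contDiffAt (hΩ.mem_nhds hx))
    · have : x ∉ tsupport (fun x => χ x • V x) := fun h => hx (hLΩ (hsupp h))
      exact (contDiffAt_const (c := (0 : E))).congr_of_eventuallyEq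
        (notMem_tsupport_iff_eventuallyEq.1 this)
  · have h1 : χ x = 1 := hN1 hx.1
    simp [h1]

omit [FiniteDimensional ℝ E] in
/-- The derivative of a compactly supported `C¹` map is uniformly continuous, in quantitative
form. -/
theorem ContDiff.exists_uniform_linear_approx {V : E → E} (hV : ContDiff ℝ 1 V)
    (hVc : HasCompactSupport V) {η : ℝ} (hη : 0 < η) :
    ∃ δ > 0, ∀ x k : E, ‖k‖ < δ → ‖V (x + k) - V x - fderiv ℝ V x k‖ ≤ η * ‖k‖ := by
  have hcont : Continuous (fderiv ℝ V) := hV.continuous_fderiv (by norm_num)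
  have huc : UniformContinuous (fderiv ℝ V) :=
    Continuous.uniformContinuous_of_tendsto_cocompact hcont
      ((hVc.fderiv ℝ).is_zero_at_infty)
  obtain ⟨δ, hδ, h⟩ := Metric.uniformContinuous_iff.1 huc η hη
  refine ⟨δ, hδ, fun x k hk => ?_⟩
  have hx : x ∈ Metric.ball x δ := Metric.mem_ball_self hδ
  have hxk : x + k ∈ Metric.ball x δ := by simpa [Metric.mem_ball, dist_eq_norm] using hk
  have := (convex_ball x δ).norm_image_sub_le_of_norm_fderiv_le' (𝕜 := ℝ) (f := V)
    (φ := fderiv ℝ V x) (C := η)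
    (fun y _ => (hV.differentiable (by norm_num)) y)
    (fun y hy => by rw [← dist_eq_norm]; exact (h hy).le) hx hxk
  simpa using this

/-- The flow of a `C¹` vector field exists near any compact integral curve, and it is
differentiable along that curve; its differential is the fundamental solution of the linearised
equation. -/
theorem exists_flow_hasFDerivAt {V : E → E} {Ω : Set E} (hΩ : IsOpen Ω)
    (hV : ContDiffOn ℝ 1 V Ω) {γ : ℝ → E} {a b : ℝ} (hab : a ≤ b)
    (hγΩ : ∀ t ∈ Icc a b, γ t ∈ Ω)
    (hγ : ∀ t ∈ Icc a b, HasDerivWithinAt γ (V (γ t)) (Icc a b) t)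
    {Y : ℝ → E →L[ℝ] E} (hY0 : Y a = ContinuousLinearMap.id ℝ E)
    (hY : ∀ t ∈ Icc a b, HasDerivWithinAt Y (fderiv ℝ V (γ t) ∘L Y t) (Icc a b) t) :
    ∃ Φ : E → ℝ → E,
      (∀ᶠ z in 𝓝 (γ a), Φ z a = z ∧ ∀ t ∈ Icc a b, Φ z t ∈ Ω ∧
        HasDerivWithinAt (Φ z) (V (Φ z t)) (Icc a b) t) ∧
      Φ (γ a) b = γ b ∧ HasFDerivAt (fun z => Φ z b) (Y b) (γ a) := by
  have hcomplete : CompleteSpace E := FiniteDimensional.complete ℝ E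
  have hγc : ContinuousOn γ (Icc a b) := fun t ht => (hγ t ht).continuousWithinAt
  have hK : IsCompact (γ '' Icc a b) := isCompact_Icc.image_of_continuousOn hγc
  obtain ⟨W, hW, hWc, N, hN, hKN, hNΩ, hWV⟩ := exists_contDiff_hasCompactSupport_eqOn hΩ hV hK
    (image_subset_iff.2 hγΩ)
  obtain ⟨L, hL⟩ := hW.lipschitzWith_of_hasCompactSupport hWc (by norm_num)
  obtain ⟨B, hB⟩ := hW.continuous.bounded_above_of_compact_support hWc
  have hB0 : 0 ≤ B := (norm_nonneg _).trans (hB 0)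
  -- The truncated field `W` has trajectories from every point over all of $[a,b]$. Those starting
  -- near `γ a` stay in `N`, where `W` is the original field.
  choose Φ hΦ0 hΦ using fun x => exists_solution_of_bounded_of_lipschitz
    (f := fun _ => W) (K := L) (L := B.toNNReal) hab (fun _ _ => hL) (fun _ => continuousOn_const)
    (fun _ _ x => by rw [Real.coe_toNNReal _ hB0]; exact hB x) x
  have hΦc : ∀ x, ContinuousOn (Φ x) (Icc a b) := fun x t ht => (hΦ x t ht).continuousWithinAt
  have hγW : ∀ t ∈ Icc a b, HasDerivWithinAt γ (W (γ t)) (Icc a b) t := fun t ht => by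
    rw [hWV (hKN (mem_image_of_mem γ ht))]; exact hγ t ht
  have hdist : ∀ z, ∀ t ∈ Icc a b, dist (Φ z t) (γ t) ≤ dist z (γ a) * Real.exp (L * (b - a)) := by
    intro z t ht
    refine (dist_le_of_trajectories_ODE (v := fun _ => W) (fun _ => hL) (hΦc z)
      (fun t ht => (hΦ z t (Ico_subset_Icc_self ht)).Ici_of_Icc ht) hγc
      (fun t ht => (hγW t (Ico_subset_Icc_self ht)).Ici_of_Icc ht)
      (by rw [hΦ0 z]) t ht).trans ?_
    gcongr
    exact ht.2
  have hΦγ : ∀ t ∈ Icc a b, Φ (γ a) t = γ t := fun t ht => by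
    have := hdist (γ a) t ht
    rwa [dist_self, zero_mul, dist_le_zero] at this
  refine ⟨Φ, ?_, hΦγ b (right_mem_Icc.2 hab), ?_⟩
  · obtain ⟨δ, hδ, hδN⟩ := hK.exists_thickening_subset_open hN hKN
    have hev : ∀ᶠ z in 𝓝 (γ a), dist z (γ a) * Real.exp (L * (b - a)) < δ := by
      have : ContinuousAt (fun z => dist z (γ a) * Real.exp (L * (b - a))) (γ a) := by fun_prop
      exact this.eventually_lt_const (by simpa using hδ)
    filter_upwards [hev] with z hz
    refine ⟨hΦ0 z, fun t ht => ?_⟩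
    have hmem : Φ z t ∈ N := hδN <| Metric.mem_thickening_iff.2
      ⟨γ t, mem_image_of_mem γ ht, (hdist z t ht).trans_lt hz⟩
    refine ⟨hNΩ hmem, ?_⟩
    rw [← hWV hmem]
    exact hΦ z t ht
  · have hYc : ContinuousOn Y (Icc a b) := fun t ht => (hY t ht).continuousWithinAt
    obtain ⟨C, hC⟩ := isCompact_Icc.exists_bound_of_continuousOn hYc
    have hC0 : 0 ≤ C := (norm_nonneg _).trans (hC a (left_mem_Icc.2 hab))
    have hfd : ∀ t ∈ Icc a b, fderiv ℝ W (γ t) = fderiv ℝ V (γ t) := fun t ht =>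
      (hWV.eventuallyEq_of_mem (hN.mem_nhds (hKN (mem_image_of_mem γ ht)))).fderiv_eq
    set G : ℝ := gronwallBound 0 L 1 (b - a) with hG
    have hG0 : 0 ≤ G := by
      have := gronwallBound_mono (δ := 0) (ε := 1) (K := L) le_rfl zero_le_one L.2
        (sub_nonneg.2 hab)
      rwa [gronwallBound_x0] at this
    have hGlin : ∀ ε, gronwallBound 0 L ε (b - a) = ε * G := fun ε => by
      rw [hG]
      by_cases hL0 : (L : ℝ) = 0
      · rw [hL0]; simp [gronwallBound_K0]
      · simp only [gronwallBound_of_K_ne_0 hL0]; ring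
    rw [hasFDerivAt_iff_isLittleO_nhds_zero, Asymptotics.isLittleO_iff]
    intro c hc
    -- The curve $\gamma+Yh$ solves the equation up to a defect $\eta C\|h\|$. Gronwall multiplies
    -- the defect by $G$, so $\eta$ is chosen to make $\eta CG\le c$; the `+ 1` keeps the
    -- denominator positive.
    set η : ℝ := c / (C * G + 1) with hη
    have hη0 : 0 < η := by positivity
    obtain ⟨δ, hδ, hδW⟩ := hW.exists_uniform_linear_approx hWc hη0
    have hev : ∀ᶠ h in 𝓝 (0 : E), C * ‖h‖ < δ := by
      have : ContinuousAt (fun h : E => C * ‖h‖) 0 := by fun_prop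
      exact this.eventually_lt_const (by simpa using hδ)
    filter_upwards [hev] with h hh
    have hYh : ∀ t ∈ Icc a b, ‖Y t h‖ ≤ C * ‖h‖ := fun t ht =>
      ((Y t).le_opNorm h).trans (mul_le_mul_of_nonneg_right (hC t ht) (norm_nonneg _))
    have happrox : ∀ t ∈ Icc a b, HasDerivWithinAt (fun t => γ t + Y t h)
        (W (γ t) + fderiv ℝ W (γ t) (Y t h)) (Icc a b) t := fun t ht => by
      have h1 := (hγW t ht).fun_add ((hY t ht).clm_apply (hasDerivWithinAt_const t _ h))
      rw [hfd t ht]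
      simpa using h1
    have hle := dist_le_of_approx_trajectories_ODE (v := fun _ => W) (fun _ => hL)
      (f := Φ (γ a + h)) (g := fun t => γ t + Y t h)
      (f' := fun t => W (Φ (γ a + h) t)) (g' := fun t => W (γ t) + fderiv ℝ W (γ t) (Y t h))
      (εf := 0) (εg := η * (C * ‖h‖)) (δ := 0) (hΦc _)
      (fun t ht => (hΦ _ t (Ico_subset_Icc_self ht)).Ici_of_Icc ht) (by simp)
      (fun t ht => (happrox t ht).continuousWithinAt)
      (fun t ht => (happrox t (Ico_subset_Icc_self ht)).Ici_of_Icc ht)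
      (fun t ht => by
        have ht' := Ico_subset_Icc_self ht
        have h1 := hδW (γ t) (Y t h) ((hYh t ht').trans_lt hh)
        rw [dist_comm, dist_eq_norm]
        calc ‖W (γ t + Y t h) - (W (γ t) + fderiv ℝ W (γ t) (Y t h))‖
            = ‖W (γ t + Y t h) - W (γ t) - fderiv ℝ W (γ t) (Y t h)‖ := by rw [sub_sub]
          _ ≤ η * ‖Y t h‖ := h1
          _ ≤ η * (C * ‖h‖) := by gcongr; exact hYh t ht')
      (by rw [hΦ0, hY0]; simp) b (right_mem_Icc.2 hab)
    rw [zero_add, hGlin, dist_eq_norm, ← sub_sub] at hle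
    show ‖Φ (γ a + h) b - Φ (γ a) b - Y b h‖ ≤ c * ‖h‖
    rw [hΦγ b (right_mem_Icc.2 hab)]
    refine hle.trans ?_
    have : η * (C * G) ≤ c := by
      rw [hη, div_mul_eq_mul_div, div_le_iff₀ (by positivity)]
      nlinarith
    calc η * (C * ‖h‖) * G = η * (C * G) * ‖h‖ := by ring
      _ ≤ c * ‖h‖ := by gcongr

end ODEFlows

/-! ### Integral curves on manifolds: charts, uniqueness, concatenation. -/

section IntegralCurves

variable {E : Type*} [NormedAddCommGroup E] [NormedSpace ℝ E]
  {H : Type*} [TopologicalSpace H] {I : ModelWithCorners ℝ E H}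
  {N : Type*} [TopologicalSpace N] [ChartedSpace H N]

/-- The representative of a vector field in the preferred chart at `z₀`. -/
def chartField (X : (z : N) → TangentSpace I z) (z₀ : N) (y : E) : E :=
  mfderiv I 𝓘(ℝ, E) (extChartAt I z₀) ((extChartAt I z₀).symm y) (X ((extChartAt I z₀).symm y))

/-- A vector field whose representatives in all preferred charts are of class `C¹`. -/
def IsC1Field (X : (z : N) → TangentSpace I z) : Prop :=
  ∀ z₀, ContDiffOn ℝ 1 (chartField X z₀) (extChartAt I z₀).target

variable [IsManifold I 1 N] {X : (z : N) → TangentSpace I z} {γ γ' : ℝ → N} {s : Set ℝ} {t : ℝ}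

omit [IsManifold I 1 N] in
theorem hasMFDerivWithinAt_smulRight_iff {f : ℝ → E} {v : E} :
    HasMFDerivWithinAt 𝓘(ℝ, ℝ) 𝓘(ℝ, E) f s t ((1 : ℝ →L[ℝ] ℝ).smulRight v) ↔
      HasDerivWithinAt f v s t := by
  refine ⟨fun h => ?_, fun h => hasMFDerivWithinAt_iff_hasFDerivWithinAt.2 ?_⟩
  · have h' : HasFDerivWithinAt f ((1 : ℝ →L[ℝ] ℝ).smulRight v : ℝ →L[ℝ] E) s t :=
      hasMFDerivWithinAt_iff_hasFDerivWithinAt.1 h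
    exact h'.hasDerivWithinAt.congr_deriv (one_smul ℝ v)
  · refine h.hasFDerivWithinAt.congr_fderiv ?_
    ext
    rfl

omit [IsManifold I 1 N] in
theorem HasMFDerivWithinAt.hasDerivWithinAt_comp {F : Type*} [NormedAddCommGroup F]
    [NormedSpace ℝ F] {f : N → F} {v : TangentSpace I (γ t)}
    {L : TangentSpace I (γ t) →L[ℝ] F}
    (hγ : HasMFDerivWithinAt 𝓘(ℝ, ℝ) I γ s t ((1 : ℝ →L[ℝ] ℝ).smulRight v))
    (hf : HasMFDerivAt I 𝓘(ℝ, F) f (γ t) L) :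
    HasDerivWithinAt (f ∘ γ) (L v) s t := by
  have h := hf.comp_hasMFDerivWithinAt t hγ
  refine hasMFDerivWithinAt_smulRight_iff.1 (h.congr_mfderiv ?_)
  ext
  refine (congrArg _ (one_smul ℝ v)).trans ?_
  exact (one_smul ℝ (L v)).symm

theorem IsMIntegralCurveOn.hasDerivWithinAt_chartField (hγ : IsMIntegralCurveOn γ X s)
    (ht : t ∈ s) {z₀ : N} (hsrc : γ t ∈ (extChartAt I z₀).source) :
    HasDerivWithinAt (extChartAt I z₀ ∘ γ) (chartField X z₀ (extChartAt I z₀ (γ t))) s t := by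
  have h := (hγ t ht).hasDerivWithinAt_comp
    (mdifferentiableAt_extChartAt (I := I) (x := z₀) (by simpa using hsrc)).hasMFDerivAt
  rw [chartField, (extChartAt I z₀).left_inv hsrc]
  exact h

theorem hasMFDerivWithinAt_extChartAt_symm_comp [I.Boundaryless] {z₀ : N} {y : ℝ → E}
    (hy : HasDerivWithinAt y (chartField X z₀ (y t)) s t) (hmem : y t ∈ (extChartAt I z₀).target) :
    HasMFDerivWithinAt 𝓘(ℝ, ℝ) I ((extChartAt I z₀).symm ∘ y) s t
      ((1 : ℝ →L[ℝ] ℝ).smulRight (X ((extChartAt I z₀).symm (y t)))) := by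
  have hy' := hasMFDerivWithinAt_smulRight_iff.2 hy
  have h1 := (mdifferentiableWithinAt_extChartAt_symm hmem).hasMFDerivWithinAt
  have h := h1.comp t hy' (fun x _ => by simp [I.range_eq_univ])
  refine h.congr_mfderiv ?_
  have h2 := mfderivWithin_extChartAt_symm_comp_mfderiv_extChartAt hmem
  have h3 := congrArg (fun L => L (X ((extChartAt I z₀).symm (y t)))) h2
  ext
  refine (congrArg _ (one_smul ℝ _)).trans ?_
  refine h3.trans ?_
  exact (one_smul ℝ (X ((extChartAt I z₀).symm (y t)))).symm

/-- Uniqueness of integral curves on a compact interval. -/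
theorem IsMIntegralCurveOn.eqOn_Icc [I.Boundaryless] [T2Space N] (hX : IsC1Field X) {a b t₀ : ℝ}
    (hγ : IsMIntegralCurveOn γ X (Icc a b)) (hγ' : IsMIntegralCurveOn γ' X (Icc a b))
    (ht₀ : t₀ ∈ Icc a b) (h : γ t₀ = γ' t₀) : EqOn γ γ' (Icc a b) := by
  have hpre : PreconnectedSpace (Icc a b) :=
    isPreconnected_iff_preconnectedSpace.1 isPreconnected_Icc
  have hc : Continuous fun t : Icc a b => γ t := continuousOn_iff_continuous_domRestrict.1 hγ.continuousOn
  have hc' : Continuous fun t : Icc a b => γ' t :=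
    continuousOn_iff_continuous_domRestrict.1 hγ'.continuousOn
  -- The agreement set is closed because the manifold is Hausdorff, and open by Gronwall in a chart;
  -- the interval is connected.
  suffices hclopen : IsClopen {t : Icc a b | γ t = γ' t} by
    have huniv := hclopen.eq_univ ⟨⟨t₀, ht₀⟩, h⟩
    intro t ht
    have : (⟨t, ht⟩ : Icc a b) ∈ {t : Icc a b | γ t = γ' t} := huniv ▸ mem_univ _
    exact this
  refine ⟨isClosed_eq hc hc', isOpen_iff_mem_nhds.2 ?_⟩
  rintro ⟨t₁, ht₁⟩ (h₁ : γ t₁ = γ' t₁)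
  set c := extChartAt I (γ t₁) with hcdef
  have hsrc : c.source ∈ 𝓝 (γ t₁) := extChartAt_source_mem_nhds _
  have hmem : γ t₁ ∈ c.source := mem_of_mem_nhds hsrc
  obtain ⟨K, u, hu, hK⟩ := ((hX (γ t₁)).contDiffAt (extChartAt_target_mem_nhds (γ t₁))
    |>.exists_lipschitzOnWith)
  have hu' : c ⁻¹' u ∈ 𝓝 (γ t₁) := (continuousAt_extChartAt (γ t₁)).preimage_mem_nhds hu
  have hw : c.source ∩ c ⁻¹' u ∈ 𝓝 (γ t₁) := inter_mem hsrc hu'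
  have hn : ∀ᶠ t in 𝓝[Icc a b] t₁, γ t ∈ c.source ∩ c ⁻¹' u :=
    hγ.continuousOn t₁ ht₁ hw
  have hn' : ∀ᶠ t in 𝓝[Icc a b] t₁, γ' t ∈ c.source ∩ c ⁻¹' u :=
    hγ'.continuousOn t₁ ht₁ (h₁ ▸ hw)
  obtain ⟨δ, hδ, hball⟩ := Metric.mem_nhdsWithin_iff.1 (hn.and hn')
  set a' := max a (t₁ - δ / 2)
  set b' := min b (t₁ + δ / 2)
  have hsub : Icc a' b' ⊆ Icc a b := Icc_subset_Icc (le_max_left _ _) (min_le_left _ _)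
  have hin : ∀ t ∈ Icc a' b', (γ t ∈ c.source ∩ c ⁻¹' u) ∧ γ' t ∈ c.source ∩ c ⁻¹' u := by
    intro t ht
    refine hball ⟨?_, hsub ht⟩
    have h1 := (le_max_right _ _).trans ht.1
    have h2 := ht.2.trans (min_le_right _ _)
    rw [Metric.mem_ball, Real.dist_eq, abs_lt]
    constructor <;> linarith
  have ht₁' : t₁ ∈ Icc a' b' :=
    ⟨max_le ht₁.1 (by linarith), le_min ht₁.2 (by linarith)⟩
  have hzero := eq_zero_of_norm_deriv_le (w := fun t => c (γ t) - c (γ' t))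
    (w' := fun t => chartField X (γ t₁) (c (γ t)) - chartField X (γ t₁) (c (γ' t)))
    (C := K) ht₁'
    (fun t ht => ((hγ.hasDerivWithinAt_chartField (hsub ht) (hin t ht).1.1).mono hsub).sub
      ((hγ'.hasDerivWithinAt_chartField (hsub ht) (hin t ht).2.1).mono hsub))
    (fun t ht => by
      have := hK.dist_le_mul _ (hin t ht).1.2 _ (hin t ht).2.2
      rwa [dist_eq_norm, dist_eq_norm] at this) (by simp [h₁])
  have hnear : {t : Icc a b | |(t : ℝ) - t₁| < δ / 2} ∈ 𝓝 (⟨t₁, ht₁⟩ : Icc a b) := by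
    have : IsOpen {t : Icc a b | |(t : ℝ) - t₁| < δ / 2} :=
      isOpen_lt (by fun_prop) continuous_const
    exact this.mem_nhds (by simpa using hδ)
  filter_upwards [hnear] with t ht
  replace ht := abs_lt.1 ht
  have htmem : (t : ℝ) ∈ Icc a' b' :=
    ⟨max_le t.2.1 (by linarith), le_min t.2.2 (by linarith)⟩
  exact c.injOn (hin t htmem).1.1 (hin t htmem).2.1 (sub_eq_zero.1 (hzero t htmem))

omit [IsManifold I 1 N] in
/-- Concatenation of two integral curves. -/
theorem IsMIntegralCurveOn.ite_Icc {a b c : ℝ} (hab : a ≤ b) (hbc : b ≤ c)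
    (hγ : IsMIntegralCurveOn γ X (Icc a b)) (hγ' : IsMIntegralCurveOn γ' X (Icc b c))
    (h : γ b = γ' b) :
    IsMIntegralCurveOn (fun t => if t ≤ b then γ t else γ' t) X (Icc a c) := by
  set σ : ℝ → N := fun t => if t ≤ b then γ t else γ' t with hσ
  have e1 : ∀ t ∈ Icc a b, σ t = γ t := fun t ht => if_pos ht.2
  have e2 : ∀ t ∈ Icc b c, σ t = γ' t := fun t ht => by
    rcases ht.1.eq_or_lt with rfl | hlt
    · simp [hσ, h]
    · exact if_neg (not_le.2 hlt)
  have d1 : IsMIntegralCurveOn σ X (Icc a b) := fun t ht => by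
    rw [e1 t ht]
    exact (hγ t ht).congr_of_eventuallyEq (eventually_of_mem self_mem_nhdsWithin e1) (e1 t ht)
  have d2 : IsMIntegralCurveOn σ X (Icc b c) := fun t ht => by
    rw [e2 t ht]
    exact (hγ' t ht).congr_of_eventuallyEq (eventually_of_mem self_mem_nhdsWithin e2) (e2 t ht)
  intro t ht
  rcases lt_trichotomy t b with hlt | heq | hgt
  · refine (d1 t ⟨ht.1, hlt.le⟩).mono_of_mem_nhdsWithin ?_
    filter_upwards [self_mem_nhdsWithin, mem_nhdsWithin_of_mem_nhds (Iio_mem_nhds hlt)] with u hu hu'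
    exact ⟨hu.1, le_of_lt hu'⟩
  · subst heq
    have := (d1 t ⟨hab, le_rfl⟩).union (d2 t ⟨le_rfl, hbc⟩)
    rwa [Icc_union_Icc_eq_Icc hab hbc] at this
  · refine (d2 t ⟨hgt.le, ht.2⟩).mono_of_mem_nhdsWithin ?_
    filter_upwards [self_mem_nhdsWithin, mem_nhdsWithin_of_mem_nhds (Ioi_mem_nhds hgt)] with u hu hu'
    exact ⟨le_of_lt hu', hu.2⟩

end IntegralCurves

/-! ### Flows along compact integral curves are submersive. -/

section Flows

variable {E : Type*} [NormedAddCommGroup E] [NormedSpace ℝ E]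
  {H : Type*} [TopologicalSpace H] {I : ModelWithCorners ℝ E H}
  {N : Type*} [TopologicalSpace N] [ChartedSpace H N]
  {X : (z : N) → TangentSpace I z} {γ : ℝ → N} {O : Set N} {a b c : ℝ}

/-- The flow of `X` from time `a` to time `b` is defined near `γ a`, with trajectories in `O`, and
it is submersive at `γ a`, whose trajectory is `γ`. -/
def SubmersiveFlowOn (X : (z : N) → TangentSpace I z) (O : Set N) (γ : ℝ → N) (a b : ℝ) : Prop :=
  ∃ Φ : N → N, (∀ᶠ z in 𝓝 (γ a), ∃ σ : ℝ → N, σ a = z ∧ σ b = Φ z ∧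
      IsMIntegralCurveOn σ X (Icc a b) ∧ ∀ t ∈ Icc a b, σ t ∈ O) ∧
    Φ (γ a) = γ b ∧ MDifferentiableAt I I Φ (γ a) ∧
    Function.Surjective (mfderiv I I Φ (γ a))

theorem SubmersiveFlowOn.trans (hab : a ≤ b) (hbc : b ≤ c)
    (h₁ : SubmersiveFlowOn X O γ a b) (h₂ : SubmersiveFlowOn X O γ b c) :
    SubmersiveFlowOn X O γ a c := by
  obtain ⟨Φ, hΦ, hΦγ, hΦd, hΦs⟩ := h₁
  obtain ⟨Ψ, hΨ, hΨγ, hΨd, hΨs⟩ := h₂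
  rw [← hΦγ] at hΨ hΨd hΨs
  refine ⟨Ψ ∘ Φ, ?_, by rw [Function.comp_apply, hΦγ, hΨγ], hΨd.comp _ hΦd, ?_⟩
  · filter_upwards [hΦ, hΦd.continuousAt.eventually hΨ] with z hz hz'
    obtain ⟨σ, hσ0, hσ1, hσ, hσO⟩ := hz
    obtain ⟨σ', hσ0', hσ1', hσ', hσO'⟩ := hz'
    have hglue : σ b = σ' b := by rw [hσ1, hσ0']
    refine ⟨fun t => if t ≤ b then σ t else σ' t, by simp [hab, hσ0], ?_,
      hσ.ite_Icc hab hbc hσ' hglue, fun t ht => ?_⟩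
    · rcases hbc.eq_or_lt with rfl | hlt
      · simp [hglue, hσ1']
      · simp [not_le.2 hlt, hσ1']
    · by_cases h : t ≤ b
      · simpa [h] using hσO t ⟨ht.1, h⟩
      · simpa [h] using hσO' t ⟨(not_le.1 h).le, ht.2⟩
  · rw [mfderiv_comp _ hΨd hΦd]
    exact hΨs.comp hΦs

variable [IsManifold I 1 N] [I.Boundaryless] [FiniteDimensional ℝ E]

/-- In the chart the differential of the flow is the fundamental solution `Y b`, which has the right
inverse `Z b`; the chart and its inverse have invertible differentials. -/
theorem SubmersiveFlowOn.of_mem_chart (hX : IsC1Field X) (hO : IsOpen O) (hab : a ≤ b)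
    (hγ : IsMIntegralCurveOn γ X (Icc a b)) {z₀ : N}
    (hγO : ∀ t ∈ Icc a b, γ t ∈ (extChartAt I z₀).source ∩ O) : SubmersiveFlowOn X O γ a b := by
  set c := extChartAt I z₀ with hc
  have hΩ : IsOpen (c.target ∩ c.symm ⁻¹' O) :=
    (continuousOn_extChartAt_symm z₀).isOpen_inter_preimage (isOpen_extChartAt_target z₀) hO
  have hV : ContDiffOn ℝ 1 (chartField X z₀) (c.target ∩ c.symm ⁻¹' O) :=
    (hX z₀).mono inter_subset_left
  have hmemΩ : ∀ t ∈ Icc a b, (c ∘ γ) t ∈ c.target ∩ c.symm ⁻¹' O := fun t ht =>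
    ⟨c.map_source (hγO t ht).1, by
      rw [mem_preimage, Function.comp_apply, c.left_inv (hγO t ht).1]; exact (hγO t ht).2⟩
  have hd : ∀ t ∈ Icc a b,
      HasDerivWithinAt (c ∘ γ) (chartField X z₀ ((c ∘ γ) t)) (Icc a b) t := fun t ht =>
    hγ.hasDerivWithinAt_chartField ht (hγO t ht).1
  have hA : ContinuousOn (fun t => fderiv ℝ (chartField X z₀) ((c ∘ γ) t)) (Icc a b) :=
    (hV.continuousOn_fderiv_of_isOpen hΩ le_rfl).comp
      (fun t ht => (hd t ht).continuousWithinAt) hmemΩ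
  obtain ⟨Y, Z, hY0, -, hY, -, hYZ⟩ := exists_fundamental_solution hab hA
  obtain ⟨Φ, hΦ, hΦγ, hΦd⟩ := exists_flow_hasFDerivAt hΩ hV hab hmemΩ hd hY0 hY
  have ha := left_mem_Icc.2 hab
  have hb := right_mem_Icc.2 hab
  have hcd : MDifferentiableAt I 𝓘(ℝ, E) c (γ a) :=
    mdifferentiableAt_extChartAt (by simpa [hc] using (hγO a ha).1)
  have hΦd' : MDifferentiableAt 𝓘(ℝ, E) 𝓘(ℝ, E) (fun y => Φ y b) (c (γ a)) :=
    hΦd.differentiableAt.mdifferentiableAt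
  have hsd : MDifferentiableAt 𝓘(ℝ, E) I c.symm (Φ (c (γ a)) b) := by
    have := mdifferentiableWithinAt_extChartAt_symm (I := I) (x := z₀) (hmemΩ b hb).1
    rw [I.range_eq_univ, mdifferentiableWithinAt_univ] at this
    rw [show Φ (c (γ a)) b = (c ∘ γ) b from hΦγ]
    exact this
  have hd₂ : MDifferentiableAt I 𝓘(ℝ, E) ((fun y => Φ y b) ∘ c) (γ a) := hΦd'.comp _ hcd
  refine ⟨c.symm ∘ ((fun y => Φ y b) ∘ c), ?_, ?_, MDifferentiableAt.comp _ hsd hd₂, ?_⟩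
  · filter_upwards [(continuousAt_extChartAt' (hγO a ha).1).eventually hΦ,
      extChartAt_source_mem_nhds' (hγO a ha).1] with z hz hzs
    refine ⟨c.symm ∘ Φ (c z), ?_, rfl, fun t ht => ?_, fun t ht => (hz.2 t ht).1.2⟩
    · rw [Function.comp_apply, hz.1, c.left_inv hzs]
    · exact hasMFDerivWithinAt_extChartAt_symm_comp (hz.2 t ht).2 (hz.2 t ht).1.1
  · show c.symm (Φ ((c ∘ γ) a) b) = γ b
    rw [hΦγ, Function.comp_apply, c.left_inv (hγO b hb).1]
  · rw [mfderiv_comp (γ a) (f := (fun y => Φ y b) ∘ c) hsd hd₂, mfderiv_comp _ hΦd' hcd]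
    have s1 : Function.Surjective (mfderiv I 𝓘(ℝ, E) c (γ a)) :=
      (isInvertible_mfderiv_extChartAt (hγO a ha).1).surjective
    have s2 : Function.Surjective (mfderiv 𝓘(ℝ, E) 𝓘(ℝ, E) (fun y => Φ y b) (c (γ a))) := by
      have : mfderiv 𝓘(ℝ, E) 𝓘(ℝ, E) (fun y => Φ y b) (c (γ a)) = Y b := by
        rw [mfderiv_eq_fderiv]; exact hΦd.fderiv
      rw [this]
      exact fun v => ⟨Z b v, (hYZ b hb).2 v⟩
    have s3 : Function.Surjective (mfderiv 𝓘(ℝ, E) I c.symm (Φ (c (γ a)) b)) := by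
      have := isInvertible_mfderivWithin_extChartAt_symm (I := I) (x := z₀) (hmemΩ b hb).1
      rw [I.range_eq_univ, mfderivWithin_univ] at this
      rw [show Φ (c (γ a)) b = (c ∘ γ) b from hΦγ]
      exact this.surjective
    exact s3.comp (s2.comp s1)

/-- The flow of a `C¹` vector field along a compact integral curve is a submersion. -/
theorem IsMIntegralCurveOn.submersiveFlowOn (hX : IsC1Field X) (hO : IsOpen O) (hab : a ≤ b)
    (hγ : IsMIntegralCurveOn γ X (Icc a b)) (hγO : ∀ t ∈ Icc a b, γ t ∈ O) :
    SubmersiveFlowOn X O γ a b := by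
  have hcont : Continuous fun t : Icc a b => γ t :=
    continuousOn_iff_continuous_domRestrict.1 hγ.continuousOn
  -- Compactness divides the interval into finitely many pieces, each mapped into one chart; the
  -- pieces are joined by `SubmersiveFlowOn.trans`.
  obtain ⟨t, ht0, htm, ⟨m, hm⟩, ht⟩ := exists_monotone_Icc_subset_open_cover_Icc hab
    (c := fun z₀ : N => {t : Icc a b | γ t ∈ (extChartAt I z₀).source})
    (fun z₀ => (isOpen_extChartAt_source z₀).preimage hcont)
    (fun t _ => mem_iUnion.2 ⟨γ t, mem_extChartAt_source (γ t)⟩)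
  have key : ∀ k, SubmersiveFlowOn X O γ (t 0) (t k) := by
    intro k
    induction k with
    | zero =>
      refine SubmersiveFlowOn.of_mem_chart hX hO le_rfl
        (hγ.mono (Icc_subset_Icc (t 0).2.1 (t 0).2.2)) (z₀ := γ (t 0)) fun u hu => ?_
      rw [Icc_self, mem_singleton_iff] at hu
      rw [hu]
      exact ⟨mem_extChartAt_source _, hγO _ (t 0).2⟩
    | succ k ih =>
      obtain ⟨z₀, hz₀⟩ := ht k
      have hle : (t k : ℝ) ≤ t (k + 1) := htm k.le_succ
      have hsub : Icc (t k : ℝ) (t (k + 1)) ⊆ Icc a b :=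
        Icc_subset_Icc (t k).2.1 (t (k + 1)).2.2
      refine ih.trans (htm k.zero_le) hle ?_
      refine SubmersiveFlowOn.of_mem_chart hX hO hle (hγ.mono hsub) (z₀ := z₀) fun u hu => ?_
      exact ⟨hz₀ (show (⟨u, hsub hu⟩ : Icc a b) ∈ Icc (t k) (t (k + 1)) from ⟨hu.1, hu.2⟩),
        hγO u (hsub hu)⟩
  have := key m
  rwa [ht0, hm m le_rfl] at this

end Flows

/-! ### Hamiltonian vectors and symplectic linear algebra in coordinates. -/

section HamiltonianCoordinates

/-- Phase space `ℝⁿ × (ℝⁿ)*`. -/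
abbrev Phase (n : ℕ) : Type := Rn n × (Rn n →L[ℝ] ℝ)

variable {n : ℕ}

instance : NormedAddCommGroup (Phase n →L[ℝ] ℝ) := ContinuousLinearMap.toNormedAddCommGroup

instance : NormedSpace ℝ (Phase n →L[ℝ] ℝ) := ContinuousLinearMap.toNormedSpace

/-- The Hamiltonian vector associated with a differential on phase space. -/
def symplGrad (l : Phase n →L[ℝ] ℝ) : Phase n :=
  (∑ j, l (0, EuclideanSpace.proj j) • EuclideanSpace.single j (1 : ℝ),
    -(l.comp (ContinuousLinearMap.inl ℝ (Rn n) (Rn n →L[ℝ] ℝ))))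

theorem eq_sum_apply_single (η : Rn n →L[ℝ] ℝ) :
    η = ∑ j, η (EuclideanSpace.single j 1) • (EuclideanSpace.proj j : Rn n →L[ℝ] ℝ) := by
  ext v
  conv_lhs => rw [← (EuclideanSpace.basisFun (Fin n) ℝ).sum_repr v]
  simp [mul_comm]

theorem apply_symplGrad_fst (l : Phase n →L[ℝ] ℝ) (η : Rn n →L[ℝ] ℝ) :
    η (symplGrad l).1 = l (0, η) := by
  have h : (0, η) = ∑ j, η (EuclideanSpace.single j 1) •
      ((0, EuclideanSpace.proj j) : Phase n) := by
    ext1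
    · simp [Prod.fst_sum]
    · rw [Prod.snd_sum]
      exact eq_sum_apply_single η
  rw [h, map_sum, symplGrad, map_sum]
  simp only [map_smul, smul_eq_mul, mul_comm]

theorem symplGrad_snd_apply (l : Phase n →L[ℝ] ℝ) (v : Rn n) :
    (symplGrad l).2 v = -l (v, 0) := by
  simp [symplGrad]

theorem symplGrad_pairing (l : Phase n →L[ℝ] ℝ) (w : Phase n) :
    w.2 (symplGrad l).1 - (symplGrad l).2 w.1 = l w := by
  rw [apply_symplGrad_fst, symplGrad_snd_apply, sub_neg_eq_add, ← map_add]
  simp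

/-- Nondegeneracy of the symplectic form. It lets Hamiltonian vectors be recognised by their
pairings, without components. -/
theorem eq_symplGrad_of_pairing {l : Phase n →L[ℝ] ℝ} {u : Phase n}
    (h : ∀ w : Phase n, w.2 u.1 - u.2 w.1 = l w) : u = symplGrad l := by
  have h1 : ∀ w : Phase n, w.2 (u.1 - (symplGrad l).1) = (u.2 - (symplGrad l).2) w.1 := fun w => by
    have := (h w).trans (symplGrad_pairing l w).symm
    simp only [map_sub, sub_apply]
    linarith
  refine Prod.ext ?_ (ContinuousLinearMap.ext fun v => ?_)
  · ext j
    have := h1 (0, EuclideanSpace.proj j)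
    simpa [sub_eq_zero] using this
  · have h2 : (u.2 - (symplGrad l).2) v = 0 := by simpa using (h1 (v, 0)).symm
    simpa [sub_eq_zero] using h2

theorem symplGrad_add (l l' : Phase n →L[ℝ] ℝ) :
    symplGrad (l + l') = symplGrad l + symplGrad l' := by
  refine (eq_symplGrad_of_pairing fun w => ?_).symm
  have h1 := symplGrad_pairing l w
  have h2 := symplGrad_pairing l' w
  simp only [Prod.fst_add, Prod.snd_add, map_add, add_apply]
  linarith

theorem symplGrad_smul (a : ℝ) (l : Phase n →L[ℝ] ℝ) :
    symplGrad (a • l) = a • symplGrad l := by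
  refine (eq_symplGrad_of_pairing fun w => ?_).symm
  have h1 := symplGrad_pairing l w
  simp only [Prod.smul_fst, Prod.smul_snd, map_smul, smul_apply, smul_eq_mul]
  rw [← mul_sub, h1]

variable (n) in
/-- `symplGrad` as a continuous linear map. -/
def symplGradL : (Phase n →L[ℝ] ℝ) →L[ℝ] Phase n :=
  LinearMap.toContinuousLinearMap
    { toFun := symplGrad, map_add' := symplGrad_add, map_smul' := symplGrad_smul }

theorem symplGradL_apply (l : Phase n →L[ℝ] ℝ) : symplGradL n l = symplGrad l := rfl

/-- A surjective map preserving the canonical symplectic form commutes with Hamiltonian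
vectors. -/
theorem map_symplGrad_comp {L : Phase n →L[ℝ] Phase n} (hsurj : Function.Surjective L)
    (hL : ∀ u w : Phase n, (L w).2 (L u).1 - (L u).2 (L w).1 = w.2 u.1 - u.2 w.1)
    (l : Phase n →L[ℝ] ℝ) : L (symplGrad (l.comp L)) = symplGrad l := by
  refine eq_symplGrad_of_pairing fun w => ?_
  obtain ⟨w, rfl⟩ := hsurj w
  rw [hL, symplGrad_pairing]
  rfl

/-- The cotangent lift of a local diffeomorphism is symplectic. -/
theorem exists_hasFDerivAt_cotangentLift {ψ θ : Rn n → Rn n} {y₀ : Rn n} (ξ₀ : Rn n →L[ℝ] ℝ)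
    (hψ : ContDiffAt ℝ 2 ψ y₀) (hθ : ContDiffAt ℝ 2 θ (ψ y₀))
    (hinv : ∀ᶠ y in 𝓝 y₀, θ (ψ y) = y) :
    ∃ L : Phase n →L[ℝ] Phase n,
      HasFDerivAt (fun w : Phase n => ((ψ w.1, w.2 ∘L fderiv ℝ θ (ψ w.1)) : Phase n)) L (y₀, ξ₀) ∧
      ∀ u w : Phase n, (L w).2 (L u).1 - (L u).2 (L w).1 = w.2 u.1 - u.2 w.1 := by
  set A := fderiv ℝ ψ y₀
  set B := fderiv ℝ θ (ψ y₀)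
  set D := fderiv ℝ (fderiv ℝ θ) (ψ y₀)
  have hA : HasFDerivAt ψ A y₀ := (hψ.differentiableAt (by norm_num)).hasFDerivAt
  have hB : HasFDerivAt θ B (ψ y₀) := (hθ.differentiableAt (by norm_num)).hasFDerivAt
  have hD : HasFDerivAt (fderiv ℝ θ) D (ψ y₀) :=
    ((hθ.fderiv_right (m := 1) (by norm_num)).differentiableAt (by norm_num)).hasFDerivAt
  have hBA : ∀ v, B (A v) = v := fun v => by
    have h1 : HasFDerivAt (θ ∘ ψ) (B ∘L A) y₀ := hB.comp y₀ hA
    have h2 : HasFDerivAt (θ ∘ ψ) (ContinuousLinearMap.id ℝ (Rn n)) y₀ :=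
      (hasFDerivAt_id y₀).congr_of_eventuallyEq hinv
    exact congrArg (fun L : Rn n →L[ℝ] Rn n => L v) (h1.unique h2)
  -- The second derivative of `θ` enters the differential of the lift; its symmetry is what makes
  -- its contribution to the symplectic form cancel.
  have hsymm : ∀ v w, D v w = D w v := fun v w =>
    (hθ.isSymmSndFDerivAt (by simp)).eq v w
  have hfst : HasFDerivAt (fun w : Phase n => w.1)
      (ContinuousLinearMap.fst ℝ (Rn n) (Rn n →L[ℝ] ℝ)) (y₀, ξ₀) := hasFDerivAt_fst
  have hsnd : HasFDerivAt (fun w : Phase n => w.2)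
      (ContinuousLinearMap.snd ℝ (Rn n) (Rn n →L[ℝ] ℝ)) (y₀, ξ₀) := hasFDerivAt_snd
  have h1 : HasFDerivAt (fun w : Phase n => ψ w.1) _ (y₀, ξ₀) :=
    HasFDerivAt.comp (y₀, ξ₀) (f := fun w : Phase n => w.1) hA hfst
  have h2 : HasFDerivAt (fun w : Phase n => fderiv ℝ θ (ψ w.1)) _ (y₀, ξ₀) :=
    HasFDerivAt.comp (y₀, ξ₀) (f := fun w : Phase n => ψ w.1) hD h1
  have h3 := h1.prodMk (hsnd.clm_comp h2)
  refine ⟨_, h3, fun u w => ?_⟩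
  simp only [ContinuousLinearMap.prod_apply, ContinuousLinearMap.comp_apply,
    add_apply, ContinuousLinearMap.coe_fst', ContinuousLinearMap.coe_snd',
    ContinuousLinearMap.compL_apply, ContinuousLinearMap.flip_apply]
  change (ξ₀ (D (A w.1) (A u.1)) + w.2 (B (A u.1))) -
    (ξ₀ (D (A u.1) (A w.1)) + u.2 (B (A w.1))) = _
  rw [hBA, hBA, hsymm]
  ring

end HamiltonianCoordinates

/-! ### Canonical charts of the cotangent bundle. -/

section CotangentCharts

variable {n : ℕ} {M : Type*} [TopologicalSpace M] [ChartedSpace (Rn n) M] [IsManifold (𝓡 n) ∞ M]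

/-- The components of a covector in the preferred chart at its base point. -/
def covector (z : CotangentBundle n M) : Rn n →L[ℝ] ℝ := z.snd

theorem mem_extChartAt_cotangent_source {z₀ z : CotangentBundle n M} :
    z ∈ (extChartAt (cotModel n) z₀).source ↔ z.proj ∈ (extChartAt (𝓡 n) z₀.proj).source := by
  rw [FiberBundle.extChartAt]
  simp only [PartialEquiv.trans_source, PartialEquiv.prod_source, PartialEquiv.refl_source,
    extChartAt_source, mem_inter_iff, mem_preimage, mem_prod, mem_univ, and_true]
  refine ⟨fun h => h.2, fun h => ⟨⟨h, trivial⟩, h⟩⟩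

theorem extChartAt_cotangent_target (z₀ : CotangentBundle n M) :
    (extChartAt (cotModel n) z₀).target = (extChartAt (𝓡 n) z₀.proj).target ×ˢ univ := by
  rw [FiberBundle.extChartAt_target, hom_trivializationAt_baseSet]
  ext w
  simp only [TangentBundle.trivializationAt_baseSet]
  constructor
  · rintro ⟨h, -⟩
    exact ⟨h.1, trivial⟩
  · rintro ⟨h, -⟩
    refine ⟨⟨h, ?_⟩, trivial⟩
    have := (extChartAt (𝓡 n) z₀.proj).map_target h
    rw [extChartAt_source] at this
    exact ⟨this, trivial⟩

/-- The target line bundle is trivial, so changing trivialization acts on a covector only by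
precomposition with the coordinate change of tangent vectors. -/
theorem extChartAt_cotangent_apply {z₀ z : CotangentBundle n M}
    (hz : z ∈ (extChartAt (cotModel n) z₀).source) :
    extChartAt (cotModel n) z₀ z = (extChartAt (𝓡 n) z₀.proj z.proj,
      covector z ∘L tangentCoordChange (𝓡 n) z₀.proj z.proj z.proj) := by
  rw [mem_extChartAt_cotangent_source, extChartAt_source] at hz
  rw [FiberBundle.extChartAt]
  refine Prod.ext rfl ?_
  · simp only [PartialEquiv.coe_trans, Function.comp_apply, PartialEquiv.prod_coe,
      PartialEquiv.refl_coe, id_eq]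
    ext v
    show ContinuousLinearMap.inCoordinates (Rn n) (TangentSpace (𝓡 n)) ℝ (Bundle.Trivial M ℝ)
      z₀.proj z.proj z₀.proj z.proj z.snd v = _
    simp only [ContinuousLinearMap.inCoordinates]
    rw [TangentBundle.symmL_trivializationAt_eq_core hz]
    simp
    rfl

/-- The transition map between two charts of the cotangent bundle is a cotangent lift. -/
theorem extChartAt_cotangent_transition {z₀ z : CotangentBundle n M} {w : Phase n}
    (hw : w.1 ∈ (extChartAt (𝓡 n) z.proj).target)
    (hw' : (extChartAt (𝓡 n) z.proj).symm w.1 ∈ (extChartAt (𝓡 n) z₀.proj).source) :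
    extChartAt (cotModel n) z₀ ((extChartAt (cotModel n) z).symm w) =
      (extChartAt (𝓡 n) z₀.proj ((extChartAt (𝓡 n) z.proj).symm w.1),
        w.2 ∘L fderiv ℝ (extChartAt (𝓡 n) z.proj ∘ (extChartAt (𝓡 n) z₀.proj).symm)
          (extChartAt (𝓡 n) z₀.proj ((extChartAt (𝓡 n) z.proj).symm w.1))) := by
  set c := extChartAt (cotModel n) z
  have hwt : w ∈ c.target := by
    rw [extChartAt_cotangent_target]; exact ⟨hw, trivial⟩
  have hsrc : c.symm w ∈ c.source := c.map_target hwt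
  have hc := extChartAt_cotangent_apply hsrc
  rw [c.right_inv hwt] at hc
  rw [mem_extChartAt_cotangent_source] at hsrc
  have hp : (c.symm w).proj = (extChartAt (𝓡 n) z.proj).symm w.1 := by
    have := congrArg (fun w : Phase n => (extChartAt (𝓡 n) z.proj).symm w.1) hc
    exact ((extChartAt (𝓡 n) z.proj).left_inv hsrc).symm.trans this.symm
  have hsrc' : c.symm w ∈ (extChartAt (cotModel n) z₀).source := by
    rw [mem_extChartAt_cotangent_source, hp]; exact hw'
  rw [extChartAt_cotangent_apply hsrc', hp]
  refine Prod.ext rfl ?_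
  have h2 := congrArg Prod.snd hc
  simp only [hp] at h2
  rw [h2]
  refine ContinuousLinearMap.ext fun v => ?_
  simp only [ContinuousLinearMap.comp_apply]
  have h3 := tangentCoordChange_comp (I := 𝓡 n) (w := z₀.proj) (x := z.proj)
    (y := (c.symm w).proj) (z := (c.symm w).proj) (v := v)
    ⟨⟨by rw [hp]; exact hw', hsrc⟩, mem_extChartAt_source _⟩
  rw [hp] at h3
  rw [← h3, tangentCoordChange_def (x := z₀.proj), (𝓡 n).range_eq_univ, fderivWithin_univ]

end CotangentCharts

/-! ### Invariance of the Hamilton field under canonical charts. -/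

section HamiltonFieldInCharts

variable {n : ℕ} {M : Type*} [TopologicalSpace M] [ChartedSpace (Rn n) M] [IsManifold (𝓡 n) ∞ M]

theorem contDiffAt_extChartAt_transition (x x' : M) {y : Rn n}
    (hy : y ∈ (extChartAt (𝓡 n) x').target)
    (hy' : (extChartAt (𝓡 n) x').symm y ∈ (extChartAt (𝓡 n) x).source) :
    ContDiffAt ℝ ∞ (extChartAt (𝓡 n) x ∘ (extChartAt (𝓡 n) x').symm) y := by
  have h := contDiffWithinAt_ext_coord_change (I := 𝓡 n) (n := ∞) x x' (y := y) ⟨hy, hy'⟩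
  rwa [(𝓡 n).range_eq_univ, contDiffWithinAt_univ] at h

/-- The differential of a chart of the cotangent bundle is symplectic. -/
theorem exists_hasMFDerivAt_extChartAt_symplectic {z₀ z : CotangentBundle n M}
    (hz : z ∈ (extChartAt (cotModel n) z₀).source) :
    ∃ L : Phase n →L[ℝ] Phase n,
      HasMFDerivAt (cotModel n) 𝓘(ℝ, Phase n) (extChartAt (cotModel n) z₀) z L ∧
      Function.Surjective L ∧
      ∀ u w : Phase n, (L w).2 (L u).1 - (L u).2 (L w).1 = w.2 u.1 - u.2 w.1 := by
  have hz' := mem_extChartAt_cotangent_source.1 hz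
  set φ₀ := extChartAt (𝓡 n) z₀.proj
  set φ := extChartAt (𝓡 n) z.proj
  have hφz : z.proj ∈ φ.source := mem_extChartAt_source _
  set w₀ := extChartAt (cotModel n) z z with hw₀
  have hw₀1 : w₀.1 = φ z.proj := by
    rw [hw₀, extChartAt_cotangent_apply (mem_extChartAt_source _)]
  have hback : φ.symm (φ z.proj) = z.proj := φ.left_inv hφz
  have htarget : φ.target ∈ 𝓝 (φ z.proj) := extChartAt_target_mem_nhds _
  have hpre : φ.symm ⁻¹' φ₀.source ∈ 𝓝 (φ z.proj) :=
    (continuousAt_extChartAt_symm z.proj).preimage_mem_nhds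
      (by rw [hback]; exact extChartAt_source_mem_nhds' hz')
  have hψ : ContDiffAt ℝ 2 (φ₀ ∘ φ.symm) (φ z.proj) :=
    (contDiffAt_extChartAt_transition _ _ (φ.map_source hφz) (by rw [hback]; exact hz')).of_le
      ENat.LEInfty.out
  have hψz : (φ₀ ∘ φ.symm) (φ z.proj) = φ₀ z.proj := by rw [Function.comp_apply, hback]
  have hθ : ContDiffAt ℝ 2 (φ ∘ φ₀.symm) ((φ₀ ∘ φ.symm) (φ z.proj)) := by
    rw [hψz]
    exact (contDiffAt_extChartAt_transition _ _ (φ₀.map_source hz')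
      (by rw [φ₀.left_inv hz']; exact hφz)).of_le ENat.LEInfty.out
  have hinv : ∀ᶠ y in 𝓝 (φ z.proj), (φ ∘ φ₀.symm) ((φ₀ ∘ φ.symm) y) = y := by
    filter_upwards [htarget, hpre] with y hy hy'
    rw [Function.comp_apply, Function.comp_apply, φ₀.left_inv hy', φ.right_inv hy]
  obtain ⟨L, hL, hLs⟩ := exists_hasFDerivAt_cotangentLift w₀.2 hψ hθ hinv
  have hm : HasMFDerivAt (cotModel n) 𝓘(ℝ, Phase n) (extChartAt (cotModel n) z₀) z L := by
    refine ⟨continuousAt_extChartAt' hz, ?_⟩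
    have heq : writtenInExtChartAt (cotModel n) 𝓘(ℝ, Phase n) z (extChartAt (cotModel n) z₀) =ᶠ[𝓝 w₀]
        fun w : Phase n => ((φ₀ ∘ φ.symm) w.1, w.2 ∘L fderiv ℝ (φ ∘ φ₀.symm) ((φ₀ ∘ φ.symm) w.1)) := by
      have hfst : Tendsto (fun w : Phase n => w.1) (𝓝 w₀) (𝓝 (φ z.proj)) := by
        rw [← hw₀1]; exact continuous_fst.continuousAt
      filter_upwards [hfst htarget, hfst hpre] with w hw hw'
      exact extChartAt_cotangent_transition hw hw'
    have : HasFDerivAt (writtenInExtChartAt (cotModel n) 𝓘(ℝ, Phase n) z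
        (extChartAt (cotModel n) z₀)) L w₀ := by
      refine HasFDerivAt.congr_of_eventuallyEq ?_ heq
      rw [← hw₀1] at hL
      exact hL
    exact this.hasFDerivWithinAt
  refine ⟨L, hm, ?_, hLs⟩
  have := (isInvertible_mfderiv_extChartAt hz).surjective
  rw [hm.mfderiv] at this
  exact this

/-- Invariance of the Hamilton vector field: its representative in any chart is the Hamiltonian
vector of the function read in that chart. -/
theorem mfderiv_extChartAt_hamiltonField {z₀ z : CotangentBundle n M}
    (hz : z ∈ (extChartAt (cotModel n) z₀).source) {q : CotangentBundle n M → ℝ}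
    {Q : Phase n → ℝ} (hQ : DifferentiableAt ℝ Q (extChartAt (cotModel n) z₀ z))
    (hq : q =ᶠ[𝓝 z] Q ∘ extChartAt (cotModel n) z₀) :
    mfderiv (cotModel n) 𝓘(ℝ, Phase n) (extChartAt (cotModel n) z₀) z (hamiltonField q z) =
      symplGrad (fderiv ℝ Q (extChartAt (cotModel n) z₀ z)) := by
  obtain ⟨L, hL, hLsurj, hLs⟩ := exists_hasMFDerivAt_extChartAt_symplectic hz
  have hd : cotDeriv q z = (fderiv ℝ Q (extChartAt (cotModel n) z₀ z)).comp L := by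
    have h1 := (hQ.hasFDerivAt.hasMFDerivAt).comp z hL
    exact (h1.congr_of_eventuallyEq hq).mfderiv
  rw [hL.mfderiv, ← map_symplGrad_comp hLsurj hLs, ← hd]
  rfl

end HamiltonFieldInCharts

/-! ### Inverting positive definite bilinear forms. -/

section BilinearForms

variable {E : Type*} [NormedAddCommGroup E] [NormedSpace ℝ E] [FiniteDimensional ℝ E]

/-- Positivity makes $v\mapsto G(v,\cdot)$ injective, and a finite-dimensional space has the
dimension of its dual. -/
theorem isInvertible_of_apply_self_pos {G : E →L[ℝ] E →L[ℝ] ℝ} (hG : ∀ v, v ≠ 0 → 0 < G v v) :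
    G.IsInvertible := by
  have hinj : Function.Injective (G : E →ₗ[ℝ] E →L[ℝ] ℝ) := by
    refine (injective_iff_map_eq_zero _).2 fun v hv => ?_
    by_contra h
    have h1 := hG v h
    have h2 : G v v = 0 := by
      have : G v = 0 := hv
      rw [this]; rfl
    exact h1.ne' h2
  have hdim : Module.finrank ℝ E = Module.finrank ℝ (E →L[ℝ] ℝ) := by
    have h1 : Module.finrank ℝ (Module.Dual ℝ E) = Module.finrank ℝ E := Subspace.dual_finrank_eq
    rw [← h1]
    exact (LinearMap.toContinuousLinearMap : (E →ₗ[ℝ] ℝ) ≃ₗ[ℝ] (E →L[ℝ] ℝ)).finrank_eq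
  exact ⟨(LinearMap.linearEquivOfInjective _ hinj hdim).toContinuousLinearEquiv, by ext; rfl⟩

theorem apply_inverse_apply {G : E →L[ℝ] E →L[ℝ] ℝ} (hG : ∀ v, v ≠ 0 → 0 < G v v)
    (ξ : E →L[ℝ] ℝ) : G (G.inverse ξ) = ξ := by
  obtain ⟨e, rfl⟩ := isInvertible_of_apply_self_pos hG
  rw [ContinuousLinearMap.inverse_equiv]
  exact e.apply_symm_apply ξ

theorem inverse_apply_symm {G : E →L[ℝ] E →L[ℝ] ℝ} (hG : ∀ v, v ≠ 0 → 0 < G v v)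
    (hs : ∀ v w, G v w = G w v) (ξ η : E →L[ℝ] ℝ) : ξ (G.inverse η) = η (G.inverse ξ) := by
  have h1 := apply_inverse_apply hG ξ
  have h2 := apply_inverse_apply hG η
  calc ξ (G.inverse η) = G (G.inverse ξ) (G.inverse η) := by rw [h1]
    _ = G (G.inverse η) (G.inverse ξ) := hs _ _
    _ = _ := by rw [h2]

theorem apply_inverse_self_pos {G : E →L[ℝ] E →L[ℝ] ℝ} (hG : ∀ v, v ≠ 0 → 0 < G v v)
    {ξ : E →L[ℝ] ℝ} (hξ : ξ ≠ 0) : 0 < ξ (G.inverse ξ) := by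
  have h1 := apply_inverse_apply hG ξ
  have h2 : G.inverse ξ ≠ 0 := fun h => hξ (by rw [← h1, h, map_zero])
  have := hG _ h2
  rwa [h1] at this

end BilinearForms

/-! ### The metric, its dual and the symbol in charts. -/

section MetricInCharts

variable {n : ℕ} {M : Type*} [TopologicalSpace M] [ChartedSpace (Rn n) M] [IsManifold (𝓡 n) ∞ M]

/-- The metric at `p`, as a bilinear form on `ℝⁿ`. -/
def fiberMetric (g : SmoothMetric n M) (p : M) : Rn n →L[ℝ] Rn n →L[ℝ] ℝ := g.inner p

theorem fiberMetric_symm (g : SmoothMetric n M) (p : M) (v w : Rn n) :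
    fiberMetric g p v w = fiberMetric g p w v := g.symm p v w

theorem fiberMetric_pos (g : SmoothMetric n M) (p : M) (v : Rn n) (hv : v ≠ 0) :
    0 < fiberMetric g p v v := g.pos p v hv

theorem metricMatrix_mulVec (g : SmoothMetric n M) (p : M) (v : Rn n) (i : Fin n) :
    (metricMatrix g p).mulVec v i = fiberMetric g p v (EuclideanSpace.single i 1) := by
  have hv : v = ∑ j, v j • EuclideanSpace.single j (1 : ℝ) := by
    conv_lhs => rw [← (EuclideanSpace.basisFun (Fin n) ℝ).sum_repr v]
    simp
  conv_rhs => rw [hv]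
  rw [map_sum, sum_apply, Matrix.mulVec, dotProduct]
  refine Finset.sum_congr rfl fun j _ => ?_
  rw [map_smul, smul_apply, smul_eq_mul, mul_comm]
  congr 1
  exact fiberMetric_symm g p _ _

theorem covector_apply_eq_sum (η : Rn n →L[ℝ] ℝ) (v : Rn n) :
    η v = ∑ i, v i * η (EuclideanSpace.single i 1) := by
  have := congrArg (fun η : Rn n →L[ℝ] ℝ => η v) (eq_sum_apply_single η)
  simp only [sum_apply, smul_apply, smul_eq_mul] at this
  rw [this]
  exact Finset.sum_congr rfl fun i _ => mul_comm _ _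

theorem isUnit_metricMatrix (g : SmoothMetric n M) (p : M) : IsUnit (metricMatrix g p) := by
  rw [← Matrix.mulVec_injective_iff_isUnit]
  intro u w h
  have h0 : ∀ i, fiberMetric g p (WithLp.toLp 2 (u - w)) (EuclideanSpace.single i 1) = 0 := by
    intro i
    rw [← metricMatrix_mulVec]
    have : (metricMatrix g p).mulVec (u - w) = 0 := by
      rw [Matrix.mulVec_sub, sub_eq_zero]; exact h
    exact congrFun this i
  have h1 : fiberMetric g p (WithLp.toLp 2 (u - w)) (WithLp.toLp 2 (u - w)) = 0 := by
    rw [covector_apply_eq_sum]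
    exact Finset.sum_eq_zero fun i _ => by rw [h0, mul_zero]
  have h2 : (WithLp.toLp 2 (u - w) : Rn n) = 0 := by
    by_contra hne
    exact (fiberMetric_pos g p _ hne).ne' h1
  have h3 : u - w = 0 := by
    exact congrArg WithLp.ofLp h2
  exact sub_eq_zero.1 h3

/-- When $v$ is the metric dual of $\xi$, the components of $\xi$ are the metric matrix applied to
$v$, and the inverse matrix cancels it. The symbol is thereby freed from matrices and from the
choice of basis. -/
theorem symbol_eq_of_fiberMetric (g : SmoothMetric n M) (z : CotangentBundle n M) {v : Rn n}
    (hv : fiberMetric g z.proj v = covector z) : symbol g z = covector z v := by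
  have hx : ∀ i, covector z (EuclideanSpace.single i 1) = (metricMatrix g z.proj).mulVec v i :=
    fun i => by rw [metricMatrix_mulVec, hv]
  have h1 : symbol g z = ∑ i, ∑ j, (metricMatrix g z.proj)⁻¹ i j *
      covector z (EuclideanSpace.single i 1) * covector z (EuclideanSpace.single j 1) := rfl
  rw [h1, covector_apply_eq_sum]
  refine Finset.sum_congr rfl fun i _ => ?_
  have h2 : ((metricMatrix g z.proj)⁻¹).mulVec ((metricMatrix g z.proj).mulVec v) i = v i := by
    rw [Matrix.mulVec_mulVec, Matrix.nonsing_inv_mul _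
      ((Matrix.isUnit_iff_isUnit_det _).1 (isUnit_metricMatrix g z.proj)), Matrix.one_mulVec]
  rw [← h2, Matrix.mulVec, dotProduct, Finset.sum_mul]
  refine Finset.sum_congr rfl fun j _ => ?_
  rw [hx j]; ring

/-- The metric read in the chart at `x₀`. -/
def metricForm (g : SmoothMetric n M) (x₀ : M) (y : Rn n) : Rn n →L[ℝ] Rn n →L[ℝ] ℝ :=
  (fiberMetric g ((extChartAt (𝓡 n) x₀).symm y)).bilinearComp
    (tangentCoordChange (𝓡 n) x₀ ((extChartAt (𝓡 n) x₀).symm y) ((extChartAt (𝓡 n) x₀).symm y))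
    (tangentCoordChange (𝓡 n) x₀ ((extChartAt (𝓡 n) x₀).symm y) ((extChartAt (𝓡 n) x₀).symm y))

theorem metricForm_symm (g : SmoothMetric n M) (x₀ : M) (y v w : Rn n) :
    metricForm g x₀ y v w = metricForm g x₀ y w v := fiberMetric_symm g _ _ _

theorem tangentCoordChange_left_inv {x₀ p : M} (hp : p ∈ (extChartAt (𝓡 n) x₀).source)
    (v : Rn n) : tangentCoordChange (𝓡 n) p x₀ p (tangentCoordChange (𝓡 n) x₀ p p v) = v := by
  rw [tangentCoordChange_comp (I := 𝓡 n) ⟨⟨hp, mem_extChartAt_source _⟩, hp⟩,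
    tangentCoordChange_self (I := 𝓡 n) hp]

theorem tangentCoordChange_right_inv {x₀ p : M} (hp : p ∈ (extChartAt (𝓡 n) x₀).source)
    (v : Rn n) : tangentCoordChange (𝓡 n) x₀ p p (tangentCoordChange (𝓡 n) p x₀ p v) = v := by
  rw [tangentCoordChange_comp (I := 𝓡 n)
    ⟨⟨mem_extChartAt_source _, hp⟩, mem_extChartAt_source _⟩,
    tangentCoordChange_self (I := 𝓡 n) (mem_extChartAt_source _)]

theorem metricForm_pos (g : SmoothMetric n M) {x₀ : M} {y : Rn n}
    (hy : y ∈ (extChartAt (𝓡 n) x₀).target) (v : Rn n) (hv : v ≠ 0) :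
    0 < metricForm g x₀ y v v := by
  have hp := (extChartAt (𝓡 n) x₀).map_target hy
  refine fiberMetric_pos g _ _ fun h => hv ?_
  exact (tangentCoordChange_left_inv hp v).symm.trans ((congrArg _ h).trans (map_zero _))

/-- Vectors constant in the chart define smooth local sections of the tangent bundle, and the smooth
metric is evaluated on two of them. -/
theorem contDiffOn_metricForm (g : SmoothMetric n M) (x₀ : M) :
    ContDiffOn ℝ ∞ (metricForm g x₀) (extChartAt (𝓡 n) x₀).target := by
  set φ := extChartAt (𝓡 n) x₀ with hφ
  have hb : ContMDiffOn 𝓘(ℝ, Rn n) (𝓡 n) ∞ φ.symm φ.target := contMDiffOn_extChartAt_symm x₀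
  have hsec : ∀ v : Rn n, ContMDiffOn 𝓘(ℝ, Rn n) ((𝓡 n).prod 𝓘(ℝ, Rn n)) ∞
      (fun y => TotalSpace.mk' (Rn n) (E := fun x : M => TangentSpace (𝓡 n) x) (φ.symm y)
        (tangentCoordChange (𝓡 n) x₀ (φ.symm y) (φ.symm y) v)) φ.target := by
    intro v
    let e := trivializationAt (Rn n) (TangentSpace (𝓡 n) : M → Type _) x₀
    have h1 := e.contMDiffOn_symm (n := ∞) (IB := 𝓡 n)
    have h2 : ContMDiffOn 𝓘(ℝ, Rn n) ((𝓡 n).prod 𝓘(ℝ, Rn n)) ∞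
      (fun y => ((φ.symm y, v) : M × Rn n)) φ.target := hb.prodMk contMDiffOn_const
    have hmem : ∀ y ∈ φ.target, φ.symm y ∈ (chartAt (Rn n) x₀).source := fun y hy => by
      have := φ.map_target hy
      rwa [hφ, extChartAt_source] at this
    have h3 := h1.comp h2 (fun y hy => by
      rw [mem_preimage, e.mem_target]; exact hmem y hy)
    refine h3.congr fun y hy => ?_
    have hm := hmem y hy
    have h4 := e.mk_symm (b := φ.symm y) hm v
    refine Eq.trans ?_ h4
    have h5 := TangentBundle.symmL_trivializationAt_eq_core (𝕜 := ℝ) (I := 𝓡 n) hm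
    have h6 := congrArg (fun L : Rn n →L[ℝ] Rn n => L v) h5
    exact congrArg (TotalSpace.mk' (Rn n) (E := fun x : M => TangentSpace (𝓡 n) x) (φ.symm y))
      (h6.symm.trans (e.symmL_apply hm v))
  have hg := g.contMDiff.comp_contMDiffOn hb
  rw [contDiffOn_clm_apply]
  intro v
  rw [contDiffOn_clm_apply]
  intro w
  rw [← contMDiffOn_iff_contDiffOn]
  have h7 : ContMDiffOn 𝓘(ℝ, Rn n) ((𝓡 n).prod 𝓘(ℝ)) ∞
      (fun y ↦ TotalSpace.mk' ℝ (E := Bundle.Trivial M ℝ) (φ.symm y)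
        (metricForm g x₀ y v w)) φ.target :=
    ContMDiffOn.clm_bundle_apply₂ (F₁ := Rn n) (F₂ := Rn n) hg (hsec v) (hsec w)
  intro y hy
  have h8 := h7 y hy
  simp only [contMDiffWithinAt_totalSpace] at h8
  exact h8.2

/-- The dual metric read in the chart at `x₀`. -/
def cometric (g : SmoothMetric n M) (x₀ : M) (y : Rn n) : (Rn n →L[ℝ] ℝ) →L[ℝ] Rn n :=
  (metricForm g x₀ y).inverse

theorem contDiffOn_cometric (g : SmoothMetric n M) (x₀ : M) :
    ContDiffOn ℝ ∞ (cometric g x₀) (extChartAt (𝓡 n) x₀).target := by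
  intro y hy
  exact (isInvertible_of_apply_self_pos
    (metricForm_pos g hy)).contDiffAt_map_inverse.comp_contDiffWithinAt y
      (contDiffOn_metricForm g x₀ y hy)

theorem cometric_symm (g : SmoothMetric n M) {x₀ : M} {y : Rn n}
    (hy : y ∈ (extChartAt (𝓡 n) x₀).target) (ξ η : Rn n →L[ℝ] ℝ) :
    ξ (cometric g x₀ y η) = η (cometric g x₀ y ξ) :=
  inverse_apply_symm (metricForm_pos g hy) (metricForm_symm g x₀ y) ξ η

theorem cometric_pos (g : SmoothMetric n M) {x₀ : M} {y : Rn n}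
    (hy : y ∈ (extChartAt (𝓡 n) x₀).target) {ξ : Rn n →L[ℝ] ℝ} (hξ : ξ ≠ 0) :
    0 < ξ (cometric g x₀ y ξ) :=
  apply_inverse_self_pos (metricForm_pos g hy) hξ

/-- The symbol in canonical coordinates. -/
def symbolForm (G : Rn n → (Rn n →L[ℝ] ℝ) →L[ℝ] Rn n) (w : Phase n) : ℝ := w.2 (G w.1 w.2)

/-- Raising the index commutes with the coordinate change: the chart dual of the transported
covector is carried by `B` to the dual taken in the fibre. -/
theorem symbol_eq_symbolForm (g : SmoothMetric n M) {z₀ z : CotangentBundle n M}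
    (hz : z ∈ (extChartAt (cotModel n) z₀).source) :
    symbol g z = symbolForm (cometric g z₀.proj) (extChartAt (cotModel n) z₀ z) := by
  rw [extChartAt_cotangent_apply hz]
  have hz' := mem_extChartAt_cotangent_source.1 hz
  set φ := extChartAt (𝓡 n) z₀.proj with hφ
  set B := tangentCoordChange (𝓡 n) z₀.proj z.proj z.proj with hB
  have hy : φ z.proj ∈ φ.target := φ.map_source hz'
  have hform : metricForm g z₀.proj (φ z.proj) = (fiberMetric g z.proj).bilinearComp B B := by
    unfold metricForm
    rw [← hφ, φ.left_inv hz']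
  set w := cometric g z₀.proj (φ z.proj) (covector z ∘L B) with hw
  have h1 : metricForm g z₀.proj (φ z.proj) w = covector z ∘L B :=
    apply_inverse_apply (metricForm_pos g hy) _
  have h2 : fiberMetric g z.proj (B w) = covector z := by
    refine ContinuousLinearMap.ext fun u => ?_
    have := congrArg (fun L : Rn n →L[ℝ] ℝ => L (tangentCoordChange (𝓡 n) z.proj z₀.proj z.proj u)) h1
    rw [hform] at this
    change fiberMetric g z.proj (B w) (B (tangentCoordChange (𝓡 n) z.proj z₀.proj z.proj u)) =
      covector z (B (tangentCoordChange (𝓡 n) z.proj z₀.proj z.proj u)) at this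
    have h3 : B (tangentCoordChange (𝓡 n) z.proj z₀.proj z.proj u) = u :=
      tangentCoordChange_right_inv hz' u
    rwa [h3] at this
  exact symbol_eq_of_fiberMetric g z h2

end MetricInCharts

/-! ### Derivatives of the conformally perturbed symbol in coordinates. -/

section SymbolForms

variable {n : ℕ}

instance : NormedAddCommGroup ((Rn n →L[ℝ] ℝ) →L[ℝ] Rn n) :=
  ContinuousLinearMap.toNormedAddCommGroup

instance : NormedSpace ℝ ((Rn n →L[ℝ] ℝ) →L[ℝ] Rn n) := ContinuousLinearMap.toNormedSpace

/-- The conformally perturbed symbol in canonical coordinates. -/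
def conformalForm (G : Rn n → (Rn n →L[ℝ] ℝ) →L[ℝ] Rn n) (a : Rn n → ℝ) (w : Phase n) : ℝ :=
  (1 + a w.1) * symbolForm G w

/-- Half the Hamiltonian vector of the conformally perturbed symbol. -/
def geodesicVector (G : Rn n → (Rn n →L[ℝ] ℝ) →L[ℝ] Rn n) (a : Rn n → ℝ) (w : Phase n) : Phase n :=
  (1 / 2 : ℝ) • symplGrad (fderiv ℝ (conformalForm G a) w)

variable {G : Rn n → (Rn n →L[ℝ] ℝ) →L[ℝ] Rn n} {a : Rn n → ℝ} {U : Set (Rn n)} {w : Phase n}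

theorem contDiffOn_symbolForm {k : WithTop ℕ∞} (hG : ContDiffOn ℝ k G U) :
    ContDiffOn ℝ k (symbolForm G) (U ×ˢ univ) := by
  have h1 : ContDiffOn ℝ k (fun w : Phase n => G w.1) (U ×ˢ univ) :=
    hG.comp contDiff_fst.contDiffOn fun w hw => hw.1
  exact contDiff_snd.contDiffOn.clm_apply (h1.clm_apply contDiff_snd.contDiffOn)

theorem contDiffOn_conformalForm {k : WithTop ℕ∞} (hG : ContDiffOn ℝ k G U)
    (ha : ContDiffOn ℝ k a U) : ContDiffOn ℝ k (conformalForm G a) (U ×ˢ univ) :=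
  (contDiffOn_const.add (ha.comp contDiff_fst.contDiffOn fun _ hw => hw.1)).mul
    (contDiffOn_symbolForm hG)

theorem contDiffOn_geodesicVector (hU : IsOpen U) (hG : ContDiffOn ℝ ∞ G U)
    (ha : ContDiffOn ℝ ∞ a U) : ContDiffOn ℝ ∞ (geodesicVector G a) (U ×ˢ univ) := by
  have h1 : ContDiffOn ℝ ∞ (fderiv ℝ (conformalForm G a)) (U ×ˢ univ) :=
    (contDiffOn_conformalForm hG ha).fderiv_of_isOpen (hU.prod isOpen_univ) le_rfl
  refine ContDiffOn.congr (((symplGradL n).contDiff.comp_contDiffOn h1).const_smul (1 / 2 : ℝ))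
    fun w _ => ?_
  rw [geodesicVector, Function.comp_apply, symplGradL_apply]

theorem hasFDerivAt_symbolForm (hG : DifferentiableAt ℝ G w.1) :
    ∃ L : Phase n →L[ℝ] ℝ, HasFDerivAt (symbolForm G) L w ∧
      ∀ u : Phase n, L u = u.2 (G w.1 w.2) + w.2 (fderiv ℝ G w.1 u.1 w.2) + w.2 (G w.1 u.2) := by
  have h1 : HasFDerivAt (fun w : Phase n => G w.1) _ w :=
    hG.hasFDerivAt.comp w (hasFDerivAt_fst (𝕜 := ℝ) (E := Rn n) (F := Rn n →L[ℝ] ℝ))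
  have h2 : HasFDerivAt (fun w : Phase n => w.2) (ContinuousLinearMap.snd ℝ _ _) w :=
    hasFDerivAt_snd
  have h3 := h2.clm_apply (h1.clm_apply h2)
  refine ⟨_, h3, fun u => ?_⟩
  simp
  ring

/-- Symmetry of $G$ merges the two derivatives in the fibre direction into the factor $2$, which the
half in `geodesicVector` later removes. -/
theorem fderiv_conformalForm_apply (hG : DifferentiableAt ℝ G w.1) (ha : DifferentiableAt ℝ a w.1)
    (hs : ∀ ξ η : Rn n →L[ℝ] ℝ, ξ (G w.1 η) = η (G w.1 ξ)) (u : Phase n) :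
    fderiv ℝ (conformalForm G a) w u = (1 + a w.1) * (2 * u.2 (G w.1 w.2) +
      w.2 (fderiv ℝ G w.1 u.1 w.2)) + fderiv ℝ a w.1 u.1 * symbolForm G w := by
  obtain ⟨L, hL, hL'⟩ := hasFDerivAt_symbolForm hG
  have h1 : HasFDerivAt (fun w : Phase n => a w.1) _ w :=
    ha.hasFDerivAt.comp w (hasFDerivAt_fst (𝕜 := ℝ) (E := Rn n) (F := Rn n →L[ℝ] ℝ))
  have h2 : HasFDerivAt (conformalForm G a) _ w := (h1.const_add 1).mul hL
  rw [h2.fderiv]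
  simp only [add_apply, smul_apply, hL', smul_eq_mul, ContinuousLinearMap.comp_apply,
    ContinuousLinearMap.coe_fst']
  rw [hs w.2 u.2]
  ring

theorem geodesicVector_fst (hG : DifferentiableAt ℝ G w.1) (ha : DifferentiableAt ℝ a w.1)
    (hs : ∀ ξ η : Rn n →L[ℝ] ℝ, ξ (G w.1 η) = η (G w.1 ξ)) :
    (geodesicVector G a w).1 = (1 + a w.1) • G w.1 w.2 := by
  have h : ∀ η : Rn n →L[ℝ] ℝ, η (geodesicVector G a w).1 = η ((1 + a w.1) • G w.1 w.2) := by
    intro η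
    rw [geodesicVector, Prod.smul_fst, map_smul, apply_symplGrad_fst,
      fderiv_conformalForm_apply hG ha hs]
    simp
    ring
  ext j
  exact h (EuclideanSpace.proj j)

theorem geodesicVector_snd_apply (hG : DifferentiableAt ℝ G w.1) (ha : DifferentiableAt ℝ a w.1)
    (hs : ∀ ξ η : Rn n →L[ℝ] ℝ, ξ (G w.1 η) = η (G w.1 ξ)) (v : Rn n) :
    (geodesicVector G a w).2 v = -(1 / 2) * ((1 + a w.1) * w.2 (fderiv ℝ G w.1 v w.2) +
      fderiv ℝ a w.1 v * symbolForm G w) := by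
  rw [geodesicVector, Prod.smul_snd, smul_apply, symplGrad_snd_apply,
    fderiv_conformalForm_apply hG ha hs]
  simp
  ring

end SymbolForms

/-! ### The geodesic field on the cotangent bundle. -/

section GeodesicField

variable {n : ℕ} {M : Type*} [TopologicalSpace M] [ChartedSpace (Rn n) M] [IsManifold (𝓡 n) ∞ M]

/-- Half the Hamilton field of the conformally perturbed symbol. -/
def geodesicField (g : SmoothMetric n M) (f : M → ℝ) (z : CotangentBundle n M) :
    TangentSpace (cotModel n) z :=
  (1 / 2 : ℝ) • hamiltonField (conformalSymbol g f) z

theorem conformalSymbol_zero (g : SmoothMetric n M) :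
    conformalSymbol g (fun _ => 0) = symbol g := by
  ext z; simp [conformalSymbol]

theorem conformalSymbol_eq_conformalForm (g : SmoothMetric n M) (f : M → ℝ)
    {z₀ z : CotangentBundle n M} (hz : z ∈ (extChartAt (cotModel n) z₀).source) :
    conformalSymbol g f z = conformalForm (cometric g z₀.proj)
      (f ∘ (extChartAt (𝓡 n) z₀.proj).symm) (extChartAt (cotModel n) z₀ z) := by
  rw [conformalSymbol, conformalForm, ← symbol_eq_symbolForm g hz, Function.comp_apply,
    extChartAt_cotangent_apply hz,
    (extChartAt (𝓡 n) z₀.proj).left_inv (mem_extChartAt_cotangent_source.1 hz)]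

theorem contDiffOn_comp_extChartAt_symm {f : M → ℝ} (hf : ContMDiff (𝓡 n) 𝓘(ℝ) ∞ f) (x₀ : M) :
    ContDiffOn ℝ ∞ (f ∘ (extChartAt (𝓡 n) x₀).symm) (extChartAt (𝓡 n) x₀).target :=
  (hf.comp_contMDiffOn (contMDiffOn_extChartAt_symm x₀)).contDiffOn

/-- The bridge to coordinates: invariance of the Hamilton field reduces statements on $T^*M$ to
calculus with `geodesicVector` on phase space. -/
theorem chartField_geodesicField (g : SmoothMetric n M) {f : M → ℝ}
    (hf : ContMDiff (𝓡 n) 𝓘(ℝ) ∞ f) (z₀ : CotangentBundle n M) {w : Phase n}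
    (hw : w ∈ (extChartAt (cotModel n) z₀).target) :
    chartField (I := cotModel n) (geodesicField g f) z₀ w =
      geodesicVector (cometric g z₀.proj) (f ∘ (extChartAt (𝓡 n) z₀.proj).symm) w := by
  set c := extChartAt (cotModel n) z₀ with hc
  set z := c.symm w with hz
  have hzs : z ∈ c.source := c.map_target hw
  have hcz : c z = w := c.right_inv hw
  have hw' := hw
  rw [hc, extChartAt_cotangent_target] at hw'
  have hQ : DifferentiableAt ℝ (conformalForm (cometric g z₀.proj)
      (f ∘ (extChartAt (𝓡 n) z₀.proj).symm)) (c z) := by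
    rw [hcz]
    have := contDiffOn_conformalForm (contDiffOn_cometric g z₀.proj)
      (contDiffOn_comp_extChartAt_symm hf z₀.proj)
    exact (this.contDiffAt (((isOpen_extChartAt_target _).prod isOpen_univ).mem_nhds
      hw')).differentiableAt (by simp)
  have h1 := mfderiv_extChartAt_hamiltonField hzs hQ (q := conformalSymbol g f) (by
    filter_upwards [(isOpen_extChartAt_source z₀).mem_nhds hzs] with z' hz'
    exact conformalSymbol_eq_conformalForm g f hz')
  unfold chartField geodesicVector
  rw [← hc, ← hz, ← hcz, ← h1]
  exact (mfderiv (cotModel n) 𝓘(ℝ, Phase n) c z).map_smul _ _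

theorem isC1Field_geodesicField (g : SmoothMetric n M) {f : M → ℝ}
    (hf : ContMDiff (𝓡 n) 𝓘(ℝ) ∞ f) :
    IsC1Field (I := cotModel n) (geodesicField g f) := by
  intro z₀
  have h := contDiffOn_geodesicVector (isOpen_extChartAt_target z₀.proj)
    (contDiffOn_cometric g z₀.proj) (contDiffOn_comp_extChartAt_symm hf z₀.proj)
  rw [← extChartAt_cotangent_target] at h
  exact (h.of_le ENat.LEInfty.out).congr fun w hw => chartField_geodesicField g hf z₀ hw

theorem geodesicField_congr (g : SmoothMetric n M) {f f' : M → ℝ} {z : CotangentBundle n M}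
    (h : f =ᶠ[𝓝 z.proj] f') : geodesicField g f z = geodesicField g f' z := by
  have h1 : conformalSymbol g f =ᶠ[𝓝 z] conformalSymbol g f' := by
    have hp : Continuous fun z : CotangentBundle n M => z.proj :=
      FiberBundle.continuous_proj (Rn n →L[ℝ] ℝ) _
    filter_upwards [hp.continuousAt.eventually h] with z' hz'
    rw [conformalSymbol, conformalSymbol, hz']
  have h2 : cotDeriv (conformalSymbol g f) z = cotDeriv (conformalSymbol g f') z :=
    h1.mfderiv_eq
  unfold geodesicField hamiltonField
  rw [h2]

/-- Needed for uniqueness of integral curves. Points over one base point are separated in a common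
chart, the others by their projections. -/
instance [T2Space M] : T2Space (CotangentBundle n M) := by
  have hp : Continuous fun z : CotangentBundle n M => z.proj :=
    FiberBundle.continuous_proj (Rn n →L[ℝ] ℝ) _
  refine ⟨fun z z' hne => ?_⟩
  by_cases h : z.proj = z'.proj
  · have hs : z ∈ (extChartAt (cotModel n) z).source := mem_extChartAt_source _
    have hs' : z' ∈ (extChartAt (cotModel n) z).source := by
      rw [mem_extChartAt_cotangent_source, ← h]; exact mem_extChartAt_source _
    have hne' : extChartAt (cotModel n) z z ≠ extChartAt (cotModel n) z z' := fun h' =>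
      hne ((extChartAt (cotModel n) z).injOn hs hs' h')
    obtain ⟨u, v, hu, hv, hzu, hzv, huv⟩ := t2_separation hne'
    have hcont := continuousOn_extChartAt (I := cotModel n) z
    have ho := isOpen_extChartAt_source (I := cotModel n) z
    refine ⟨_, _, hcont.isOpen_inter_preimage ho hu, hcont.isOpen_inter_preimage ho hv,
      ⟨hs, hzu⟩, ⟨hs', hzv⟩, ?_⟩
    exact (huv.preimage _).mono inter_subset_right inter_subset_right
  · obtain ⟨u, v, hu, hv, hzu, hzv, huv⟩ := t2_separation h
    exact ⟨_, _, hu.preimage hp, hv.preimage hp, hzu, hzv, huv.preimage _⟩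

end GeodesicField

/-! ### Integral identities tested by functions concentrated at a simple point. -/

section TestFunctionsAlongCurves

variable {E : Type*} [NormedAddCommGroup E] [NormedSpace ℝ E] {x β : ℝ → E} {a b s k : ℝ} {v : E}

/-- Near `s` the bound comes from the nonzero derivative, elsewhere from compactness and simplicity
of `x s`. It turns small support in space into small support in time. -/
theorem exists_lower_bound_of_injective_at (hx : ContinuousOn x (Icc a b))
    (hd : HasDerivAt x v s) (hv : v ≠ 0) (hinj : ∀ t ∈ Icc a b, x t = x s → t = s) :
    ∃ c > 0, ∀ t ∈ Icc a b, c * |t - s| ≤ ‖x t - x s‖ := by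
  have hv' : 0 < ‖v‖ := norm_pos_iff.2 hv
  have h1 := hd.isLittleO.def (half_pos hv')
  obtain ⟨r, hr, hr'⟩ := Metric.eventually_nhds_iff.1 h1
  have hnear : ∀ t, |t - s| < r → ‖v‖ / 2 * |t - s| ≤ ‖x t - x s‖ := by
    intro t ht
    have h2 := hr' (y := t) (by rwa [Real.dist_eq])
    have h3 : ‖(t - s) • v‖ - ‖x t - x s‖ ≤ ‖x t - x s - (t - s) • v‖ := by
      rw [← norm_neg (x t - x s - (t - s) • v), neg_sub]
      exact norm_sub_norm_le _ _
    rw [norm_smul, Real.norm_eq_abs] at h3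
    rw [Real.norm_eq_abs] at h2
    nlinarith
  have hK : IsCompact (Icc a b ∩ {t | r ≤ |t - s|}) :=
    isCompact_Icc.inter_right (isClosed_le continuous_const (by fun_prop))
  have hfar : ∃ m > 0, ∀ t ∈ Icc a b, r ≤ |t - s| → m ≤ ‖x t - x s‖ := by
    rcases (Icc a b ∩ {t | r ≤ |t - s|}).eq_empty_or_nonempty with h | h
    · refine ⟨1, one_pos, fun t ht htr => ?_⟩
      have : t ∈ (∅ : Set ℝ) := h ▸ ⟨ht, htr⟩
      exact this.elim
    · obtain ⟨t₀, ht₀, hmin⟩ := hK.exists_isMinOn h (f := fun t => ‖x t - x s‖)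
        ((hx.mono inter_subset_left).sub continuousOn_const).norm
      refine ⟨‖x t₀ - x s‖, norm_pos_iff.2 fun h0 => ?_, fun t ht htr => hmin ⟨ht, htr⟩⟩
      have := hinj t₀ ht₀.1 (sub_eq_zero.1 h0)
      have h5 : r ≤ |t₀ - s| := ht₀.2
      rw [this, sub_self, abs_zero] at h5
      linarith
  obtain ⟨m, hm, hm'⟩ := hfar
  set B := |a - s| + |b - s| + 1 with hB
  have hBpos : 0 < B := by positivity
  have hbound : ∀ t ∈ Icc a b, |t - s| ≤ B := by
    intro t ht
    have := abs_le_max_abs_abs (sub_le_sub_right ht.1 s) (sub_le_sub_right ht.2 s)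
    refine this.trans (max_le ?_ ?_)
    · have := abs_nonneg (b - s); linarith
    · have := abs_nonneg (a - s); linarith
  refine ⟨min (‖v‖ / 2) (m / B), lt_min (half_pos hv') (by positivity), fun t ht => ?_⟩
  rcases lt_or_ge |t - s| r with h | h
  · exact (mul_le_mul_of_nonneg_right (min_le_left _ _) (abs_nonneg _)).trans (hnear t h)
  · refine (mul_le_mul (min_le_right _ _) (hbound t ht) (abs_nonneg _) (by positivity)).trans ?_
    rw [div_mul_cancel₀ _ hBpos.ne']
    exact hm' t ht h

theorem intervalIntegral_eq_of_eq_zero {F : ℝ → ℝ} {a' b' : ℝ} (hF : ContinuousOn F (Icc a b))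
    (h1 : a ≤ a') (h2 : a' ≤ b') (h3 : b' ≤ b) (h4 : ∀ t ∈ Icc a a', F t = 0)
    (h5 : ∀ t ∈ Icc b' b, F t = 0) : ∫ t in a..b, F t = ∫ t in a'..b', F t := by
  have i1 : IntervalIntegrable F MeasureTheory.volume a a' :=
    (hF.mono (Icc_subset_Icc le_rfl (h2.trans h3))).intervalIntegrable_of_Icc h1
  have i2 : IntervalIntegrable F MeasureTheory.volume a' b' :=
    (hF.mono (Icc_subset_Icc h1 h3)).intervalIntegrable_of_Icc h2
  have i3 : IntervalIntegrable F MeasureTheory.volume b' b :=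
    (hF.mono (Icc_subset_Icc (h1.trans h2) le_rfl)).intervalIntegrable_of_Icc h3
  have z1 : ∫ t in a..a', F t = 0 := by
    rw [intervalIntegral.integral_congr (g := fun _ => (0 : ℝ))
      (by rw [uIcc_of_le h1]; exact h4)]
    simp
  have z3 : ∫ t in b'..b, F t = 0 := by
    rw [intervalIntegral.integral_congr (g := fun _ => (0 : ℝ))
      (by rw [uIcc_of_le h3]; exact h5)]
    simp
  rw [← intervalIntegral.integral_add_adjacent_intervals (i1.trans i2) i3,
    ← intervalIntegral.integral_add_adjacent_intervals i1 i2, z1, z3]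
  ring

theorem exists_dual_eq_zero_eq_one [FiniteDimensional ℝ E] {w : E} (h : ¬ ∃ r : ℝ, w = r • v) :
    ∃ m : E →L[ℝ] ℝ, m v = 0 ∧ m w = 1 := by
  have hw : w ∉ Submodule.span ℝ {v} := fun hw => by
    obtain ⟨r, hr⟩ := Submodule.mem_span_singleton.1 hw
    exact h ⟨r, hr.symm⟩
  obtain ⟨f, hf, hker⟩ := Submodule.exists_le_ker_of_notMem hw
  have hv : f v = 0 := hker (Submodule.mem_span_singleton_self v)
  refine ⟨LinearMap.toContinuousLinearMap ((f w)⁻¹ • f), ?_, ?_⟩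
  · simp [hv]
  · simp [hf]

variable [FiniteDimensional ℝ E] {W : Set E}

/-- If `f ↦ ∫ (df(β) + k f)` vanishes on test functions, then `β` is tangent to the curve. -/
theorem exists_eq_smul_of_integral_eq_zero (hs : s ∈ Ioo a b) (hx : ContinuousOn x (Icc a b))
    (hβ : ContinuousOn β (Icc a b)) (hd : HasDerivAt x v s) (hv : v ≠ 0)
    (hinj : ∀ t ∈ Icc a b, x t = x s → t = s) (hW : W ∈ 𝓝 (x s))
    (hT : ∀ f : E → ℝ, ContDiff ℝ ∞ f → HasCompactSupport f → tsupport f ⊆ W →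
      ∫ t in a..b, (fderiv ℝ f (x t) (β t) + k * f (x t)) = 0) :
    ∃ r : ℝ, β s = r • v := by
  by_contra hne
  obtain ⟨m, hmv, hmβ⟩ := exists_dual_eq_zero_eq_one hne
  obtain ⟨c, hc, hlow⟩ := exists_lower_bound_of_injective_at hx hd hv hinj
  let χ : ContDiffBump (0 : E) := ⟨1 / 2, 1, by norm_num, by norm_num⟩
  -- The test functions are $\delta\,\Psi((y-x(s))/\delta)$: their differentials stay of order one
  -- while their values are of order $\delta$, so the term with `k` disappears in the limit.
  set Ψ : E → ℝ := fun y => m y * χ y with hΨ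
  have hχ : ContDiff ℝ ∞ χ := χ.contDiff
  have hΨs : ContDiff ℝ ∞ Ψ := m.contDiff.mul hχ
  have hΨt : tsupport Ψ ⊆ Metric.closedBall 0 1 := by
    rw [← χ.tsupport_eq]
    exact tsupport_mul_subset_right
  have hΨc : HasCompactSupport Ψ := HasCompactSupport.mul_left χ.hasCompactSupport
  have hdΨ : Continuous (fderiv ℝ Ψ) := hΨs.continuous_fderiv (by simp)
  have hΨ0 : ∀ y, 1 < ‖y‖ → Ψ y = 0 ∧ fderiv ℝ Ψ y = 0 := fun y hy => by
    have : y ∉ tsupport Ψ := fun h => by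
      have := hΨt h
      rw [mem_closedBall_zero_iff] at this
      linarith
    exact ⟨image_eq_zero_of_notMem_tsupport this, fderiv_of_notMem_tsupport ℝ this⟩
  -- Along the tangent line `m` vanishes, so only the derivative of `m` in the direction `β s`
  -- survives, and this is one.
  have hΨv : ∀ r : ℝ, fderiv ℝ Ψ (r • v) (β s) = χ (r • v) := by
    intro r
    have h1 : HasFDerivAt Ψ _ (r • v) :=
      m.hasFDerivAt.mul (hχ.differentiable (by simp) (r • v)).hasFDerivAt
    rw [h1.fderiv]
    simp [hmv, hmβ]
  -- For $|t-s|\ge C\delta$ the curve is at distance at least $2\delta$ from $x(s)$, outside the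
  -- support of the test function.
  set C : ℝ := 2 / c with hC
  have hCpos : 0 < C := by positivity
  set F : ℝ → ℝ → ℝ := fun δ t => fderiv ℝ Ψ (δ⁻¹ • (x t - x s)) (β t) +
    k * (δ * Ψ (δ⁻¹ • (x t - x s))) with hF
  have hFc : ∀ δ, ContinuousOn (F δ) (Icc a b) := by
    intro δ
    have h1 : ContinuousOn (fun t => δ⁻¹ • (x t - x s)) (Icc a b) :=
      (hx.sub continuousOn_const).const_smul _
    exact ((hdΨ.comp_continuousOn h1).clm_apply hβ).add
      (continuousOn_const.mul (continuousOn_const.mul (hΨs.continuous.comp_continuousOn h1)))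
  obtain ⟨ρ, hρ, hρW⟩ := Metric.mem_nhds_iff.1 hW
  have hevIcc : ∀ᶠ δ in 𝓝[>] (0 : ℝ), s - C * δ ∈ Icc a b ∧ s + C * δ ∈ Icc a b := by
    have h1 : Tendsto (fun δ : ℝ => s - C * δ) (𝓝 0) (𝓝 s) := by
      have : Continuous (fun δ : ℝ => s - C * δ) := by fun_prop
      simpa using this.tendsto 0
    have h2 : Tendsto (fun δ : ℝ => s + C * δ) (𝓝 0) (𝓝 s) := by
      have : Continuous (fun δ : ℝ => s + C * δ) := by fun_prop
      simpa using this.tendsto 0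
    have hm := Icc_mem_nhds hs.1 hs.2
    refine nhdsWithin_le_nhds ?_
    filter_upwards [h1 hm, h2 hm] with δ h3 h4 using ⟨h3, h4⟩
  have hzero : ∀ᶠ δ in 𝓝[>] (0 : ℝ), ∫ r in (-C)..C, F δ (s + δ * r) = 0 := by
    have hρ' : ∀ᶠ δ in 𝓝[>] (0 : ℝ), δ < ρ := nhdsWithin_le_nhds (eventually_lt_nhds hρ)
    filter_upwards [hevIcc, hρ', self_mem_nhdsWithin] with δ hδ hδρ hδ0
    have hδ0 : 0 < δ := hδ0
    set f : E → ℝ := fun y => δ * Ψ (δ⁻¹ • (y - x s)) with hf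
    have hfs : ContDiff ℝ ∞ f :=
      contDiff_const.mul (hΨs.comp ((contDiff_id.sub contDiff_const).const_smul _))
    have hft : tsupport f ⊆ Metric.closedBall (x s) δ := by
      refine closure_minimal (fun y hy => ?_) Metric.isClosed_closedBall
      by_contra hy'
      rw [mem_closedBall_iff_norm, not_le] at hy'
      refine hy ?_
      have : 1 < ‖δ⁻¹ • (y - x s)‖ := by
        rw [norm_smul, Real.norm_eq_abs, abs_of_pos (inv_pos.2 hδ0), inv_mul_eq_div,
          one_lt_div hδ0]
        exact hy'
      simp [hf, (hΨ0 _ this).1]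
    have hfW : tsupport f ⊆ W := hft.trans ((Metric.closedBall_subset_ball hδρ).trans hρW)
    have hfc : HasCompactSupport f :=
      HasCompactSupport.of_support_subset_isCompact (isCompact_closedBall (x s) δ)
        ((subset_tsupport f).trans hft)
    have hfd : ∀ y, fderiv ℝ f y = fderiv ℝ Ψ (δ⁻¹ • (y - x s)) := by
      intro y
      have h1 : HasFDerivAt (fun y => δ⁻¹ • (y - x s)) (δ⁻¹ • ContinuousLinearMap.id ℝ E) y :=
        ((hasFDerivAt_id y).sub_const (x s)).const_smul δ⁻¹
      have h2 := (((hΨs.differentiable (by simp) (δ⁻¹ • (y - x s))).hasFDerivAt).comp y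
        h1).const_mul δ
      refine HasFDerivAt.fderiv (h2.congr_fderiv ?_)
      ext w
      simp [hδ0.ne']
    have hI : ∫ t in a..b, F δ t = 0 := by
      rw [← hT f hfs hfc hfW]
      refine intervalIntegral.integral_congr fun t _ => ?_
      rw [hfd]
    have hvan : ∀ t ∈ Icc a b, C * δ ≤ |t - s| → F δ t = 0 := by
      intro t ht h
      have h1 := hlow t ht
      have h2 : 1 < ‖δ⁻¹ • (x t - x s)‖ := by
        rw [norm_smul, Real.norm_eq_abs, abs_of_pos (inv_pos.2 hδ0), inv_mul_eq_div,
          one_lt_div hδ0]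
        have : c * (C * δ) ≤ c * |t - s| := mul_le_mul_of_nonneg_left h hc.le
        have h3 : c * (C * δ) = 2 * δ := by rw [hC]; field_simp
        linarith
      simp [hF, (hΨ0 _ h2).1, (hΨ0 _ h2).2]
    have hCδ : 0 < C * δ := mul_pos hCpos hδ0
    have hI2 := intervalIntegral_eq_of_eq_zero (hFc δ) (a' := s - C * δ) (b' := s + C * δ)
      hδ.1.1 (by linarith) hδ.2.2
      (fun t ht => hvan t ⟨ht.1, ht.2.trans hδ.1.2⟩ (by
        rw [abs_of_nonpos (by linarith [ht.2])]; linarith [ht.2]))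
      (fun t ht => hvan t ⟨hδ.2.1.trans ht.1, ht.2⟩ (by
        rw [abs_of_nonneg (by linarith [ht.1])]; linarith [ht.1]))
    rw [intervalIntegral.integral_comp_add_mul (F δ) hδ0.ne' s,
      show s + δ * -C = s - C * δ by ring, show s + δ * C = s + C * δ by ring, ← hI2, hI, smul_zero]
  have hβc : ContinuousAt β s := hβ.continuousAt (Icc_mem_nhds hs.1 hs.2)
  obtain ⟨K₁, hK₁⟩ := hdΨ.bounded_above_of_compact_support (hΨc.fderiv ℝ)
  obtain ⟨K₂, hK₂⟩ := hΨs.continuous.bounded_above_of_compact_support hΨc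
  obtain ⟨K₃, hK₃⟩ := isCompact_Icc.exists_bound_of_continuousOn hβ
  -- After substituting $t=s+\delta r$, the rescaled curve tends to its tangent line $rv$, and
  -- dominated convergence applies. The limit is positive, whereas the integrals are eventually
  -- zero.
  have hlim : Tendsto (fun δ => ∫ r in (-C)..C, F δ (s + δ * r)) (𝓝[>] 0)
      (𝓝 (∫ r in (-C)..C, χ (r • v))) := by
    have hin : ∀ δ : ℝ, 0 < δ → s - C * δ ∈ Icc a b ∧ s + C * δ ∈ Icc a b → ∀ r ∈ Icc (-C) C,
        s + δ * r ∈ Icc a b := by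
      intro δ hδ h r hr
      have h1 : δ * (-C) ≤ δ * r := mul_le_mul_of_nonneg_left hr.1 hδ.le
      have h2 : δ * r ≤ δ * C := mul_le_mul_of_nonneg_left hr.2 hδ.le
      exact ⟨by linarith [h.1.1], by linarith [h.2.2]⟩
    have hCC : -C ≤ C := by linarith
    refine intervalIntegral.tendsto_integral_filter_of_dominated_convergence
      (fun _ => K₁ * K₃ + |k| * (1 * K₂)) ?_ ?_ intervalIntegrable_const ?_
    · filter_upwards [hevIcc, self_mem_nhdsWithin] with δ hδ hδ0
      rw [uIoc_of_le hCC]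
      have : ContinuousOn (fun r => F δ (s + δ * r)) (Icc (-C) C) :=
        (hFc δ).comp (by fun_prop) (hin δ hδ0 hδ)
      exact (this.mono Ioc_subset_Icc_self).aestronglyMeasurable measurableSet_Ioc
    · have h1 : ∀ᶠ δ in 𝓝[>] (0 : ℝ), δ < 1 := nhdsWithin_le_nhds (eventually_lt_nhds one_pos)
      filter_upwards [hevIcc, self_mem_nhdsWithin, h1] with δ hδ hδ0 hδ1
      have hδ0 : 0 < δ := hδ0
      refine Eventually.of_forall fun r hr => ?_
      rw [uIoc_of_le hCC] at hr
      have hmem := hin δ hδ0 hδ r (Ioc_subset_Icc_self hr)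
      refine (norm_add_le _ _).trans (add_le_add ?_ ?_)
      · exact (ContinuousLinearMap.le_opNorm _ _).trans (mul_le_mul (hK₁ _) (hK₃ _ hmem)
          (norm_nonneg _) ((norm_nonneg _).trans (hK₁ 0)))
      · rw [norm_mul, norm_mul, Real.norm_eq_abs, Real.norm_eq_abs δ, abs_of_pos hδ0]
        exact mul_le_mul_of_nonneg_left (mul_le_mul hδ1.le (hK₂ _) (norm_nonneg _) zero_le_one)
          (abs_nonneg _)
    · refine Eventually.of_forall fun r _ => ?_
      have h1 : HasDerivAt (fun δ : ℝ => x (s + δ * r)) (r • v) 0 := by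
        have h2 : HasDerivAt (fun δ : ℝ => s + δ * r) r 0 := by
          simpa using ((hasDerivAt_id (0 : ℝ)).mul_const r).const_add s
        have h3 : HasDerivAt x v (s + 0 * r) := by simpa using hd
        exact h3.scomp (0 : ℝ) h2
      have h4 := h1.tendsto_slope_zero_right
      simp only [zero_add, zero_mul, add_zero] at h4
      have h5 : Tendsto (fun δ : ℝ => β (s + δ * r)) (𝓝[>] 0) (𝓝 (β s)) := by
        refine hβc.tendsto.comp (tendsto_nhdsWithin_of_tendsto_nhds ?_)
        have : Continuous (fun δ : ℝ => s + δ * r) := by fun_prop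
        simpa using this.tendsto 0
      have h6 : Tendsto (fun δ : ℝ => fderiv ℝ Ψ (δ⁻¹ • (x (s + δ * r) - x s)) (β (s + δ * r)))
          (𝓝[>] 0) (𝓝 (fderiv ℝ Ψ (r • v) (β s))) :=
        ((isBoundedBilinearMap_apply (𝕜 := ℝ) (E := E) (F := ℝ)).continuous.tendsto
          (fderiv ℝ Ψ (r • v), β s)).comp (((hdΨ.tendsto _).comp h4).prodMk_nhds h5)
      have h7 : Tendsto (fun δ : ℝ => k * (δ * Ψ (δ⁻¹ • (x (s + δ * r) - x s))))
          (𝓝[>] 0) (𝓝 (k * (0 * Ψ (r • v)))) :=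
        (((tendsto_nhdsWithin_of_tendsto_nhds tendsto_id).mul
          ((hΨs.continuous.tendsto _).comp h4)).const_mul k)
      have h8 := h6.add h7
      rw [hΨv, zero_mul, mul_zero, add_zero] at h8
      exact h8
  have hI0 : ∫ r in (-C)..C, χ (r • v) = 0 :=
    tendsto_nhds_unique hlim ((tendsto_congr' hzero).2 tendsto_const_nhds)
  have hpos : 0 < ∫ r in (-C)..C, χ (r • v) := by
    refine intervalIntegral.integral_pos (by linarith) ?_ (fun r _ => χ.nonneg) ⟨0, ⟨by linarith, hCpos.le⟩, ?_⟩
    · exact (hχ.continuous.comp (by fun_prop)).continuousOn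
    · rw [zero_smul, χ.one_of_mem_closedBall (Metric.mem_closedBall_self (by norm_num))]
      exact one_pos
  exact hpos.ne' hI0

/-- If `f ↦ ∫ (df(β) + k f)` vanishes on test functions and `β = r x'`, then `r' = k`. -/
theorem eq_of_integral_eq_zero {x' : ℝ → E} {r r' : ℝ → ℝ} (hs : s ∈ Ioo a b)
    (hx : ContinuousOn x (Icc a b)) (hβ : ContinuousOn β (Icc a b)) (hv : x' s ≠ 0)
    (hinj : ∀ t ∈ Icc a b, x t = x s → t = s) (hW : W ∈ 𝓝 (x s))
    (hT : ∀ f : E → ℝ, ContDiff ℝ ∞ f → HasCompactSupport f → tsupport f ⊆ W →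
      ∫ t in a..b, (fderiv ℝ f (x t) (β t) + k * f (x t)) = 0)
    (hd : ∀ᶠ t in 𝓝 s, HasDerivAt x (x' t) t) (hr : ∀ᶠ t in 𝓝 s, HasDerivAt r (r' t) t)
    (hr' : ∀ᶠ t in 𝓝 s, ContinuousAt r' t) (hβr : ∀ᶠ t in 𝓝 s, β t = r t • x' t) : r' s = k := by
  by_contra hne
  obtain ⟨c, hc, hlow⟩ := exists_lower_bound_of_injective_at hx hd.self_of_nhds hv hinj
  -- Multiplying by `D` makes $k-r'$ positive near `s` whatever its sign, so both cases are treated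
  -- at once.
  set D : ℝ := k - r' s with hD
  have hD0 : D ≠ 0 := sub_ne_zero.2 (Ne.symm hne)
  have hpos : ∀ᶠ t in 𝓝 s, 0 < D * (k - r' t) := by
    have h1 : ContinuousAt (fun t => D * (k - r' t)) s :=
      continuousAt_const.mul (continuousAt_const.sub hr'.self_of_nhds)
    exact h1.eventually (lt_mem_nhds (mul_self_pos.2 hD0))
  obtain ⟨ρ, hρ, hall⟩ := Metric.eventually_nhds_iff.1
    (hd.and (hr.and (hr'.and (hβr.and (hpos.and (Icc_mem_nhds hs.1 hs.2))))))
  set δ := ρ / 2 with hδ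
  have hδ0 : 0 < δ := by positivity
  have hin : ∀ t ∈ Icc (s - δ) (s + δ), dist t s < ρ := fun t ht => by
    rw [Real.dist_eq, abs_lt]; constructor <;> linarith [ht.1, ht.2]
  have hsub : Icc (s - δ) (s + δ) ⊆ Icc a b := fun t ht => (hall (hin t ht)).2.2.2.2.2
  obtain ⟨R, hR, hRW⟩ := Metric.mem_nhds_iff.1 hW
  -- This radius keeps the bump inside `W` and makes it vanish on the curve for $|t-s|\ge\delta$, by
  -- the lower bound `hlow`.
  set o := min (c * δ) R / 2 with ho
  have hmin : 0 < min (c * δ) R := lt_min (by positivity) hR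
  have ho0 : 0 < o := by positivity
  let f : ContDiffBump (x s) := ⟨o / 2, o, by positivity, by linarith⟩
  have hfs : ContDiff ℝ ∞ f := f.contDiff
  have hft : tsupport f = Metric.closedBall (x s) o := f.tsupport_eq
  have hvan : ∀ t ∈ Icc a b, δ ≤ |t - s| → x t ∉ tsupport f := by
    intro t ht h hmem
    rw [hft, mem_closedBall_iff_norm] at hmem
    have h1 := hlow t ht
    have h2 : c * δ ≤ c * |t - s| := mul_le_mul_of_nonneg_left h hc.le
    have := min_le_left (c * δ) R
    have h3 : 0 < c * δ := by positivity
    linarith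
  have hI := hT f hfs f.hasCompactSupport (by
    rw [hft]
    refine (Metric.closedBall_subset_ball ?_).trans hRW
    have := min_le_right (c * δ) R
    linarith)
  have hdf : Continuous (fderiv ℝ f) := hfs.continuous_fderiv (by simp)
  have hsl : s - δ ∈ Icc (s - δ) (s + δ) := ⟨le_rfl, by linarith⟩
  have hsr : s + δ ∈ Icc (s - δ) (s + δ) := ⟨by linarith, le_rfl⟩
  have hfx : ContinuousOn (fun t => f (x t)) (Icc a b) := hfs.continuous.comp_continuousOn hx
  rw [intervalIntegral_eq_of_eq_zero (F := fun t => fderiv ℝ f (x t) (β t) + k * f (x t))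
    (a' := s - δ) (b' := s + δ) (((hdf.comp_continuousOn hx).clm_apply hβ).add (continuousOn_const.mul hfx))
    (hsub hsl).1 (by linarith) (hsub hsr).2
    (fun t ht => by
      have := hvan t ⟨ht.1, ht.2.trans (hsub hsl).2⟩ (by
        rw [abs_of_nonpos (by linarith [ht.2])]; linarith [ht.2])
      simp [image_eq_zero_of_notMem_tsupport this, fderiv_of_notMem_tsupport ℝ this])
    (fun t ht => by
      have := hvan t ⟨(hsub hsr).1.trans ht.1, ht.2⟩ (by
        rw [abs_of_nonneg (by linarith [ht.1])]; linarith [ht.1])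
      simp [image_eq_zero_of_notMem_tsupport this, fderiv_of_notMem_tsupport ℝ this])] at hI
  have hle : s - δ ≤ s + δ := by linarith
  have hprod : ∀ t ∈ Icc (s - δ) (s + δ), HasDerivAt (fun t => r t * f (x t))
      (r' t * f (x t) + r t * fderiv ℝ f (x t) (x' t)) t := by
    intro t ht
    obtain ⟨h1, h2, -⟩ := hall (hin t ht)
    exact h2.mul (((hfs.differentiable (by simp) (x t)).hasFDerivAt).comp_hasDerivAt t h1)
  have hr'c : ContinuousOn r' (Icc (s - δ) (s + δ)) := fun t ht =>
    (hall (hin t ht)).2.2.1.continuousWithinAt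
  have hcont1 : ContinuousOn (fun t => fderiv ℝ f (x t) (β t)) (Icc (s - δ) (s + δ)) :=
    ((hdf.comp_continuousOn hx).clm_apply hβ).mono hsub
  have hfx' := hfx.mono hsub
  have heq : ∀ t ∈ Icc (s - δ) (s + δ), r t * fderiv ℝ f (x t) (x' t) = fderiv ℝ f (x t) (β t) := by
    intro t ht
    rw [(hall (hin t ht)).2.2.2.1, map_smul, smul_eq_mul]
  have hint : IntervalIntegrable (fun t => r' t * f (x t) + r t * fderiv ℝ f (x t) (x' t))
      MeasureTheory.volume (s - δ) (s + δ) := by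
    refine ContinuousOn.intervalIntegrable_of_Icc hle ?_
    exact ((hr'c.mul hfx').add hcont1).congr fun t ht => by rw [heq t ht]; rfl
  -- Integrating $(r\,f(x))'$ replaces $df(\beta)=r\,df(x')$ by $-r'f(x)$, so the identity becomes
  -- $\int(k-r')f(x)\,dt=0$.
  have hFTC := intervalIntegral.integral_eq_sub_of_hasDerivAt
    (fun t ht => hprod t (by rwa [uIcc_of_le hle] at ht)) hint
  have hend : f (x (s + δ)) = 0 ∧ f (x (s - δ)) = 0 := by
    refine ⟨image_eq_zero_of_notMem_tsupport (hvan _ (hsub hsr) ?_),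
      image_eq_zero_of_notMem_tsupport (hvan _ (hsub hsl) ?_)⟩
    · rw [add_sub_cancel_left]; exact le_abs_self _
    · rw [sub_sub_cancel_left, abs_neg]; exact le_abs_self _
  rw [hend.1, hend.2, mul_zero, mul_zero, sub_zero] at hFTC
  have hintT : IntervalIntegrable (fun t => fderiv ℝ f (x t) (β t) + k * f (x t))
      MeasureTheory.volume (s - δ) (s + δ) :=
    (hcont1.add (continuousOn_const.mul hfx')).intervalIntegrable_of_Icc hle
  have hdiff : ∫ t in (s - δ)..(s + δ), (k - r' t) * f (x t) = 0 := by
    rw [← sub_zero (0 : ℝ)]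
    nth_rewrite 1 [← hI]
    rw [← hFTC, ← intervalIntegral.integral_sub hintT hint]
    refine intervalIntegral.integral_congr fun t ht => ?_
    rw [uIcc_of_le hle] at ht
    simp only [heq t ht]
    ring
  have hposI : 0 < ∫ t in (s - δ)..(s + δ), D * ((k - r' t) * f (x t)) := by
    refine intervalIntegral.integral_pos (by linarith)
      (continuousOn_const.mul ((continuousOn_const.sub hr'c).mul hfx')) (fun t ht => ?_)
      ⟨s, ⟨by linarith, by linarith⟩, ?_⟩
    · rw [← mul_assoc]
      exact mul_nonneg (hall (hin t (Ioc_subset_Icc_self ht))).2.2.2.2.1.le f.nonneg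
    · rw [← mul_assoc, f.one_of_mem_closedBall (Metric.mem_closedBall_self (by positivity)), mul_one]
      exact mul_self_pos.2 hD0
  rw [intervalIntegral.integral_const_mul, hdiff, mul_zero] at hposI
  exact lt_irrefl _ hposI

end TestFunctionsAlongCurves

/-! ### Solutions of the linearised equation and the annihilator argument. -/

section JacobiFields

variable {n : ℕ}

instance : NormedAddCommGroup (Phase n →L[ℝ] Phase n) := ContinuousLinearMap.toNormedAddCommGroup

instance : NormedSpace ℝ (Phase n →L[ℝ] Phase n) := ContinuousLinearMap.toNormedSpace

/-- The canonical symplectic form of phase space. -/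
def symplForm (u w : Phase n) : ℝ := w.2 u.1 - u.2 w.1

theorem symplForm_symplGrad (l : Phase n →L[ℝ] ℝ) (w : Phase n) :
    symplForm (symplGrad l) w = l w := symplGrad_pairing l w

theorem symplForm_swap (u w : Phase n) : symplForm u w = -symplForm w u := by
  unfold symplForm; ring

theorem symplForm_smul_left (r : ℝ) (u w : Phase n) : symplForm (r • u) w = r * symplForm u w := by
  simp [symplForm]; ring

theorem HasDerivWithinAt.symplForm {u w : ℝ → Phase n} {u' w' : Phase n} {s : Set ℝ} {t : ℝ}
    (hu : HasDerivWithinAt u u' s t) (hw : HasDerivWithinAt w w' s t) :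
    HasDerivWithinAt (fun t => symplForm (u t) (w t)) (symplForm u' (w t) + symplForm (u t) w')
      s t := by
  have hu1 : HasDerivWithinAt (fun t => (u t).1) u'.1 s t := hu.fst
  have hu2 : HasDerivWithinAt (fun t => (u t).2) u'.2 s t := hu.snd
  have hw1 : HasDerivWithinAt (fun t => (w t).1) w'.1 s t := hw.fst
  have hw2 : HasDerivWithinAt (fun t => (w t).2) w'.2 s t := hw.snd
  refine ((hw2.clm_apply hu1).fun_sub (hu2.clm_apply hw1)).congr_deriv ?_
  unfold _root_.symplForm
  ring

/-- A smooth field of positive definite quadratic forms on the covectors over an open set. -/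
structure IsCometricOn (G : Rn n → (Rn n →L[ℝ] ℝ) →L[ℝ] Rn n) (U : Set (Rn n)) : Prop where
  isOpen : IsOpen U
  contDiffOn : ContDiffOn ℝ ∞ G U
  symm : ∀ y ∈ U, ∀ ξ η : Rn n →L[ℝ] ℝ, ξ (G y η) = η (G y ξ)
  pos : ∀ y ∈ U, ∀ ξ : Rn n →L[ℝ] ℝ, ξ ≠ 0 → 0 < ξ (G y ξ)

variable {G : Rn n → (Rn n →L[ℝ] ℝ) →L[ℝ] Rn n} {U : Set (Rn n)}

theorem conformalForm_zero : conformalForm G (fun _ => 0) = symbolForm G := by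
  ext w; simp [conformalForm]

/-- The unperturbed Hamiltonian vector field. -/
abbrev freeVector (G : Rn n → (Rn n →L[ℝ] ℝ) →L[ℝ] Rn n) : Phase n → Phase n :=
  geodesicVector G fun _ => 0

namespace IsCometricOn

theorem differentiableAt (h : IsCometricOn G U) {y : Rn n} (hy : y ∈ U) :
    DifferentiableAt ℝ G y :=
  (h.contDiffOn.contDiffAt (h.isOpen.mem_nhds hy)).differentiableAt (by simp)

theorem isOpen_prod (h : IsCometricOn G U) : IsOpen (U ×ˢ (univ : Set (Rn n →L[ℝ] ℝ))) :=
  h.isOpen.prod isOpen_univ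

theorem contDiffAt_symbolForm (h : IsCometricOn G U) {w : Phase n} (hw : w.1 ∈ U) :
    ContDiffAt ℝ ∞ (symbolForm G) w :=
  (contDiffOn_symbolForm h.contDiffOn).contDiffAt (h.isOpen_prod.mem_nhds ⟨hw, trivial⟩)

theorem contDiffOn_freeVector (h : IsCometricOn G U) :
    ContDiffOn ℝ ∞ (freeVector G) (U ×ˢ univ) :=
  contDiffOn_geodesicVector h.isOpen h.contDiffOn contDiffOn_const

theorem hasFDerivAt_freeVector (h : IsCometricOn G U) {w : Phase n} (hw : w.1 ∈ U) :
    HasFDerivAt (freeVector G) (fderiv ℝ (freeVector G) w) w :=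
  ((h.contDiffOn_freeVector.contDiffAt (h.isOpen_prod.mem_nhds ⟨hw, trivial⟩)).differentiableAt
    (by simp)).hasFDerivAt

theorem continuousOn_fderiv_freeVector (h : IsCometricOn G U) :
    ContinuousOn (fderiv ℝ (freeVector G)) (U ×ˢ univ) :=
  h.contDiffOn_freeVector.continuousOn_fderiv_of_isOpen h.isOpen_prod (by simp)

theorem symplForm_freeVector (w u : Phase n) :
    symplForm (freeVector G w) u = 1 / 2 * fderiv ℝ (symbolForm G) w u := by
  rw [freeVector, geodesicVector, symplForm_smul_left, symplForm_symplGrad, conformalForm_zero]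

/-- Conservation of energy: the symplectic form is alternating. -/
theorem fderiv_symbolForm_freeVector (w : Phase n) :
    fderiv ℝ (symbolForm G) w (freeVector G w) = 0 := by
  have h1 := symplForm_freeVector (G := G) w (freeVector G w)
  have h2 : symplForm (freeVector G w) (freeVector G w) = 0 := by simp [symplForm]
  linarith

/-- The linearised field is infinitesimally symplectic because the Hessian of the symbol is
symmetric. Hence the symplectic product of two solutions of the linearised equation is constant. -/
theorem symplForm_fderiv_freeVector (h : IsCometricOn G U) {w : Phase n} (hw : w.1 ∈ U)
    (u u' : Phase n) : symplForm (fderiv ℝ (freeVector G) w u) u' +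
      symplForm u (fderiv ℝ (freeVector G) w u') = 0 := by
  have hP := h.contDiffAt_symbolForm hw
  have hsymm : IsSymmSndFDerivAt ℝ (symbolForm G) w :=
    (hP.of_le ENat.LEInfty.out : ContDiffAt ℝ 2 (symbolForm G) w).isSymmSndFDerivAt
      (by simp)
  have hd : DifferentiableAt ℝ (fderiv ℝ (symbolForm G)) w :=
    (hP.fderiv_right (m := 1) (by rw [one_add_one_eq_two]; exact ENat.LEInfty.out)).differentiableAt (by simp)
  have hV : freeVector G = fun w => (1 / 2 : ℝ) • symplGradL n (fderiv ℝ (symbolForm G) w) := by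
    ext1 w
    rw [freeVector, geodesicVector, conformalForm_zero, symplGradL_apply]
  have hA : ∀ v, fderiv ℝ (freeVector G) w v =
      (1 / 2 : ℝ) • symplGrad (fderiv ℝ (fderiv ℝ (symbolForm G)) w v) := by
    intro v
    have h1 := ((symplGradL n).hasFDerivAt.comp w hd.hasFDerivAt).const_smul (1 / 2 : ℝ)
    have h2 : fderiv ℝ (freeVector G) w =
        (1 / 2 : ℝ) • (symplGradL n ∘L fderiv ℝ (fderiv ℝ (symbolForm G)) w) := by
      rw [hV]; exact h1.fderiv
    rw [h2, smul_apply, ContinuousLinearMap.comp_apply, symplGradL_apply]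
  rw [symplForm_swap u, hA, hA, symplForm_smul_left, symplForm_smul_left, symplForm_symplGrad,
    symplForm_symplGrad, hsymm.eq u u']
  ring

theorem freeVector_fst (h : IsCometricOn G U) {w : Phase n} (hw : w.1 ∈ U) :
    (freeVector G w).1 = G w.1 w.2 := by
  rw [freeVector, geodesicVector_fst (h.differentiableAt hw) (differentiableAt_const _)
    (h.symm _ hw)]
  simp

/-- The base component of the field is $G(y)\xi$, linear in $\xi$. This later recovers the fibre
component of a solution from the derivative of its base component. -/
theorem fderiv_freeVector_vertical (h : IsCometricOn G U) {w : Phase n} (hw : w.1 ∈ U)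
    (η : Rn n →L[ℝ] ℝ) : (fderiv ℝ (freeVector G) w (0, η)).1 = G w.1 η := by
  have h1 : HasFDerivAt (fun w => (freeVector G w).1) _ w := (h.hasFDerivAt_freeVector hw).fst
  have h2 : HasFDerivAt (fun w : Phase n => G w.1) _ w :=
    (h.differentiableAt hw).hasFDerivAt.comp w
      (hasFDerivAt_fst (𝕜 := ℝ) (E := Rn n) (F := Rn n →L[ℝ] ℝ))
  have h3 : HasFDerivAt (fun w : Phase n => w.2) (ContinuousLinearMap.snd ℝ _ _) w :=
    hasFDerivAt_snd
  have h4 := (h2.clm_apply h3).congr_of_eventuallyEq (f₁ := fun w => (freeVector G w).1) (by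
    filter_upwards [h.isOpen_prod.mem_nhds (⟨hw, trivial⟩ : w ∈ U ×ˢ univ)] with w' hw'
    exact h.freeVector_fst hw'.1)
  have h5 := congrArg (fun L : Phase n →L[ℝ] Rn n => L (0, η)) (h1.unique h4)
  simpa using h5

/-- The difference of the fields is half the Hamiltonian vector of $fp$, so the pairing is
$-\tfrac12\,d(fp)(u)$. -/
theorem symplForm_geodesicVector_sub (h : IsCometricOn G U) {w : Phase n} (hw : w.1 ∈ U)
    {f : Rn n → ℝ} (hf : DifferentiableAt ℝ f w.1) (u : Phase n) :
    symplForm u (geodesicVector G f w - freeVector G w) = -(1 / 2) *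
      (fderiv ℝ f w.1 u.1 * symbolForm G w + f w.1 * fderiv ℝ (symbolForm G) w u) := by
  have h1 := fderiv_conformalForm_apply (h.differentiableAt hw) hf (h.symm _ hw) u
  have h2 := fderiv_conformalForm_apply (h.differentiableAt hw)
    (differentiableAt_const (0 : ℝ)) (h.symm _ hw) u
  rw [conformalForm_zero] at h2
  have h3 : symplForm (geodesicVector G f w) u = 1 / 2 * fderiv ℝ (conformalForm G f) w u := by
    rw [geodesicVector, symplForm_smul_left, symplForm_symplGrad]
  have h4 := symplForm_freeVector (G := G) w u
  have h5 : symplForm u (geodesicVector G f w - freeVector G w) =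
      symplForm (freeVector G w) u - symplForm (geodesicVector G f w) u := by
    simp [symplForm]; ring
  rw [h5, h3, h4, h1, h2]
  simp
  ring

end IsCometricOn

/-- An integral curve of the unperturbed Hamiltonian vector field, with nonzero covector. -/
structure IsChartGeodesic (G : Rn n → (Rn n →L[ℝ] ℝ) →L[ℝ] Rn n) (U : Set (Rn n))
    (γ : ℝ → Phase n) (a b : ℝ) : Prop where
  mem : ∀ t ∈ Icc a b, (γ t).1 ∈ U
  hasDerivWithinAt : ∀ t ∈ Icc a b, HasDerivWithinAt γ (freeVector G (γ t)) (Icc a b) t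
  ne_zero : (γ a).2 ≠ 0

variable {γ : ℝ → Phase n} {a b : ℝ}

namespace IsChartGeodesic

theorem continuousOn (hγ : IsChartGeodesic G U γ a b) : ContinuousOn γ (Icc a b) :=
  fun t ht => (hγ.hasDerivWithinAt t ht).continuousWithinAt

theorem mapsTo (hγ : IsChartGeodesic G U γ a b) : MapsTo γ (Icc a b) (U ×ˢ univ) :=
  fun t ht => ⟨hγ.mem t ht, trivial⟩

theorem symbolForm_eq (h : IsCometricOn G U) (hγ : IsChartGeodesic G U γ a b) {t : ℝ}
    (ht : t ∈ Icc a b) : symbolForm G (γ t) = symbolForm G (γ a) := by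
  have hd : ∀ t ∈ Icc a b, HasDerivWithinAt (fun t => symbolForm G (γ t)) 0 (Icc a b) t := by
    intro t ht
    have h1 := ((h.contDiffAt_symbolForm (hγ.mem t ht)).differentiableAt
      (by simp)).hasFDerivAt.comp_hasDerivWithinAt t (hγ.hasDerivWithinAt t ht)
    rwa [IsCometricOn.fderiv_symbolForm_freeVector] at h1
  exact constant_of_derivWithin_zero (fun t ht => (hd t ht).differentiableWithinAt)
    (fun t ht => (hd t (Ico_subset_Icc_self ht)).derivWithin
      (uniqueDiffOn_Icc (ht.1.trans_lt ht.2) t (Ico_subset_Icc_self ht))) t ht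

theorem symbolForm_pos (h : IsCometricOn G U) (hγ : IsChartGeodesic G U γ a b) (hab : a ≤ b) :
    0 < symbolForm G (γ a) := h.pos _ (hγ.mem a ⟨le_rfl, hab⟩) _ hγ.ne_zero

theorem continuousOn_fderiv (h : IsCometricOn G U) (hγ : IsChartGeodesic G U γ a b) :
    ContinuousOn (fun t => fderiv ℝ (freeVector G) (γ t)) (Icc a b) :=
  h.continuousOn_fderiv_freeVector.comp hγ.continuousOn hγ.mapsTo

theorem hasDerivWithinAt_velocity (h : IsCometricOn G U) (hγ : IsChartGeodesic G U γ a b) {t : ℝ}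
    (ht : t ∈ Icc a b) : HasDerivWithinAt (fun t => freeVector G (γ t))
      (fderiv ℝ (freeVector G) (γ t) (freeVector G (γ t))) (Icc a b) t :=
  (h.hasFDerivAt_freeVector (hγ.mem t ht)).comp_hasDerivWithinAt t (hγ.hasDerivWithinAt t ht)

/-- Transporting a covector by the inverse of the linearised flow gives, after identifying vectors
and covectors by the symplectic form, a solution of the linearised equation. -/
theorem hasDerivWithinAt_symplGrad (h : IsCometricOn G U) (hγ : IsChartGeodesic G U γ a b)
    {Z : ℝ → Phase n →L[ℝ] Phase n} {t : ℝ} (ht : t ∈ Icc a b)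
    (hZ : HasDerivWithinAt Z (-(Z t ∘L fderiv ℝ (freeVector G) (γ t))) (Icc a b) t)
    (l : Phase n →L[ℝ] ℝ) :
    HasDerivWithinAt (fun t => symplGrad (l ∘L Z t))
      (fderiv ℝ (freeVector G) (γ t) (symplGrad (l ∘L Z t))) (Icc a b) t := by
  have h1 : HasDerivWithinAt (fun t => l ∘L Z t)
      (l ∘L (-(Z t ∘L fderiv ℝ (freeVector G) (γ t)))) (Icc a b) t :=
    (((ContinuousLinearMap.compL ℝ (Phase n) (Phase n) ℝ) l).hasFDerivAt).comp_hasDerivWithinAt t hZ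
  have h2 := (symplGradL n).hasFDerivAt.comp_hasDerivWithinAt t h1
  have h3 : HasDerivWithinAt (fun t => symplGrad (l ∘L Z t))
      (symplGradL n (l ∘L (-(Z t ∘L fderiv ℝ (freeVector G) (γ t))))) (Icc a b) t :=
    h2.congr_of_mem (fun t _ => (symplGradL_apply _).symm) ht
  refine h3.congr_deriv ?_
  rw [symplGradL_apply]
  refine (eq_symplGrad_of_pairing fun w => ?_).symm
  have h4 := h.symplForm_fderiv_freeVector (hγ.mem t ht) (symplGrad (l ∘L Z t)) w
  rw [symplForm_symplGrad] at h4
  have h5 : (l ∘L (-(Z t ∘L fderiv ℝ (freeVector G) (γ t)))) w =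
      -((l ∘L Z t) (fderiv ℝ (freeVector G) (γ t) w)) := by simp
  rw [h5]
  exact eq_neg_of_add_eq_zero_left h4

/-- The velocity $X$ itself solves the linearised equation, and its symplectic product with $u$,
namely $\tfrac12dp(u)$, is constant. -/
theorem symplForm_velocity_eq (h : IsCometricOn G U) (hγ : IsChartGeodesic G U γ a b)
    {u : ℝ → Phase n} (hu : ∀ t ∈ Icc a b,
      HasDerivWithinAt u (fderiv ℝ (freeVector G) (γ t) (u t)) (Icc a b) t) {t : ℝ}
    (ht : t ∈ Icc a b) : fderiv ℝ (symbolForm G) (γ t) (u t) =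
      fderiv ℝ (symbolForm G) (γ a) (u a) := by
  have hd : ∀ t ∈ Icc a b, HasDerivWithinAt (fun t => symplForm (freeVector G (γ t)) (u t)) 0
      (Icc a b) t := by
    intro t ht
    have h1 := (hγ.hasDerivWithinAt_velocity h ht).symplForm (hu t ht)
    rwa [h.symplForm_fderiv_freeVector (hγ.mem t ht)] at h1
  have h2 := constant_of_derivWithin_zero (fun t ht => (hd t ht).differentiableWithinAt)
    (fun t ht => (hd t (Ico_subset_Icc_self ht)).derivWithin
      (uniqueDiffOn_Icc (ht.1.trans_lt ht.2) t (Ico_subset_Icc_self ht))) t ht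
  rw [IsCometricOn.symplForm_freeVector, IsCometricOn.symplForm_freeVector] at h2
  linarith

theorem continuousOn_perturbation (h : IsCometricOn G U) (hγ : IsChartGeodesic G U γ a b)
    {f : Rn n → ℝ} (hf : ContDiff ℝ ∞ f) :
    ContinuousOn (fun t => geodesicVector G f (γ t) - freeVector G (γ t)) (Icc a b) :=
  ((contDiffOn_geodesicVector h.isOpen h.contDiffOn hf.contDiffOn).continuousOn.comp
    hγ.continuousOn hγ.mapsTo).sub (h.contDiffOn_freeVector.continuousOn.comp hγ.continuousOn
      hγ.mapsTo)

/-- A solution of the linearised equation along a geodesic which is annihilated by all conformal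
perturbations supported near a simple point of the geodesic is a multiple of the velocity. -/
theorem exists_eq_smul_velocity (h : IsCometricOn G U) (hγ : IsChartGeodesic G U γ a b)
    {u : ℝ → Phase n} (hu : ∀ t ∈ Icc a b,
      HasDerivWithinAt u (fderiv ℝ (freeVector G) (γ t) (u t)) (Icc a b) t)
    {W : Set (Rn n)} (hW : IsOpen W) {t₁ : ℝ} (ht₁ : t₁ ∈ Ioo a b)
    (hsimple : ∀ᶠ s in 𝓝 t₁, (γ s).1 ∈ W ∧ ∀ t ∈ Icc a b, (γ t).1 = (γ s).1 → t = s)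
    (hT : ∀ f : Rn n → ℝ, ContDiff ℝ ∞ f → HasCompactSupport f → tsupport f ⊆ W →
      ∫ t in a..b, symplForm (u t) (geodesicVector G f (γ t) - freeVector G (γ t)) = 0) :
    ∃ r : ℝ, ∀ t ∈ Icc a b, u t = r • freeVector G (γ t) := by
  have hab : a ≤ b := (ht₁.1.trans ht₁.2).le
  set p := symbolForm G (γ a) with hp
  have hp0 : 0 < p := hγ.symbolForm_pos h hab
  set κ := fderiv ℝ (symbolForm G) (γ a) (u a) with hκ
  set x := fun t => (γ t).1 with hx
  set β := fun t => (u t).1 with hβ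
  set X := fun t => freeVector G (γ t) with hX
  have hX1 : ∀ t ∈ Icc a b, (X t).1 = G (γ t).1 (γ t).2 := fun t ht =>
    h.freeVector_fst (hγ.mem t ht)
  have hξX : ∀ t ∈ Icc a b, (γ t).2 (X t).1 = p := fun t ht => by
    rw [hX1 t ht]; exact hγ.symbolForm_eq h ht
  have hXne : ∀ t ∈ Icc a b, (X t).1 ≠ 0 := fun t ht h0 => by
    have := hξX t ht
    rw [h0, map_zero] at this
    exact hp0.ne this
  have hucont : ContinuousOn u (Icc a b) := fun t ht => (hu t ht).continuousWithinAt
  have hxc : ContinuousOn x (Icc a b) := hγ.continuousOn.fst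
  have hβc : ContinuousOn β (Icc a b) := hucont.fst
  have hT' : ∀ f : Rn n → ℝ, ContDiff ℝ ∞ f → HasCompactSupport f → tsupport f ⊆ W →
      ∫ t in a..b, (fderiv ℝ f (x t) (β t) + κ / p * f (x t)) = 0 := by
    intro f hf hfc hfW
    have h1 := hT f hf hfc hfW
    have h2 : ∫ t in a..b, symplForm (u t) (geodesicVector G f (γ t) - freeVector G (γ t)) =
        ∫ t in a..b, -(1 / 2) * p * (fderiv ℝ f (x t) (β t) + κ / p * f (x t)) := by
      refine intervalIntegral.integral_congr fun t ht => ?_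
      rw [uIcc_of_le hab] at ht
      rw [h.symplForm_geodesicVector_sub (hγ.mem t ht) (hf.differentiable (by simp) _),
        hγ.symbolForm_eq h ht, hγ.symplForm_velocity_eq h hu ht, ← hp, ← hκ]
      field_simp
      simp only [hx, hβ]
      ring
    rw [h2, intervalIntegral.integral_const_mul] at h1
    exact (mul_eq_zero.1 h1).resolve_left (by have := hp0.ne'; simp [this])
  have hIcc : ∀ᶠ s in 𝓝 t₁, s ∈ Ioo a b := Ioo_mem_nhds ht₁.1 ht₁.2
  have hdγ : ∀ s ∈ Ioo a b, HasDerivAt γ (X s) s := fun s hs =>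
    (hγ.hasDerivWithinAt s (Ioo_subset_Icc_self hs)).hasDerivAt (Icc_mem_nhds hs.1 hs.2)
  have hdX : ∀ s ∈ Ioo a b, HasDerivAt X (fderiv ℝ (freeVector G) (γ s) (X s)) s := fun s hs =>
    (hγ.hasDerivWithinAt_velocity h (Ioo_subset_Icc_self hs)).hasDerivAt (Icc_mem_nhds hs.1 hs.2)
  have hdu : ∀ s ∈ Ioo a b, HasDerivAt u (fderiv ℝ (freeVector G) (γ s) (u s)) s := fun s hs =>
    (hu s (Ioo_subset_Icc_self hs)).hasDerivAt (Icc_mem_nhds hs.1 hs.2)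
  -- Since $\xi(\dot x)=p$, a relation $\beta=q\dot x$ forces $q=\xi(\beta)/p$. This formula defines
  -- a differentiable function before proportionality is known.
  set r : ℝ → ℝ := fun t => p⁻¹ * (γ t).2 (β t) with hr
  set r' : ℝ → ℝ := fun t => p⁻¹ * ((X t).2 (β t) +
    (γ t).2 (fderiv ℝ (freeVector G) (γ t) (u t)).1) with hr'
  have hdr : ∀ s ∈ Ioo a b, HasDerivAt r (r' s) s := fun s hs => by
    have h1 : HasDerivAt (fun t => (γ t).2) (X s).2 s := (hdγ s hs).snd
    have h2 : HasDerivAt β (fderiv ℝ (freeVector G) (γ s) (u s)).1 s := (hdu s hs).fst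
    exact (h1.clm_apply h2).const_mul _
  have hXc : ContinuousOn X (Icc a b) := fun t ht =>
    (hγ.hasDerivWithinAt_velocity h ht).continuousWithinAt
  have hr'c : ContinuousOn r' (Icc a b) :=
    continuousOn_const.mul ((hXc.snd.clm_apply hβc).add
      (hγ.continuousOn.snd.clm_apply (((hγ.continuousOn_fderiv h).clm_apply hucont).fst)))
  have hpar : ∀ᶠ s in 𝓝 t₁, β s = r s • (X s).1 := by
    filter_upwards [hsimple, hIcc] with s hs hsab
    have hsI := Ioo_subset_Icc_self hsab
    have h1 : HasDerivAt x (X s).1 s := (hdγ s hsab).fst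
    obtain ⟨q, hq⟩ := exists_eq_smul_of_integral_eq_zero hsab hxc hβc h1 (hXne s hsI) hs.2
      (hW.mem_nhds hs.1) hT'
    have h2 : r s = q := by
      simp only [hr]
      rw [hq, map_smul, hξX s hsI, smul_eq_mul]
      field_simp
    rw [h2, hq]
  have hkey : r' t₁ = κ / p := by
    refine eq_of_integral_eq_zero (x' := fun t => (X t).1) ht₁ hxc hβc
      (hXne _ (Ioo_subset_Icc_self ht₁)) hsimple.self_of_nhds.2
      (hW.mem_nhds hsimple.self_of_nhds.1) hT' ?_ ?_ ?_ hpar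
    · filter_upwards [hIcc] with s hs using (hdγ s hs).fst
    · filter_upwards [hIcc] with s hs using hdr s hs
    · filter_upwards [hIcc] with s hs using hr'c.continuousAt (Icc_mem_nhds hs.1 hs.2)
  have hI₁ := Ioo_subset_Icc_self ht₁
  have hU₁ := hγ.mem t₁ hI₁
  set A := fderiv ℝ (freeVector G) (γ t₁) with hA
  -- The derivative of $\beta$ at $t_1$ computed twice: from the linearised equation and from
  -- $\beta=r\dot x$.
  have hβ' : (A (u t₁)).1 = r t₁ • (A (X t₁)).1 + r' t₁ • (X t₁).1 := by
    have h1 : HasDerivAt β (A (u t₁)).1 t₁ := (hdu t₁ ht₁).fst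
    have h2 : HasDerivAt (fun t => (X t).1) (A (X t₁)).1 t₁ := (hdX t₁ ht₁).fst
    exact h1.unique (((hdr t₁ ht₁).smul h2).congr_of_eventuallyEq hpar)
  have hβ₁ : (u t₁).1 = r t₁ • (X t₁).1 := hpar.self_of_nhds
  -- At $t_1$ the vector $u-rX$ is vertical, $(0,\eta)$ say, and `hβ'` gives $G\eta=r'\,G\xi$;
  -- definiteness of $G$ gives $\eta=r'\xi$.
  have hη : (u t₁).2 = r t₁ • (X t₁).2 + r' t₁ • (γ t₁).2 := by
    have h1 : u t₁ - r t₁ • X t₁ = (0, (u t₁).2 - r t₁ • (X t₁).2) :=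
      Prod.ext (sub_eq_zero.2 hβ₁) rfl
    have h2 := h.fderiv_freeVector_vertical hU₁ ((u t₁).2 - r t₁ • (X t₁).2)
    rw [← h1, map_sub, map_smul, Prod.fst_sub, Prod.smul_fst, ← hA, hβ', add_sub_cancel_left,
      hX1 t₁ hI₁, ← map_smul] at h2
    have h3 : G (γ t₁).1 ((u t₁).2 - r t₁ • (X t₁).2 - r' t₁ • (γ t₁).2) = 0 := by
      rw [map_sub, h2, sub_self]
    have h4 : (u t₁).2 - r t₁ • (X t₁).2 - r' t₁ • (γ t₁).2 = 0 := by
      by_contra hne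
      have := h.pos _ hU₁ _ hne
      rw [h3, map_zero] at this
      exact lt_irrefl _ this
    rw [sub_sub, sub_eq_zero] at h4
    exact h4
  have hu₁ : u t₁ = r t₁ • X t₁ + r' t₁ • (0, (γ t₁).2) :=
    Prod.ext (by simp [hβ₁]) (by simp [hη])
  -- Applying $dp$ to `hu₁`: it vanishes on $X$ and equals $2p$ on $(0,\xi)$ by homogeneity, so
  -- $\kappa=2pr'=2\kappa$.
  have hκ0 : r' t₁ = 0 := by
    have h1 := hγ.symplForm_velocity_eq h hu hI₁
    obtain ⟨L, hL, hL'⟩ := hasFDerivAt_symbolForm (w := γ t₁) (h.differentiableAt hU₁)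
    have h2 : fderiv ℝ (symbolForm G) (γ t₁) (0, (γ t₁).2) = 2 * p := by
      rw [hL.fderiv, hL']
      have := hγ.symbolForm_eq h hI₁
      rw [symbolForm, ← hp] at this
      simp [this]
      ring
    rw [hu₁, map_add, map_smul, map_smul, hX, IsCometricOn.fderiv_symbolForm_freeVector, h2,
      ← hκ, hkey] at h1
    simp only [smul_eq_mul, mul_zero, zero_add] at h1
    rw [hkey]
    field_simp at h1 ⊢
    linarith
  rw [hκ0, zero_smul, add_zero] at hu₁
  refine ⟨r t₁, ?_⟩
  obtain ⟨C, hC⟩ : ∃ C, ∀ t ∈ Icc a b, ‖fderiv ℝ (freeVector G) (γ t)‖ ≤ C :=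
    isCompact_Icc.exists_bound_of_continuousOn (hγ.continuousOn_fderiv h)
  have hw : ∀ t ∈ Icc a b, HasDerivWithinAt (fun t => u t - r t₁ • X t)
      (fderiv ℝ (freeVector G) (γ t) (u t - r t₁ • X t)) (Icc a b) t := by
    intro t ht
    refine ((hu t ht).fun_sub ((hγ.hasDerivWithinAt_velocity h ht).fun_const_smul
      (r t₁))).congr_deriv ?_
    rw [map_sub, map_smul]
  have hz := eq_zero_of_norm_deriv_le hI₁ hw (C := C) (fun t ht =>
    (ContinuousLinearMap.le_opNorm _ _).trans
      (mul_le_mul_of_nonneg_right (hC t ht) (norm_nonneg _))) (sub_eq_zero.2 hu₁)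
  exact fun t ht => sub_eq_zero.1 (hz t ht)

/-- The first variations of the endpoint obtained by conformal perturbations supported near a
simple point of a geodesic, together with the variation of the length of the initial covector,
have trivial annihilator. -/
theorem eq_zero_of_annihilates (h : IsCometricOn G U) (hγ : IsChartGeodesic G U γ a b)
    {Z : ℝ → Phase n →L[ℝ] Phase n} (hZa : Z a = ContinuousLinearMap.id ℝ _)
    (hZ : ∀ t ∈ Icc a b, HasDerivWithinAt Z (-(Z t ∘L fderiv ℝ (freeVector G) (γ t))) (Icc a b) t)
    {W : Set (Rn n)} (hW : IsOpen W) {t₁ : ℝ} (ht₁ : t₁ ∈ Ioo a b)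
    (hsimple : ∀ᶠ s in 𝓝 t₁, (γ s).1 ∈ W ∧ ∀ t ∈ Icc a b, (γ t).1 = (γ s).1 → t = s)
    {l : Phase n →L[ℝ] ℝ} (hl : l (0, (γ a).2) = 0)
    (hT : ∀ f : Rn n → ℝ, ContDiff ℝ ∞ f → HasCompactSupport f → tsupport f ⊆ W →
      l (∫ t in a..b, Z t (geodesicVector G f (γ t) - freeVector G (γ t))) = 0) : l = 0 := by
  have hab : a ≤ b := (ht₁.1.trans ht₁.2).le
  have haI : a ∈ Icc a b := ⟨le_rfl, hab⟩
  obtain ⟨r, hr⟩ := hγ.exists_eq_smul_velocity h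
    (fun t ht => hγ.hasDerivWithinAt_symplGrad h ht (hZ t ht) l) hW ht₁ hsimple
    (fun f hf hfc hfW => by
      have hZc : ContinuousOn Z (Icc a b) := fun t ht => (hZ t ht).continuousWithinAt
      have hint := (hZc.clm_apply (hγ.continuousOn_perturbation h hf)).intervalIntegrable_of_Icc
        (μ := MeasureTheory.volume) hab
      rw [← hT f hf hfc hfW, ← l.intervalIntegral_comp_comm hint]
      exact intervalIntegral.integral_congr fun t _ => symplForm_symplGrad _ _)
  have ha := hr a haI
  -- The radial vector excludes the remaining multiple of $X$: their symplectic product is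
  -- $\xi(G\xi)=p>0$.
  have h1 := symplForm_symplGrad (l ∘L Z a) (0, (γ a).2)
  rw [ha, symplForm_smul_left, hZa, ContinuousLinearMap.comp_id, hl, symplForm] at h1
  simp only [map_zero, sub_zero] at h1
  rw [h.freeVector_fst (hγ.mem a haI)] at h1
  have hr0 : r = 0 := (mul_eq_zero.1 h1).resolve_right (hγ.symbolForm_pos h hab).ne'
  rw [hr0, zero_smul, hZa, ContinuousLinearMap.comp_id] at ha
  refine ContinuousLinearMap.ext fun w => ?_
  rw [← symplForm_symplGrad l, ha]
  simp [symplForm]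

end IsChartGeodesic

end JacobiFields

/-! ### Selecting finitely many spanning vectors. -/

section SpanningFamilies

variable {V : Type*} [AddCommGroup V] [Module ℝ V] [FiniteDimensional ℝ V]

/-- Extend $\{e\}$ to a basis inside the spanning set; deleting $e$ leaves exactly $\dim V-1$
vectors, all in $T$. -/
theorem exists_family_span_insert {e : V} (he : e ≠ 0) {T : Set V}
    (hT : ⊤ ≤ Submodule.span ℝ (insert e T)) {m : ℕ} (hm : Module.finrank ℝ V - 1 = m) :
    ∃ v : Fin m → V, (∀ i, v i ∈ T) ∧
      ∀ w, ∃ (τ : ℝ) (σ : Fin m → ℝ), w = τ • e + ∑ i, σ i • v i := by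
  have hs : LinearIndepOn ℝ id {e} := LinearIndepOn.singleton (by simpa using he)
  have hst : {e} ⊆ insert e T := by simp
  obtain ⟨B, b, hbB, heB, hBT⟩ : ∃ (B : Set V) (b : Module.Basis B ℝ V), range b = B ∧ e ∈ B ∧
      B ⊆ insert e T :=
    ⟨_, Module.Basis.extendLe hs hst hT, Module.Basis.range_extendLe hs hst hT,
      hs.subset_extend hst rfl, hs.extend_subset hst⟩
  have hfin : Finite B := Module.Finite.finite_basis b
  have hcard : B.ncard = Module.finrank ℝ V := (Module.finrank_eq_nat_card_basis b).symm
  have hspan : Submodule.span ℝ B = ⊤ := by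
    have h1 := b.span_eq
    rwa [hbB] at h1
  have hfin' : Finite (B \ {e} : Set V) := Finite.Set.subset B sdiff_subset
  have hc : Nat.card (B \ {e} : Set V) = m := by
    have h1 : (B \ {e}).ncard = B.ncard - 1 := ncard_sdiff_singleton_of_mem heB
    rw [← hm, ← hcard, ← h1]
    rfl
  let ε := Finite.equivFinOfCardEq hc
  refine ⟨fun i => (ε.symm i : V), fun i => ?_, fun w => ?_⟩
  · have h1 := (ε.symm i).2
    exact (hBT h1.1).resolve_left h1.2
  · have hw : w ∈ Submodule.span ℝ (insert e (B \ {e})) := by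
      rw [insert_sdiff_singleton, insert_eq_of_mem heB, hspan]; trivial
    obtain ⟨τ, z, hz, rfl⟩ := Submodule.mem_span_insert.1 hw
    have hr : range (fun i => (ε.symm i : V)) = B \ {e} := by
      rw [show (fun i => (ε.symm i : V)) = Subtype.val ∘ ε.symm from rfl, ε.symm.surjective.range_comp]
      exact Subtype.range_coe
    rw [← hr, Submodule.mem_span_range_iff_exists_fun] at hz
    obtain ⟨σ, rfl⟩ := hz
    exact ⟨τ, σ, rfl⟩

end SpanningFamilies

/-! ### Linear families of perturbations and the endpoint map in a chart. -/

section PerturbedFlowInChart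

variable {n : ℕ} {G : Rn n → (Rn n →L[ℝ] ℝ) →L[ℝ] Rn n} {U : Set (Rn n)} {γ : ℝ → Phase n}
  {a b : ℝ}

theorem eq_of_symplForm_eq {u u' : Phase n} (h : ∀ w, symplForm w u = symplForm w u') : u = u' := by
  refine Prod.ext ?_ (ContinuousLinearMap.ext fun v => ?_)
  · ext j
    have := h (0, EuclideanSpace.proj j)
    simpa [symplForm] using this
  · have := h (v, 0)
    simpa [symplForm] using this

variable {m : ℕ} {f : Fin m → Rn n → ℝ}

/-- The first order change of the Hamiltonian vector field under a conformal perturbation. -/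
def variationVector (G : Rn n → (Rn n →L[ℝ] ℝ) →L[ℝ] Rn n) (f : Rn n → ℝ) (w : Phase n) : Phase n :=
  geodesicVector G f w - freeVector G w

/-- The Hamiltonian vector field of a family of conformal perturbations depending linearly on the
parameter. -/
def perturbedVector (G : Rn n → (Rn n →L[ℝ] ℝ) →L[ℝ] Rn n) (f : Fin m → Rn n → ℝ)
    (z : Phase n × Rn m) : Phase n :=
  freeVector G z.1 + ∑ i, z.2 i • variationVector G (f i) z.1

theorem symplForm_add_right (u w w' : Phase n) :
    symplForm u (w + w') = symplForm u w + symplForm u w' := by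
  simp [symplForm]; ring

theorem symplForm_smul_right (r : ℝ) (u w : Phase n) :
    symplForm u (r • w) = r * symplForm u w := by
  simp [symplForm]; ring

theorem symplForm_sum_right {ι : Type*} (s : Finset ι) (u : Phase n) (w : ι → Phase n) :
    symplForm u (∑ i ∈ s, w i) = ∑ i ∈ s, symplForm u (w i) := by
  classical
  induction s using Finset.induction_on with
  | empty => simp [symplForm]
  | insert i s hi ih => rw [Finset.sum_insert hi, Finset.sum_insert hi, symplForm_add_right, ih]

/-- The change of the field is linear in `f`, because $f\mapsto d(fp)$ is. -/
theorem geodesicVector_sum (h : IsCometricOn G U) (hf : ∀ i, ContDiff ℝ ∞ (f i)) (σ : Rn m)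
    {w : Phase n} (hw : w.1 ∈ U) :
    geodesicVector G (fun y => ∑ i, σ i * f i y) w = perturbedVector G f (w, σ) := by
  have hd : ∀ i, DifferentiableAt ℝ (f i) w.1 := fun i => (hf i).differentiable (by simp) _
  have hsum : HasFDerivAt (fun y => ∑ i, σ i * f i y) (∑ i, σ i • fderiv ℝ (f i) w.1) w.1 :=
    HasFDerivAt.fun_sum fun i _ => (hd i).hasFDerivAt.const_mul (σ i)
  have key : geodesicVector G (fun y => ∑ i, σ i * f i y) w - freeVector G w =
      ∑ i, σ i • variationVector G (f i) w := by
    refine eq_of_symplForm_eq fun u => ?_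
    rw [h.symplForm_geodesicVector_sub hw hsum.differentiableAt, symplForm_sum_right, hsum.fderiv,
      sum_apply, Finset.sum_mul, Finset.sum_mul, ← Finset.sum_add_distrib, Finset.mul_sum]
    refine Finset.sum_congr rfl fun i _ => ?_
    rw [symplForm_smul_right, variationVector, h.symplForm_geodesicVector_sub hw (hd i), smul_apply,
      smul_eq_mul]
    ring
  rw [perturbedVector, ← key]
  abel

theorem contDiffOn_variationVector (h : IsCometricOn G U) {f : Rn n → ℝ} (hf : ContDiff ℝ ∞ f) :
    ContDiffOn ℝ ∞ (variationVector G f) (U ×ˢ univ) :=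
  (contDiffOn_geodesicVector h.isOpen h.contDiffOn hf.contDiffOn).sub h.contDiffOn_freeVector

theorem contDiffOn_perturbedVector (h : IsCometricOn G U) (hf : ∀ i, ContDiff ℝ ∞ (f i)) :
    ContDiffOn ℝ ∞ (perturbedVector G f) ((U ×ˢ (univ : Set (Rn n →L[ℝ] ℝ))) ×ˢ (univ : Set (Rn m))) := by
  have hp : ContDiffOn ℝ ∞ (fun z : Phase n × Rn m => z.1)
    ((U ×ˢ (univ : Set (Rn n →L[ℝ] ℝ))) ×ˢ (univ : Set (Rn m))) := contDiff_fst.contDiffOn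
  have hmaps : MapsTo (fun z : Phase n × Rn m => z.1)
    ((U ×ˢ (univ : Set (Rn n →L[ℝ] ℝ))) ×ˢ (univ : Set (Rn m))) (U ×ˢ univ) := fun z hz => hz.1
  refine (h.contDiffOn_freeVector.comp hp hmaps).add (ContDiffOn.sum fun i _ => ?_)
  have h1 : ContDiff ℝ ∞ (fun z : Phase n × Rn m => z.2 i) :=
    (EuclideanSpace.proj i : Rn m →L[ℝ] ℝ).contDiff.comp contDiff_snd
  exact h1.contDiffOn.smul ((contDiffOn_variationVector h (hf i)).comp hp hmaps)

theorem exists_hasFDerivAt_perturbedVector (h : IsCometricOn G U) (hf : ∀ i, ContDiff ℝ ∞ (f i))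
    {w : Phase n} (hw : w.1 ∈ U) :
    ∃ L : Phase n × Rn m →L[ℝ] Phase n, HasFDerivAt (perturbedVector G f) L (w, 0) ∧
      ∀ u σ, L (u, σ) = fderiv ℝ (freeVector G) w u + ∑ i, σ i • variationVector G (f i) w := by
  have hp : HasFDerivAt (fun z : Phase n × Rn m => z.1)
    (ContinuousLinearMap.fst ℝ (Phase n) (Rn m)) (w, 0) := hasFDerivAt_fst
  have h0 : HasFDerivAt (fun z : Phase n × Rn m => freeVector G z.1) _ (w, 0) :=
    HasFDerivAt.comp (w, (0 : Rn m)) (f := fun z : Phase n × Rn m => z.1)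
      (h.hasFDerivAt_freeVector hw) hp
  have hi : ∀ i, HasFDerivAt (fun z : Phase n × Rn m => z.2 i • variationVector G (f i) z.1)
      (((EuclideanSpace.proj i : Rn m →L[ℝ] ℝ) ∘L ContinuousLinearMap.snd ℝ (Phase n) (Rn m)).smulRight
        (variationVector G (f i) w)) (w, 0) := by
    intro i
    have h1 : HasFDerivAt (fun z : Phase n × Rn m => z.2 i)
        ((EuclideanSpace.proj i : Rn m →L[ℝ] ℝ) ∘L ContinuousLinearMap.snd ℝ (Phase n) (Rn m))
        (w, 0) := ((EuclideanSpace.proj i : Rn m →L[ℝ] ℝ) ∘L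
          ContinuousLinearMap.snd ℝ (Phase n) (Rn m)).hasFDerivAt
    have h2 : HasFDerivAt (variationVector G (f i)) (fderiv ℝ (variationVector G (f i)) w) w :=
      (((contDiffOn_variationVector h (hf i)).contDiffAt
        (h.isOpen_prod.mem_nhds ⟨hw, trivial⟩)).differentiableAt (by simp)).hasFDerivAt
    have h3 : HasFDerivAt (fun z : Phase n × Rn m => variationVector G (f i) z.1) _ (w, 0) :=
      HasFDerivAt.comp (w, (0 : Rn m)) (f := fun z : Phase n × Rn m => z.1) h2 hp
    refine (h1.smul h3).congr_fderiv ?_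
    ext1 <;> ext1 <;> simp
  refine ⟨_, h0.add (HasFDerivAt.fun_sum fun i _ => hi i), fun u σ => ?_⟩
  simp

/-- First variation of the endpoint, pulled back to the initial point by the inverse `Z` of the
linearised flow. -/
theorem apply_inverse_flow_eq {A : ℝ → Phase n →L[ℝ] Phase n} {Z : ℝ → Phase n →L[ℝ] Phase n}
    (hab : a ≤ b) (hZa : Z a = ContinuousLinearMap.id ℝ _)
    (hZ : ∀ t ∈ Icc a b, HasDerivWithinAt Z (-(Z t ∘L A t)) (Icc a b) t) {u β : ℝ → Phase n}
    (hu : ∀ t ∈ Icc a b, HasDerivWithinAt u (A t (u t) + β t) (Icc a b) t)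
    (hβ : ContinuousOn β (Icc a b)) : Z b (u b) = u a + ∫ t in a..b, Z t (β t) := by
  have hd : ∀ t ∈ Icc a b, HasDerivWithinAt (fun t => Z t (u t)) (Z t (β t)) (Icc a b) t := by
    intro t ht
    refine ((hZ t ht).clm_apply (hu t ht)).congr_deriv ?_
    simp
  have hZc : ContinuousOn Z (Icc a b) := fun t ht => (hZ t ht).continuousWithinAt
  rw [intervalIntegral.integral_eq_sub_of_hasDerivAt_of_le hab
    (fun t ht => (hd t ht).continuousWithinAt)
    (fun t ht => (hd t (Ioo_subset_Icc_self ht)).hasDerivAt (Icc_mem_nhds ht.1 ht.2))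
    ((hZc.clm_apply hβ).intervalIntegrable_of_Icc hab), hZa]
  simp

theorem finrank_phase : Module.finrank ℝ (Phase n) = 2 * n := by
  have h1 : Module.finrank ℝ (Rn n →L[ℝ] ℝ) = n := by
    rw [← (LinearMap.toContinuousLinearMap : (Rn n →ₗ[ℝ] ℝ) ≃ₗ[ℝ] (Rn n →L[ℝ] ℝ)).finrank_eq]
    exact Subspace.dual_finrank_eq.trans finrank_euclideanSpace_fin
  rw [Module.finrank_prod, h1, finrank_euclideanSpace_fin, two_mul]

theorem eq_const_of_hasDerivWithinAt_zero {E : Type*} [NormedAddCommGroup E] [NormedSpace ℝ E]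
    {c : ℝ → E} (hd : ∀ t ∈ Icc a b, HasDerivWithinAt c 0 (Icc a b) t) {t : ℝ}
    (ht : t ∈ Icc a b) : c t = c a :=
  constant_of_derivWithin_zero (fun t ht => (hd t ht).differentiableWithinAt)
    (fun t ht => (hd t (Ico_subset_Icc_self ht)).derivWithin
      (uniqueDiffOn_Icc (ht.1.trans_lt ht.2) t (Ico_subset_Icc_self ht))) t ht

/-- The suspension of the perturbed vector fields. -/
def suspendedVector (G : Rn n → (Rn n →L[ℝ] ℝ) →L[ℝ] Rn n) (f : Fin m → Rn n → ℝ)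
    (z : Phase n × Rn m) : Phase n × Rn m := (perturbedVector G f z, 0)

theorem contDiffOn_suspendedVector (h : IsCometricOn G U) (hf : ∀ i, ContDiff ℝ ∞ (f i)) :
    ContDiffOn ℝ ∞ (suspendedVector G f)
      ((U ×ˢ (univ : Set (Rn n →L[ℝ] ℝ))) ×ˢ (univ : Set (Rn m))) :=
  (contDiffOn_perturbedVector h hf).prodMk contDiffOn_const

theorem fderiv_suspendedVector (h : IsCometricOn G U) (hf : ∀ i, ContDiff ℝ ∞ (f i))
    {w : Phase n} (hw : w.1 ∈ U) (z : Phase n × Rn m) :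
    fderiv ℝ (suspendedVector G f) (w, 0) z =
      (fderiv ℝ (freeVector G) w z.1 + ∑ i, z.2 i • variationVector G (f i) w, 0) := by
  obtain ⟨L, hL, hL'⟩ := exists_hasFDerivAt_perturbedVector (f := f) h hf hw
  have h1 := hL.prodMk (hasFDerivAt_const (0 : Rn m) (w, (0 : Rn m)))
  rw [show fderiv ℝ (suspendedVector G f) (w, 0) = _ from h1.fderiv, ← hL']
  rfl

theorem hasDerivWithinAt_suspended {t : ℝ}
    (hγ : HasDerivWithinAt γ (freeVector G (γ t)) (Icc a b) t) :
    HasDerivWithinAt (fun t => (γ t, (0 : Rn m))) (suspendedVector G f (γ t, 0)) (Icc a b) t := by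
  have h1 := hγ.prodMk (hasDerivWithinAt_const t (Icc a b) (0 : Rn m))
  have h2 : perturbedVector G f (γ t, 0) = freeVector G (γ t) := by
    simp [perturbedVector]
  rw [suspendedVector, h2]
  exact h1

namespace IsChartGeodesic

/-- The parameter component of a linearised solution is constant, so the phase component solves an
inhomogeneous linear equation and Duhamel's formula applies. -/
theorem apply_inverse_suspended_flow_eq (h : IsCometricOn G U) (hγ : IsChartGeodesic G U γ a b)
    (hab : a ≤ b) (hf : ∀ i, ContDiff ℝ ∞ (f i)) {Z : ℝ → Phase n →L[ℝ] Phase n}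
    (hZa : Z a = ContinuousLinearMap.id ℝ _)
    (hZ : ∀ t ∈ Icc a b, HasDerivWithinAt Z (-(Z t ∘L fderiv ℝ (freeVector G) (γ t))) (Icc a b) t)
    {u : ℝ → Phase n × Rn m} (hu : ∀ t ∈ Icc a b,
      HasDerivWithinAt u (fderiv ℝ (suspendedVector G f) (γ t, 0) (u t)) (Icc a b) t) :
    Z b (u b).1 = (u a).1 +
      ∑ i, (u a).2 i • ∫ t in a..b, Z t (variationVector G (f i) (γ t)) := by
  have hd : ∀ t ∈ Icc a b, HasDerivWithinAt (fun t => (u t).2) 0 (Icc a b) t := fun t ht => by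
    have h1 := (hu t ht).snd
    rw [fderiv_suspendedVector h hf (hγ.mem t ht)] at h1
    exact h1
  have hfst : ∀ t ∈ Icc a b, HasDerivWithinAt (fun t => (u t).1)
      (fderiv ℝ (freeVector G) (γ t) (u t).1 + ∑ i, (u a).2 i • variationVector G (f i) (γ t))
      (Icc a b) t := fun t ht => by
    have h1 := (hu t ht).fst
    rw [fderiv_suspendedVector h hf (hγ.mem t ht), eq_const_of_hasDerivWithinAt_zero hd ht] at h1
    exact h1
  have hvc : ∀ i, ContinuousOn (fun t => variationVector G (f i) (γ t)) (Icc a b) := fun i =>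
    hγ.continuousOn_perturbation h (hf i)
  have hZc : ContinuousOn Z (Icc a b) := fun t ht => (hZ t ht).continuousWithinAt
  have hvc' : ∀ i (c : ℝ), ContinuousOn (fun t => c • variationVector G (f i) (γ t)) (Icc a b) :=
    fun i c => (continuous_const_smul c).comp_continuousOn (hvc i)
  rw [apply_inverse_flow_eq hab hZa hZ hfst (continuousOn_finsetSum _ fun i _ => hvc' i _)]
  congr 1
  simp only [map_sum, map_smul]
  have hint : ∀ i ∈ Finset.univ, IntervalIntegrable
      (fun t => (u a).2 i • Z t (variationVector G (f i) (γ t))) MeasureTheory.volume a b :=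
    fun i _ => ContinuousOn.intervalIntegrable_of_Icc hab
      ((continuous_const_smul _).comp_continuousOn (hZc.clm_apply (hvc i)))
  rw [intervalIntegral.integral_finsetSum hint]
  exact Finset.sum_congr rfl fun i _ => intervalIntegral.integral_smul _ _

/-- Treating the parameters as extra coordinates with zero velocity turns dependence on parameters
into dependence on initial values. The map `ι` supplies these initial values. -/
theorem exists_perturbed_flow (h : IsCometricOn G U) (hγ : IsChartGeodesic G U γ a b)
    (hab : a ≤ b) (hf : ∀ i, ContDiff ℝ ∞ (f i)) {Z : ℝ → Phase n →L[ℝ] Phase n}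
    (hZa : Z a = ContinuousLinearMap.id ℝ _)
    (hZ : ∀ t ∈ Icc a b, HasDerivWithinAt Z (-(Z t ∘L fderiv ℝ (freeVector G) (γ t))) (Icc a b) t) :
    ∃ Φ : ℝ × Rn m → ℝ → Phase n,
      (∀ᶠ q in 𝓝 ((1 : ℝ), (0 : Rn m)), Φ q a = ((γ a).1, q.1 • (γ a).2) ∧
        ∀ t ∈ Icc a b, (Φ q t).1 ∈ U ∧ HasDerivWithinAt (Φ q)
          (geodesicVector G (fun y => ∑ i, q.2 i * f i y) (Φ q t)) (Icc a b) t) ∧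
      Φ (1, 0) b = γ b ∧
      ∃ D : ℝ × Rn m →L[ℝ] Phase n, HasFDerivAt (fun q => Φ q b) D (1, 0) ∧
        ∀ q : ℝ × Rn m, Z b (D q) = q.1 • ((0, (γ a).2) : Phase n) +
          ∑ i, q.2 i • ∫ t in a..b, Z t (variationVector G (f i) (γ t)) := by
  set Ω : Set (Phase n × Rn m) := (U ×ˢ univ) ×ˢ univ with hΩ
  have hΩo : IsOpen Ω := h.isOpen_prod.prod isOpen_univ
  have hXs := contDiffOn_suspendedVector (m := m) h hf
  have hΓΩ : ∀ t ∈ Icc a b, (γ t, (0 : Rn m)) ∈ Ω := fun t ht => ⟨hγ.mapsTo ht, trivial⟩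
  have hΓd := fun t ht => hasDerivWithinAt_suspended (f := f) (hγ.hasDerivWithinAt t ht)
  have hΓc : ContinuousOn (fun t => (γ t, (0 : Rn m))) (Icc a b) :=
    fun t ht => (hΓd t ht).continuousWithinAt
  have hXc : ContinuousOn (fun t => fderiv ℝ (suspendedVector G f) (γ t, 0)) (Icc a b) :=
    (hXs.continuousOn_fderiv_of_isOpen hΩo (by simp)).comp hΓc hΓΩ
  obtain ⟨Y, -, hYa, -, hY, -, -⟩ := exists_fundamental_solution hab hXc
  obtain ⟨Ψ, hΨ, hΨb, hΨd⟩ := exists_flow_hasFDerivAt hΩo (hXs.of_le ENat.LEInfty.out) hab hΓΩ hΓd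
    hYa hY
  set ι : ℝ × Rn m → Phase n × Rn m := fun q => (((γ a).1, q.1 • (γ a).2), q.2) with hι
  have hι1 : ι (1, 0) = (γ a, 0) := by simp [hι]
  obtain ⟨J, hJ, hJ'⟩ : ∃ J : ℝ × Rn m →L[ℝ] Phase n × Rn m, HasFDerivAt ι J (1, 0) ∧
      ∀ q, J q = (q.1 • (0, (γ a).2), q.2) := by
    have h1 : HasFDerivAt (fun q : ℝ × Rn m => q.1) (ContinuousLinearMap.fst ℝ ℝ (Rn m)) (1, 0) :=
      hasFDerivAt_fst
    have h2 : HasFDerivAt (fun q : ℝ × Rn m => q.2) (ContinuousLinearMap.snd ℝ ℝ (Rn m)) (1, 0) :=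
      hasFDerivAt_snd
    refine ⟨_, ((hasFDerivAt_const (γ a).1 _).prodMk (h1.smul_const (γ a).2)).prodMk h2,
      fun q => ?_⟩
    simp
  refine ⟨fun q t => (Ψ (ι q) t).1, ?_, ?_, ?_⟩
  · have h0 := hJ.continuousAt.tendsto
    rw [hι1] at h0
    filter_upwards [h0.eventually hΨ] with q hq
    refine ⟨by rw [hq.1], fun t ht => ?_⟩
    have hsnd : (Ψ (ι q) t).2 = q.2 := by
      rw [eq_const_of_hasDerivWithinAt_zero (c := fun t => (Ψ (ι q) t).2)
        (fun t ht => (hq.2 t ht).2.snd) ht, hq.1]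
    obtain ⟨hmem, hder⟩ := hq.2 t ht
    refine ⟨hmem.1.1, ?_⟩
    rw [geodesicVector_sum h hf _ hmem.1.1, ← hsnd]
    exact hder.fst
  · change (Ψ (ι (1, 0)) b).1 = γ b
    rw [hι1, hΨb]
  · have hΨd' : HasFDerivAt (fun z => Ψ z b) (Y b) (ι (1, 0)) := by rw [hι1]; exact hΨd
    refine ⟨_, (hΨd'.comp ((1 : ℝ), (0 : Rn m)) hJ).fst, fun q => ?_⟩
    have hU : ∀ t ∈ Icc a b, HasDerivWithinAt (fun t => Y t (J q))
        (fderiv ℝ (suspendedVector G f) (γ t, 0) (Y t (J q))) (Icc a b) t := fun t ht =>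
      ((hY t ht).clm_apply (hasDerivWithinAt_const t (Icc a b) (J q))).congr_deriv (by simp)
    have h3 := hγ.apply_inverse_suspended_flow_eq h hab hf hZa hZ hU
    rw [hYa, ContinuousLinearMap.id_apply, hJ'] at h3
    rw [← h3, ← hJ']
    rfl

/-- Near a geodesic with a simple point there are `2n - 1` conformal perturbations, supported near
that point, for which the endpoint is a submersive function of the parameters and of the length of
the initial covector. -/
theorem exists_submersive_perturbation (h : IsCometricOn G U)
    (hγ : IsChartGeodesic G U γ a b) {W : Set (Rn n)} (hW : IsOpen W) {t₁ : ℝ} (ht₁ : t₁ ∈ Ioo a b)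
    (hsimple : ∀ᶠ s in 𝓝 t₁, (γ s).1 ∈ W ∧ ∀ t ∈ Icc a b, (γ t).1 = (γ s).1 → t = s)
    (hm : 2 * n - 1 = m) :
    ∃ f : Fin m → Rn n → ℝ,
      (∀ i, ContDiff ℝ ∞ (f i) ∧ HasCompactSupport (f i) ∧ tsupport (f i) ⊆ W) ∧
      ∃ Φ : ℝ × Rn m → ℝ → Phase n,
        (∀ᶠ q in 𝓝 ((1 : ℝ), (0 : Rn m)), Φ q a = ((γ a).1, q.1 • (γ a).2) ∧
          ∀ t ∈ Icc a b, (Φ q t).1 ∈ U ∧ HasDerivWithinAt (Φ q)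
            (geodesicVector G (fun y => ∑ i, q.2 i * f i y) (Φ q t)) (Icc a b) t) ∧
        Φ (1, 0) b = γ b ∧
        ∃ D : ℝ × Rn m →L[ℝ] Phase n,
          HasFDerivAt (fun q => Φ q b) D (1, 0) ∧ Function.Surjective D := by
  have hab : a ≤ b := (ht₁.1.trans ht₁.2).le
  have hbI : b ∈ Icc a b := ⟨hab, le_rfl⟩
  obtain ⟨Y, Z, hYa, hZa, hY, hZ, hYZ⟩ := exists_fundamental_solution hab (hγ.continuousOn_fderiv h)
  set e : Phase n := (0, (γ a).2) with he
  have he0 : e ≠ 0 := fun h0 => hγ.ne_zero (congrArg Prod.snd h0)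
  set T : Set (Phase n) := {v | ∃ f : Rn n → ℝ, ContDiff ℝ ∞ f ∧ HasCompactSupport f ∧
    tsupport f ⊆ W ∧ v = ∫ t in a..b, Z t (variationVector G f (γ t))} with hTdef
  have hT : ⊤ ≤ Submodule.span ℝ (insert e T) := by
    by_contra hlt
    -- A proper span would be annihilated by a nonzero functional.
    obtain ⟨l, hl0, hl⟩ := Submodule.exists_le_ker_of_lt_top (Submodule.span ℝ (insert e T))
      (lt_of_le_of_ne le_top fun h => hlt h.ge)
    have hl1 : ∀ v ∈ insert e T, l v = 0 := fun v hv => hl (Submodule.subset_span hv)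
    have h2 : LinearMap.toContinuousLinearMap l = 0 :=
      hγ.eq_zero_of_annihilates h hZa hZ hW ht₁ hsimple (hl1 e (mem_insert _ _))
        fun f hf hfc hfW => hl1 _ (mem_insert_of_mem _ ⟨f, hf, hfc, hfW, rfl⟩)
    exact hl0 (LinearMap.ext fun v => congrArg (fun L : Phase n →L[ℝ] ℝ => L v) h2)
  obtain ⟨v, hvT, hv⟩ := exists_family_span_insert he0 hT (m := m) (by rw [finrank_phase, hm])
  choose f hf hfc hfW hfv using hvT
  obtain ⟨Φ, hΦ, hΦb, D, hD, hD'⟩ := hγ.exists_perturbed_flow h hab hf hZa hZ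
  refine ⟨f, fun i => ⟨hf i, hfc i, hfW i⟩, Φ, hΦ, hΦb, D, hD, fun w => ?_⟩
  -- Solving at the initial point, after pulling back by `Z b`, suffices because `Y b` inverts `Z
  -- b`.
  obtain ⟨τ, σ, hτσ⟩ := hv (Z b w)
  refine ⟨(τ, WithLp.toLp 2 σ), ?_⟩
  have h1 := hD' (τ, WithLp.toLp 2 σ)
  simp only [← hfv] at h1
  rw [← (hYZ b hbI).2 (D _), h1, ← hτσ, (hYZ b hbI).2]

end IsChartGeodesic

end PerturbedFlowInChart

/-! ### The time-one map and non-periodic curves. -/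

section UnitTimeCurves

variable {n : ℕ} {M : Type*} [TopologicalSpace M] [T2Space M] [ChartedSpace (Rn n) M]
  [IsManifold (𝓡 n) ∞ M] {X : (z : CotangentBundle n M) → TangentSpace (cotModel n) z}
  {z : CotangentBundle n M} {γ : ℝ → CotangentBundle n M}

theorem expField_eq (hX : IsC1Field (I := cotModel n) X) (hγ : IsUnitTimeCurve X z γ) :
    expField X z = γ 1 := by
  have h : ∃ γ, IsUnitTimeCurve X z γ := ⟨γ, hγ⟩
  rw [expField, dif_pos h]
  exact IsMIntegralCurveOn.eqOn_Icc hX h.choose_spec.2 hγ.2 (t₀ := 0) ⟨le_rfl, zero_le_one⟩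
    (h.choose_spec.1.trans hγ.1.symm) ⟨zero_le_one, le_rfl⟩

omit [T2Space M] in
-- Where no curve exists the default value is `z` itself. So the hypothesis at $t=1$ already
-- contains the existence of the geodesic on $[0,1]$.
theorem exists_isUnitTimeCurve_of_expField_ne (h : expField X z ≠ z) :
    ∃ γ, IsUnitTimeCurve X z γ := by
  by_contra hne
  exact h (by rw [expField, dif_neg hne])

omit [T2Space M] in
theorem IsC1Field.const_smul (hX : IsC1Field (I := cotModel n) X) (r : ℝ) :
    IsC1Field (I := cotModel n) (fun z => r • X z) := by
  intro z₀
  refine ((hX z₀).const_smul r).congr fun w _ => ?_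
  exact (mfderiv (cotModel n) 𝓘(ℝ, Phase n) (extChartAt (cotModel n) z₀) _).map_smul r _

/-- By uniqueness, $\gamma(s)=\gamma(t)$ with $s<t$ can be carried back to $\gamma(0)=\gamma(t-s)$.
Rescaling time, this says that the flow at time $t-s\in(0,1]$ fixes the initial point. -/
theorem IsUnitTimeCurve.injOn (hX : IsC1Field (I := cotModel n) X) (hγ : IsUnitTimeCurve X z γ)
    (hper : ∀ t ∈ Ioc (0 : ℝ) 1, expField (fun z => t • X z) z ≠ z) : InjOn γ (Icc 0 1) := by
  have hne : ∀ t ∈ Ioc (0 : ℝ) 1, γ t ≠ γ 0 := by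
    intro t ht h
    have h1 : IsMIntegralCurveOn (I := cotModel n) (γ ∘ fun s => s * t) (fun z => t • X z)
        (Icc 0 1) :=
      (hγ.2.comp_mul t).mono fun s hs =>
        ⟨mul_nonneg hs.1 ht.1.le, mul_le_one₀ hs.2 ht.1.le ht.2⟩
    have h2 := expField_eq (hX.const_smul t) (z := z) ⟨by simp [hγ.1], h1⟩
    refine hper t ht (h2.trans ?_)
    rw [Function.comp_apply, one_mul, h, hγ.1]
  have hlt : ∀ s ∈ Icc (0 : ℝ) 1, ∀ t ∈ Icc (0 : ℝ) 1, s < t → γ s ≠ γ t := by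
    intro s hs t ht hst h
    have h1 : IsMIntegralCurveOn (I := cotModel n) (γ ∘ (· + (t - s))) X (Icc 0 s) :=
      (hγ.2.comp_add (t - s)).mono fun r hr =>
        ⟨by linarith [hr.1], by linarith [hr.2, ht.2]⟩
    have h2 : IsMIntegralCurveOn (I := cotModel n) γ X (Icc 0 s) :=
      hγ.2.mono (Icc_subset_Icc le_rfl hs.2)
    have h3 := IsMIntegralCurveOn.eqOn_Icc hX h2 h1 (t₀ := s) ⟨hs.1, le_rfl⟩
      (by simp [h]) (⟨le_rfl, hs.1⟩ : (0 : ℝ) ∈ Icc 0 s)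
    refine hne (t - s) ⟨by linarith, by linarith [hs.1, ht.2]⟩ ?_
    rw [h3]; simp
  intro s hs t ht h
  by_contra hne'
  rcases lt_or_gt_of_ne hne' with h' | h'
  · exact hlt s hs t ht h' h
  · exact hlt t ht s hs h' h.symm

end UnitTimeCurves

/-! ### Conservation of energy, time reversal and self-intersections of geodesics. -/

section GeodesicFlow

variable {n : ℕ} {M : Type*} [TopologicalSpace M] [ChartedSpace (Rn n) M] [IsManifold (𝓡 n) ∞ M]
  {g : SmoothMetric n M} {γ : ℝ → CotangentBundle n M} {a b t : ℝ} {s : Set ℝ}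

theorem isCometricOn_cometric (g : SmoothMetric n M) (x₀ : M) :
    IsCometricOn (cometric g x₀) (extChartAt (𝓡 n) x₀).target where
  isOpen := isOpen_extChartAt_target x₀
  contDiffOn := contDiffOn_cometric g x₀
  symm _ hy := cometric_symm g hy
  pos _ hy _ := cometric_pos g hy

/-- The geodesic vector field of the unperturbed metric. -/
abbrev freeField (g : SmoothMetric n M) (z : CotangentBundle n M) : TangentSpace (cotModel n) z :=
  geodesicField g (fun _ => 0) z

theorem isC1Field_freeField (g : SmoothMetric n M) : IsC1Field (I := cotModel n) (freeField g) :=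
  isC1Field_geodesicField g contMDiff_const

theorem extChartAt_cotangent_fst {z₀ z : CotangentBundle n M}
    (hz : z ∈ (extChartAt (cotModel n) z₀).source) :
    (extChartAt (cotModel n) z₀ z).1 = extChartAt (𝓡 n) z₀.proj z.proj := by
  rw [extChartAt_cotangent_apply hz]

theorem extChartAt_cotangent_fst_mem {z₀ z : CotangentBundle n M}
    (hz : z ∈ (extChartAt (cotModel n) z₀).source) :
    (extChartAt (cotModel n) z₀ z).1 ∈ (extChartAt (𝓡 n) z₀.proj).target := by
  rw [extChartAt_cotangent_fst hz]
  exact (extChartAt (𝓡 n) z₀.proj).map_source (mem_extChartAt_cotangent_source.1 hz)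

theorem IsMIntegralCurveOn.hasDerivWithinAt_freeVector
    (hγ : IsMIntegralCurveOn (I := cotModel n) γ (freeField g) s) (ht : t ∈ s)
    {z₀ : CotangentBundle n M} (hsrc : γ t ∈ (extChartAt (cotModel n) z₀).source) :
    HasDerivWithinAt (extChartAt (cotModel n) z₀ ∘ γ)
      (freeVector (cometric g z₀.proj) (extChartAt (cotModel n) z₀ (γ t))) s t := by
  have h := hγ.hasDerivWithinAt_chartField ht hsrc
  rw [chartField_geodesicField g contMDiff_const z₀
    ((extChartAt (cotModel n) z₀).map_source hsrc)] at h
  exact h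

theorem symbol_pos (g : SmoothMetric n M) {z : CotangentBundle n M} (hz : covector z ≠ 0) :
    0 < symbol g z := by
  rw [symbol_eq_of_fiberMetric g z (apply_inverse_apply (fiberMetric_pos g z.proj) _)]
  exact apply_inverse_self_pos (fiberMetric_pos g z.proj) hz

theorem symbol_eq_zero (g : SmoothMetric n M) {z : CotangentBundle n M} (hz : covector z = 0) :
    symbol g z = 0 := by
  rw [symbol_eq_of_fiberMetric g z (v := 0) (by rw [hz, map_zero]), hz]
  rfl

theorem IsMIntegralCurveOn.symbol_eq
    (hγ : IsMIntegralCurveOn (I := cotModel n) γ (freeField g) (Icc a b)) (ht : t ∈ Icc a b) :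
    symbol g (γ t) = symbol g (γ a) := by
  refine eq_const_of_hasDerivWithinAt_zero (c := fun t => symbol g (γ t)) (fun t ht => ?_) ht
  set c := extChartAt (cotModel n) (γ t) with hc
  have hsrc : γ t ∈ c.source := mem_extChartAt_source _
  have h1 := hγ.hasDerivWithinAt_freeVector ht hsrc
  have h2 := ((((isCometricOn_cometric g (γ t).proj).contDiffAt_symbolForm
    (extChartAt_cotangent_fst_mem hsrc)).differentiableAt
      (by simp)).hasFDerivAt).comp_hasDerivWithinAt t h1
  rw [IsCometricOn.fderiv_symbolForm_freeVector] at h2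
  refine h2.congr_of_eventuallyEq ?_ (symbol_eq_symbolForm g hsrc)
  filter_upwards [(hγ.continuousOn t ht).preimage_mem_nhdsWithin
    ((isOpen_extChartAt_source _).mem_nhds hsrc)] with r hr
  exact symbol_eq_symbolForm g hr

/-- The symbol is conserved and vanishes exactly on the zero section. -/
theorem IsMIntegralCurveOn.covector_ne_zero
    (hγ : IsMIntegralCurveOn (I := cotModel n) γ (freeField g) (Icc a b))
    (h0 : covector (γ a) ≠ 0) (ht : t ∈ Icc a b) : covector (γ t) ≠ 0 := fun h => by
  have h1 := hγ.symbol_eq ht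
  rw [symbol_eq_zero g h] at h1
  exact (symbol_pos g h0).ne h1

/-- The fibrewise reflection of the cotangent bundle. -/
def reverse (z : CotangentBundle n M) : CotangentBundle n M := ⟨z.proj, -z.snd⟩

theorem covector_reverse (z : CotangentBundle n M) : covector (reverse z) = -covector z := rfl

theorem reverse_mem_source {z₀ z : CotangentBundle n M}
    (hz : z ∈ (extChartAt (cotModel n) z₀).source) :
    reverse z ∈ (extChartAt (cotModel n) z₀).source := by
  rw [mem_extChartAt_cotangent_source] at hz ⊢
  exact hz

theorem extChartAt_reverse {z₀ z : CotangentBundle n M}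
    (hz : z ∈ (extChartAt (cotModel n) z₀).source) :
    extChartAt (cotModel n) z₀ (reverse z) =
      ((extChartAt (cotModel n) z₀ z).1, -(extChartAt (cotModel n) z₀ z).2) := by
  rw [extChartAt_cotangent_apply hz, extChartAt_cotangent_apply (reverse_mem_source hz),
    covector_reverse]
  refine Prod.ext rfl ?_
  exact ContinuousLinearMap.neg_comp _ _

/-- The symbol is even in $\xi$. Consequently the fibre reflection carries the field to its
negative, which gives time reversal. -/
theorem IsCometricOn.freeVector_neg {G : Rn n → (Rn n →L[ℝ] ℝ) →L[ℝ] Rn n} {U : Set (Rn n)}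
    (h : IsCometricOn G U) {w : Phase n} (hw : w.1 ∈ U) :
    freeVector G (w.1, -w.2) = (-(freeVector G w).1, (freeVector G w).2) := by
  refine Prod.ext ?_ (ContinuousLinearMap.ext fun v => ?_)
  · rw [h.freeVector_fst hw, h.freeVector_fst (w := (w.1, -w.2)) hw, map_neg]
  · rw [freeVector, geodesicVector_snd_apply (h.differentiableAt hw) (differentiableAt_const _)
      (h.symm _ hw), geodesicVector_snd_apply (w := (w.1, -w.2)) (h.differentiableAt hw)
      (differentiableAt_const _) (h.symm _ hw)]
    simp

/-- Time reversal of geodesics. -/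
theorem IsMIntegralCurveOn.reverse
    (hγ : IsMIntegralCurveOn (I := cotModel n) γ (freeField g) (Icc a b)) :
    IsMIntegralCurveOn (I := cotModel n) (fun r => reverse (γ (a + b - r))) (freeField g)
      (Icc a b) := by
  have hmaps : MapsTo (fun r => a + b - r) (Icc a b) (Icc a b) := fun r hr =>
    ⟨by linarith [hr.2], by linarith [hr.1]⟩
  intro r hr
  have ht := hmaps hr
  set c := extChartAt (cotModel n) (γ (a + b - r)) with hc
  have hsrc : γ (a + b - r) ∈ c.source := mem_extChartAt_source _
  have hU := extChartAt_cotangent_fst_mem hsrc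
  have h1 := hγ.hasDerivWithinAt_freeVector ht hsrc
  have h2 : HasDerivWithinAt (fun r => a + b - r) (-1) (Icc a b) r :=
    ((hasDerivAt_id r).const_sub (a + b)).hasDerivWithinAt
  have h3 := h1.scomp r h2 hmaps
  have h31 : HasDerivWithinAt (fun r => (c (γ (a + b - r))).1) _ (Icc a b) r := h3.fst
  have h32 : HasDerivWithinAt (fun r => (c (γ (a + b - r))).2) _ (Icc a b) r := h3.snd
  set y : ℝ → Phase n := fun r => ((c (γ (a + b - r))).1, -(c (γ (a + b - r))).2) with hy
  have hyc : ∀ r, γ (a + b - r) ∈ c.source → y r = c (_root_.reverse (γ (a + b - r))) :=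
    fun r hr => (extChartAt_reverse hr).symm
  have hyt : y r ∈ c.target := by
    rw [hyc r hsrc]; exact c.map_source (reverse_mem_source hsrc)
  have h4 : HasDerivWithinAt y (chartField (I := cotModel n) (freeField g) (γ (a + b - r)) (y r))
      (Icc a b) r := by
    rw [chartField_geodesicField g contMDiff_const _ hyt]
    refine (h31.prodMk h32.fun_neg).congr_deriv ?_
    have h5 := (isCometricOn_cometric g (γ (a + b - r)).proj).freeVector_neg hU
    refine Eq.trans ?_ h5.symm
    simp
  have h6 := hasMFDerivWithinAt_extChartAt_symm_comp (I := cotModel n) h4 hyt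
  have h7 : c.symm (y r) = _root_.reverse (γ (a + b - r)) := by
    rw [hyc r hsrc, c.left_inv (reverse_mem_source hsrc)]
  rw [← hc, h7] at h6
  refine h6.congr_of_eventuallyEq ?_ h7.symm
  have hcont : ContinuousWithinAt (fun r => γ (a + b - r)) (Icc a b) r :=
    (hγ.continuousOn _ ht).comp (by fun_prop) hmaps
  filter_upwards [hcont.preimage_mem_nhdsWithin
    ((isOpen_extChartAt_source _).mem_nhds hsrc)] with r' hr'
  rw [Function.comp_apply, hyc r' hr', c.left_inv (reverse_mem_source hr')]

variable [T2Space M]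

/-- An injective geodesic crosses itself transversally. -/
theorem IsMIntegralCurveOn.eq_zero_of_smul_velocity_eq
    (hγ : IsMIntegralCurveOn (I := cotModel n) γ (freeField g) (Icc a b))
    (h0 : covector (γ a) ≠ 0) (hinj : InjOn γ (Icc a b)) {t t' : ℝ} (ht : t ∈ Icc a b)
    (ht' : t' ∈ Icc a b) (htt : t < t') {z₀ : CotangentBundle n M}
    (hz : γ t ∈ (extChartAt (cotModel n) z₀).source) (hx : (γ t).proj = (γ t').proj) {r r' : ℝ}
    (hrr : r • (freeVector (cometric g z₀.proj) (extChartAt (cotModel n) z₀ (γ t))).1 =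
      r' • (freeVector (cometric g z₀.proj) (extChartAt (cotModel n) z₀ (γ t'))).1) :
    r = 0 ∧ r' = 0 := by
  set c := extChartAt (cotModel n) z₀ with hc
  have hG := isCometricOn_cometric g z₀.proj
  set G := cometric g z₀.proj with hGdef
  have hz' : γ t' ∈ c.source := by
    rw [hc, mem_extChartAt_cotangent_source, ← hx, ← mem_extChartAt_cotangent_source]; exact hz
  have hfst : (c (γ t)).1 = (c (γ t')).1 := by
    rw [extChartAt_cotangent_fst hz, extChartAt_cotangent_fst hz', hx]
  have hU := extChartAt_cotangent_fst_mem hz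
  have hU' := extChartAt_cotangent_fst_mem hz'
  set ξ := (c (γ t)).2 with hξ
  set ξ' := (c (γ t')).2 with hξ'
  rw [hG.freeVector_fst hU, hG.freeVector_fst hU', ← hfst, ← map_smul, ← map_smul,
    ← sub_eq_zero, ← map_sub] at hrr
  -- Definiteness of $G$ lifts the relation between velocities to covectors; equal energy then gives
  -- $r^2=r'^2$.
  have heq : r • ξ = r' • ξ' := by
    by_contra hne
    have := hG.pos _ hU _ (sub_ne_zero.2 hne)
    rw [hrr, map_zero] at this
    exact lt_irrefl _ this
  have hp : ξ (G (c (γ t)).1 ξ) = symbol g (γ a) := by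
    rw [← hγ.symbol_eq ht, symbol_eq_symbolForm g hz]; rfl
  have hp' : ξ' (G (c (γ t)).1 ξ') = symbol g (γ a) := by
    rw [← hγ.symbol_eq ht', symbol_eq_symbolForm g hz', hfst]; rfl
  have hpos := symbol_pos g h0
  have hsq : r * r * symbol g (γ a) = r' * r' * symbol g (γ a) := by
    rw [← hp]
    nth_rewrite 2 [hp]
    rw [← hp']
    have h1 : (r • ξ) (G (c (γ t)).1 (r • ξ)) = (r' • ξ') (G (c (γ t)).1 (r' • ξ')) := by rw [heq]
    simp only [map_smul, smul_apply, smul_eq_mul] at h1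
    linarith
  have hsq' : r * r = r' * r' := mul_right_cancel₀ hpos.ne' hsq
  by_cases hr : r = 0
  · refine ⟨hr, ?_⟩
    rw [hr, mul_zero] at hsq'
    exact mul_self_eq_zero.1 hsq'.symm
  exfalso
  have hmk : ∀ w w' : CotangentBundle n M, w ∈ c.source → w' ∈ c.source → c w = c w' → w = w' :=
    fun w w' hw hw' h => c.injOn hw hw' h
  rcases mul_self_eq_mul_self_iff.1 hsq' with h | h
  · rw [← h] at heq
    have h1 : ξ = ξ' := smul_right_injective _ hr heq
    exact htt.ne (hinj ht ht' (hmk _ _ hz hz' (Prod.ext hfst h1)))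
  · have h1 : ξ' = -ξ := by
      refine smul_right_injective _ hr ?_
      change r • ξ' = r • -ξ
      rw [smul_neg, heq, h]
      exact neg_smul r' ξ'
    have h2 : γ t' = _root_.reverse (γ t) :=
      hmk _ _ hz' (reverse_mem_source hz) (by
        rw [hc, extChartAt_reverse hz, ← hc]; exact Prod.ext hfst.symm h1)
    have hsub : Icc t t' ⊆ Icc a b := Icc_subset_Icc ht.1 ht'.2
    have h3 := hγ.mono hsub
    -- With opposite covectors at its ends, the arc coincides with its own time reversal. At the
    -- midpoint the covector then equals its negative and vanishes.
    have hm : (t + t') / 2 ∈ Icc t t' := ⟨by linarith, by linarith⟩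
    have h4 := IsMIntegralCurveOn.eqOn_Icc (isC1Field_freeField g) h3 h3.reverse (t₀ := t')
      ⟨htt.le, le_rfl⟩ (by rw [h2]; simp) hm
    have h5 := congrArg covector h4
    rw [covector_reverse, show t + t' - (t + t') / 2 = (t + t') / 2 by ring] at h5
    refine hγ.covector_ne_zero h0 (hsub hm) (ContinuousLinearMap.ext fun v => ?_)
    have h6 := congrArg (fun η : Rn n →L[ℝ] ℝ => η v) h5
    simp only [neg_apply] at h6
    change _ = (0 : ℝ)
    linarith

/-- By transversality, $(t,t')\mapsto x(t)-x(t')$, read in a chart, has injective differential at a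
self-intersection, so that zero is isolated. -/
theorem IsMIntegralCurveOn.eventually_proj_ne
    (hγ : IsMIntegralCurveOn (I := cotModel n) γ (freeField g) (Icc a b))
    (h0 : covector (γ a) ≠ 0) (hinj : InjOn γ (Icc a b)) {t t' : ℝ} (ht : t ∈ Icc a b)
    (ht' : t' ∈ Icc a b) (htt : t < t') (hx : (γ t).proj = (γ t').proj) :
    ∀ᶠ q in 𝓝[(Icc a b ×ˢ Icc a b) \ {(t, t')}] (t, t'), (γ q.1).proj ≠ (γ q.2).proj := by
  set c := extChartAt (cotModel n) (γ t) with hc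
  have hz : γ t ∈ c.source := mem_extChartAt_source _
  have hz' : γ t' ∈ c.source := by
    rw [hc, mem_extChartAt_cotangent_source, ← hx, ← mem_extChartAt_cotangent_source]; exact hz
  set v := (freeVector (cometric g (γ t).proj) (c (γ t))).1 with hv
  set v' := (freeVector (cometric g (γ t).proj) (c (γ t'))).1 with hv'
  have hd : HasDerivWithinAt (fun r => (c (γ r)).1) v (Icc a b) t :=
    (hγ.hasDerivWithinAt_freeVector ht hz).fst
  have hd' : HasDerivWithinAt (fun r => (c (γ r)).1) v' (Icc a b) t' :=
    (hγ.hasDerivWithinAt_freeVector ht' hz').fst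
  have h1 : HasFDerivWithinAt (fun q : ℝ × ℝ => (c (γ q.1)).1) _ (Icc a b ×ˢ Icc a b) (t, t') :=
    HasFDerivWithinAt.comp (t, t') (f := fun q : ℝ × ℝ => q.1) hd.hasFDerivWithinAt
      (hasFDerivWithinAt_fst (𝕜 := ℝ)) (fun q hq => hq.1)
  have h2 : HasFDerivWithinAt (fun q : ℝ × ℝ => (c (γ q.2)).1) _ (Icc a b ×ˢ Icc a b) (t, t') :=
    HasFDerivWithinAt.comp (t, t') (f := fun q : ℝ × ℝ => q.2) hd'.hasFDerivWithinAt
      (hasFDerivWithinAt_snd (𝕜 := ℝ)) (fun q hq => hq.2)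
  obtain ⟨L, h3, hL⟩ : ∃ L : ℝ × ℝ →L[ℝ] Rn n, HasFDerivWithinAt
      (fun q : ℝ × ℝ => (c (γ q.1)).1 - (c (γ q.2)).1) L (Icc a b ×ˢ Icc a b) (t, t') ∧
      ∀ q, L q = q.1 • v - q.2 • v' := ⟨_, h1.fun_sub h2, fun q => by simp⟩
  have hne := h3.eventually_ne (c := 0) (by
    obtain ⟨K, -, hK⟩ := (L : ℝ × ℝ →ₗ[ℝ] Rn n).exists_antilipschitzWith
      (LinearMap.ker_eq_bot'.2 fun q hq => by
        have h4 : q.1 • v - q.2 • v' = 0 := by rw [← hL]; exact hq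
        obtain ⟨e1, e2⟩ := hγ.eq_zero_of_smul_velocity_eq h0 hinj ht ht' htt hz hx
          (sub_eq_zero.1 h4)
        exact Prod.ext e1 e2)
    exact ⟨K, hK⟩)
  have hs1 : ∀ᶠ q : ℝ × ℝ in 𝓝[(Icc a b ×ˢ Icc a b) \ {(t, t')}] (t, t'), γ q.1 ∈ c.source := by
    have hcont : ContinuousWithinAt (fun q : ℝ × ℝ => γ q.1) ((Icc a b ×ˢ Icc a b) \ {(t, t')})
        (t, t') := ContinuousWithinAt.comp (t := Icc a b) (hγ.continuousOn t ht)
          continuous_fst.continuousWithinAt fun q hq => hq.1.1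
    exact hcont.preimage_mem_nhdsWithin ((isOpen_extChartAt_source _).mem_nhds hz)
  have hs2 : ∀ᶠ q : ℝ × ℝ in 𝓝[(Icc a b ×ˢ Icc a b) \ {(t, t')}] (t, t'), γ q.2 ∈ c.source := by
    have hcont : ContinuousWithinAt (fun q : ℝ × ℝ => γ q.2) ((Icc a b ×ˢ Icc a b) \ {(t, t')})
        (t, t') := ContinuousWithinAt.comp (t := Icc a b) (hγ.continuousOn t' ht')
          continuous_snd.continuousWithinAt fun q hq => hq.1.2
    exact hcont.preimage_mem_nhdsWithin ((isOpen_extChartAt_source _).mem_nhds hz')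
  filter_upwards [hne, hs1, hs2] with q hq hq1 hq2 hq3
  refine hq ?_
  rw [extChartAt_cotangent_fst hq1, extChartAt_cotangent_fst hq2, hq3, sub_self]

omit [T2Space M] in
theorem continuousOn_proj (hγ : ContinuousOn γ s) : ContinuousOn (fun t => (γ t).proj) s :=
  (FiberBundle.continuous_proj (Rn n →L[ℝ] ℝ)
    (fun x : M => TangentSpace (𝓡 n) x →L[ℝ] Bundle.Trivial M ℝ x)).comp_continuousOn hγ

/-- An injective geodesic has short initial points that it does not meet again later. -/
theorem IsMIntegralCurveOn.exists_simple_time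
    (hγ : IsMIntegralCurveOn (I := cotModel n) γ (freeField g) (Icc a b))
    (h0 : covector (γ a) ≠ 0) (hinj : InjOn γ (Icc a b)) {d e : ℝ} (had : a < d) (hde : d < e)
    (heb : e ≤ b) : ∃ t ∈ Ioo a d, ∀ t' ∈ Icc e b, (γ t).proj ≠ (γ t').proj := by
  by_contra! hall
  -- The gap $d<e$ keeps these pairs away from the diagonal. The set is compact and discrete, hence
  -- finite, while the interval $(a,d)$ is infinite.
  set P : Set (ℝ × ℝ) := (Icc a d ×ˢ Icc e b) ∩
    (fun q : ℝ × ℝ => ((γ q.1).proj, (γ q.2).proj)) ⁻¹' diagonal M with hP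
  have hx := continuousOn_proj hγ.continuousOn
  have hsub1 : Icc a d ⊆ Icc a b := Icc_subset_Icc le_rfl (hde.le.trans heb)
  have hsub2 : Icc e b ⊆ Icc a b := Icc_subset_Icc (had.le.trans hde.le) le_rfl
  have hcont : ContinuousOn (fun q : ℝ × ℝ => ((γ q.1).proj, (γ q.2).proj))
      (Icc a d ×ˢ Icc e b) :=
    (hx.comp continuousOn_fst fun q hq => hsub1 hq.1).prodMk
      (hx.comp continuousOn_snd fun q hq => hsub2 hq.2)
  have hcl : IsClosed P := hcont.preimage_isClosed_of_isClosed (isClosed_Icc.prod isClosed_Icc)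
    isClosed_diagonal
  have hcomp : IsCompact P := (isCompact_Icc.prod isCompact_Icc).of_isClosed_subset hcl
    inter_subset_left
  have hdisc : IsDiscrete P := by
    rw [isDiscrete_iff_nhdsNE]
    rintro ⟨t, t'⟩ ⟨⟨ht, ht'⟩, hq⟩
    have h1 := hγ.eventually_proj_ne h0 hinj (hsub1 ht) (hsub2 ht')
      (ht.2.trans_lt (hde.trans_le ht'.1)) hq
    rw [← nhdsWithin_inter', ← Filter.empty_mem_iff_bot]
    have h2 : 𝓝[{(t, t')}ᶜ ∩ P] (t, t') ≤ 𝓝[(Icc a b ×ˢ Icc a b) \ {(t, t')}] (t, t') :=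
      nhdsWithin_mono _ fun q hq => ⟨⟨hsub1 hq.2.1.1, hsub2 hq.2.1.2⟩, hq.1⟩
    filter_upwards [h2 h1, self_mem_nhdsWithin] with q hq1 hq2
    exact (hq1 hq2.2.2).elim
  have hfin := (hcomp.finite hdisc).image Prod.fst
  refine (Ioo_infinite had).mono (fun t ht => ?_) hfin
  obtain ⟨t', ht', htt'⟩ := hall t ht
  exact ⟨(t, t'), ⟨⟨Ioo_subset_Icc_self ht, ht'⟩, htt'⟩, rfl⟩

end GeodesicFlow

/-! ### Joining the perturbed flow in a chart to the free flow. -/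

section Gluing

variable {n m : ℕ} {M : Type*} [TopologicalSpace M] [T2Space M] [ChartedSpace (Rn n) M]
  [IsManifold (𝓡 n) ∞ M] {g : SmoothMetric n M} {γ : ℝ → CotangentBundle n M} {a b e : ℝ}

theorem geodesicVector_congr {G : Rn n → (Rn n →L[ℝ] ℝ) →L[ℝ] Rn n} {f f' : Rn n → ℝ} {w : Phase n}
    (h : f =ᶠ[𝓝 w.1] f') : geodesicVector G f w = geodesicVector G f' w := by
  have h1 : conformalForm G f =ᶠ[𝓝 w] conformalForm G f' := by
    filter_upwards [continuous_fst.continuousAt.eventually h] with w' hw'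
    rw [conformalForm, conformalForm, hw']
  rw [geodesicVector, geodesicVector, h1.fderiv_eq]

omit [T2Space M] in
/-- A geodesic does not meet itself for a short time. -/
theorem IsMIntegralCurveOn.eventually_injOn_proj (hab : a < b)
    (hγ : IsMIntegralCurveOn (I := cotModel n) γ (freeField g) (Icc a b))
    (h0 : covector (γ a) ≠ 0) : ∀ᶠ e in 𝓝[>] a, InjOn (fun t => (γ t).proj) (Icc a e) := by
  set c := extChartAt (cotModel n) (γ a) with hc
  set G := cometric g (γ a).proj with hGdef
  have hG := isCometricOn_cometric g (γ a).proj
  have hz : γ a ∈ c.source := mem_extChartAt_source _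
  have haI : a ∈ Icc a b := ⟨le_rfl, hab.le⟩
  -- The initial covector pairs with the initial velocity to the positive energy, so this linear
  -- function increases strictly along the projected curve for a short time.
  set l : Rn n →L[ℝ] ℝ := (c (γ a)).2 with hl
  have hU := extChartAt_cotangent_fst_mem hz
  have hpos : 0 < l (freeVector G (c (γ a))).1 := by
    have h1 := symbol_pos g h0
    rw [symbol_eq_symbolForm g hz] at h1
    rw [hG.freeVector_fst hU]
    exact h1
  have hcontV : ContinuousWithinAt (fun t => l (freeVector G (c (γ t))).1) (Icc a b) a := by
    have h1 : ContinuousAt (freeVector G) (c (γ a)) :=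
      (hG.hasFDerivAt_freeVector hU).continuousAt
    have h2 : ContinuousWithinAt (fun t => c (γ t)) (Icc a b) a :=
      (hγ.hasDerivWithinAt_freeVector haI hz).continuousWithinAt
    have h3 : ContinuousAt (fun w : Phase n => l (freeVector G w).1) (c (γ a)) :=
      l.continuous.continuousAt.comp (continuous_fst.continuousAt.comp h1)
    exact h3.comp_continuousWithinAt (f := fun t => c (γ t)) h2
  have hev : ∀ᶠ t in 𝓝[≥] a, γ t ∈ c.source ∧ 0 < l (freeVector G (c (γ t))).1 ∧ t < b := by
    rw [← nhdsWithin_Icc_eq_nhdsGE hab]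
    filter_upwards [(hγ.continuousOn a haI).preimage_mem_nhdsWithin
      ((isOpen_extChartAt_source _).mem_nhds hz), hcontV.eventually (lt_mem_nhds hpos),
      nhdsWithin_le_nhds (Iio_mem_nhds hab)] with t h1 h2 h3 using ⟨h1, h2, h3⟩
  obtain ⟨d, had, hd⟩ := (mem_nhdsGE_iff_exists_Ico_subset).1 hev
  filter_upwards [Ioo_mem_nhdsGT had] with e he
  have hsub : ∀ t ∈ Icc a e, γ t ∈ c.source ∧ 0 < l (freeVector G (c (γ t))).1 ∧ t < b :=
    fun t ht => hd ⟨ht.1, ht.2.trans_lt he.2⟩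
  have hder : ∀ t ∈ Icc a e, HasDerivWithinAt (fun t => l (c (γ t)).1)
      (l (freeVector G (c (γ t))).1) (Icc a b) t := fun t ht => by
    have h1 : HasDerivWithinAt (fun t => (c (γ t)).1) _ (Icc a b) t :=
      (hγ.hasDerivWithinAt_freeVector ⟨ht.1, (hsub t ht).2.2.le⟩ (hsub t ht).1).fst
    exact l.hasFDerivAt.comp_hasDerivWithinAt t h1
  have hmono : StrictMonoOn (fun t => l (c (γ t)).1) (Icc a e) := by
    refine strictMonoOn_of_deriv_pos (convex_Icc a e) (fun t ht => ?_) fun t ht => ?_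
    · exact ((hder t ht).continuousWithinAt).mono (Icc_subset_Icc le_rfl
        (hsub e ⟨he.1.le, le_rfl⟩).2.2.le)
    · rw [interior_Icc] at ht
      have ht' := Ioo_subset_Icc_self ht
      rw [((hder t ht').hasDerivAt (Icc_mem_nhds ht.1 (hsub t ht').2.2)).deriv]
      exact (hsub t ht').2.1
  intro t ht t' ht' htt
  refine hmono.injOn ht ht' ?_
  rw [extChartAt_cotangent_fst (hsub t ht).1, extChartAt_cotangent_fst (hsub t' ht').1]
  exact congrArg (fun p => l (extChartAt (𝓡 n) (γ a).proj p)) htt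

/-- Gluing a submersive family of perturbed geodesics in a chart with the unperturbed flow outside
of the support of the perturbation. -/
theorem mdifferentiableAt_expField_of_chart {f : Rn m → M → ℝ} {K : Set M} (hK : IsClosed K)
    (hf : ∀ s, ContMDiff (𝓡 n) 𝓘(ℝ) ∞ (f s)) (hfK : ∀ s, ∀ x ∉ K, f s x = 0) (he0 : 0 ≤ e)
    (he1 : e < 1) (hγ : IsMIntegralCurveOn (I := cotModel n) γ (freeField g) (Icc e 1))
    (hγK : ∀ t ∈ Icc e 1, (γ t).proj ∉ K) {z₀ : CotangentBundle n M}
    {start : ℝ × Rn m → CotangentBundle n M} {w : ℝ × Rn m → ℝ → Phase n}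
    (hw : ∀ᶠ q in 𝓝 ((1 : ℝ), (0 : Rn m)), (extChartAt (cotModel n) z₀).symm (w q 0) = start q ∧
      ∀ t ∈ Icc 0 e, (w q t).1 ∈ (extChartAt (𝓡 n) z₀.proj).target ∧ HasDerivWithinAt (w q)
        (geodesicVector (cometric g z₀.proj) (f q.2 ∘ (extChartAt (𝓡 n) z₀.proj).symm) (w q t))
        (Icc 0 e) t)
    (hwe : w (1, 0) e = extChartAt (cotModel n) z₀ (γ e))
    (hγe : γ e ∈ (extChartAt (cotModel n) z₀).source) {D : ℝ × Rn m →L[ℝ] Phase n}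
    (hD : HasFDerivAt (fun q => w q e) D (1, 0)) (hDs : Function.Surjective D) :
    (∀ᶠ q in 𝓝 ((1 : ℝ), (0 : Rn m)),
      ∃ σ, IsUnitTimeCurve (geodesicField g (f q.2)) (start q) σ) ∧
    MDifferentiableAt 𝓘(ℝ, ℝ × Rn m) (cotModel n)
      (fun q => expField (geodesicField g (f q.2)) (start q)) (1, 0) ∧
    Function.Surjective (mfderiv 𝓘(ℝ, ℝ × Rn m) (cotModel n)
      (fun q => expField (geodesicField g (f q.2)) (start q)) (1, 0)) := by
  set c := extChartAt (cotModel n) z₀ with hc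
  have hO : IsOpen {z : CotangentBundle n M | z.proj ∉ K} :=
    hK.isOpen_compl.preimage (FiberBundle.continuous_proj (Rn n →L[ℝ] ℝ)
      (fun x : M => TangentSpace (𝓡 n) x →L[ℝ] Bundle.Trivial M ℝ x))
  -- After time `e` the geodesic avoids `K`. Nearby free trajectories do too, and off `K` all the
  -- perturbed fields are the free one, so one map `Φ` serves every parameter.
  obtain ⟨Φ, hΦ, -, hΦd, hΦs⟩ :=
    hγ.submersiveFlowOn (isC1Field_freeField g) hO he1.le hγK
  have htar : c (γ e) ∈ c.target := c.map_source hγe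
  have hcsymm : c.symm (w (1, 0) e) = γ e := by rw [hwe, c.left_inv hγe]
  have hsd : MDifferentiableAt 𝓘(ℝ, Phase n) (cotModel n) c.symm (w (1, 0) e) := by
    have := mdifferentiableWithinAt_extChartAt_symm (I := cotModel n) (x := z₀) htar
    rw [(cotModel n).range_eq_univ, mdifferentiableWithinAt_univ] at this
    rw [hwe]
    exact this
  have hwd : MDifferentiableAt 𝓘(ℝ, ℝ × Rn m) 𝓘(ℝ, Phase n) (fun q => w q e) (1, 0) :=
    hD.differentiableAt.mdifferentiableAt
  have hcont : Tendsto (fun q => c.symm (w q e)) (𝓝 ((1 : ℝ), (0 : Rn m))) (𝓝 (γ e)) := by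
    have := (hsd.continuousAt.comp (f := fun q => w q e) hD.continuousAt).tendsto
    rw [Function.comp_apply, hcsymm] at this
    exact this
  have hcurve : ∀ᶠ q in 𝓝 ((1 : ℝ), (0 : Rn m)), ∃ σ,
      IsUnitTimeCurve (geodesicField g (f q.2)) (start q) σ ∧ σ 1 = Φ (c.symm (w q e)) := by
    filter_upwards [hw, hcont.eventually hΦ] with q hq hq'
    obtain ⟨hstart, hq⟩ := hq
    obtain ⟨σ, hσe, hσ1, hσ, hσO⟩ := hq'
    have h1 : IsMIntegralCurveOn (I := cotModel n) (c.symm ∘ w q) (geodesicField g (f q.2))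
        (Icc 0 e) := by
      intro t ht
      have hwt : w q t ∈ c.target := by
        rw [hc, extChartAt_cotangent_target]; exact ⟨(hq t ht).1, trivial⟩
      refine hasMFDerivWithinAt_extChartAt_symm_comp (I := cotModel n) ?_ hwt
      rw [chartField_geodesicField g (hf q.2) z₀ hwt]
      exact (hq t ht).2
    have h2 : IsMIntegralCurveOn (I := cotModel n) σ (geodesicField g (f q.2)) (Icc e 1) := by
      intro t ht
      have h3 : geodesicField g (f q.2) (σ t) = freeField g (σ t) := by
        refine geodesicField_congr g ?_
        filter_upwards [hK.isOpen_compl.mem_nhds (hσO t ht)] with x hx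
        exact hfK q.2 x hx
      rw [h3]
      exact hσ t ht
    refine ⟨_, ⟨?_, h1.ite_Icc he0 he1.le h2 hσe.symm⟩, ?_⟩
    · simp [he0, hstart]
    · simp [not_le.2 he1, hσ1]
  have heq : (fun q => expField (geodesicField g (f q.2)) (start q)) =ᶠ[𝓝 ((1 : ℝ), (0 : Rn m))]
      Φ ∘ (c.symm ∘ fun q => w q e) := by
    filter_upwards [hcurve] with q hq
    obtain ⟨σ, hσ, hσ1⟩ := hq
    rw [expField_eq (isC1Field_geodesicField g (hf q.2)) hσ, hσ1]
    rfl
  have hd₂ : MDifferentiableAt 𝓘(ℝ, ℝ × Rn m) (cotModel n) (c.symm ∘ fun q => w q e) (1, 0) :=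
    MDifferentiableAt.comp _ hsd hwd
  rw [← hcsymm] at hΦd hΦs
  have hcomp : MDifferentiableAt 𝓘(ℝ, ℝ × Rn m) (cotModel n)
      (Φ ∘ (c.symm ∘ fun q => w q e)) (1, 0) := MDifferentiableAt.comp _ hΦd hd₂
  refine ⟨hcurve.mono fun q ⟨σ, hσ, _⟩ => ⟨σ, hσ⟩, hcomp.congr_of_eventuallyEq heq, ?_⟩
  have s2 : Function.Surjective (mfderiv 𝓘(ℝ, ℝ × Rn m) 𝓘(ℝ, Phase n) (fun q => w q e) (1, 0)) := by
    have : mfderiv 𝓘(ℝ, ℝ × Rn m) 𝓘(ℝ, Phase n) (fun q => w q e) (1, 0) = D := by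
      rw [mfderiv_eq_fderiv]; exact hD.fderiv
    rw [this]
    exact hDs
  have s3 : Function.Surjective (mfderiv 𝓘(ℝ, Phase n) (cotModel n) c.symm (w (1, 0) e)) := by
    have := isInvertible_mfderivWithin_extChartAt_symm (I := cotModel n) (x := z₀) htar
    rw [(cotModel n).range_eq_univ, mfderivWithin_univ] at this
    rw [hwe]
    exact this.surjective
  have hm : mfderiv 𝓘(ℝ, ℝ × Rn m) (cotModel n)
      (fun q => expField (geodesicField g (f q.2)) (start q)) (1, 0) =
      mfderiv 𝓘(ℝ, ℝ × Rn m) (cotModel n) (Φ ∘ (c.symm ∘ fun q => w q e)) (1, 0) :=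
    heq.mfderiv_eq
  rw [mfderiv_comp (1, 0) (f := c.symm ∘ fun q => w q e) hΦd hd₂,
    mfderiv_comp (1, 0) (f := fun q => w q e) hsd hwd] at hm
  have s4 := hΦs.comp (s3.comp s2)
  intro v
  obtain ⟨u, hu⟩ := s4 v
  exact ⟨u, (congrArg (fun L => L u) hm).trans hu⟩

end Gluing

/-! ### Transplanting perturbations from the chart to the manifold. -/

section ExtensionByZero

variable {n m : ℕ} {M : Type*} [TopologicalSpace M] [T2Space M] [ChartedSpace (Rn n) M]
  [IsManifold (𝓡 n) ∞ M] {x₀ : M} {K : Set M}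

/-- A function on the chart domain, transplanted to the manifold by means of a bump function. -/
def transplant (χ : SmoothBumpFunction (𝓡 n) x₀) (f : Rn n → ℝ) (x : M) : ℝ :=
  χ x • f (extChartAt (𝓡 n) x₀ x)

theorem contMDiff_transplant (χ : SmoothBumpFunction (𝓡 n) x₀) {f : Rn n → ℝ}
    (hf : ContDiff ℝ ∞ f) : ContMDiff (𝓡 n) 𝓘(ℝ) ∞ (transplant χ f) :=
  χ.contMDiff_smul (g := fun x => f (extChartAt (𝓡 n) x₀ x))
    (hf.contMDiff.comp_contMDiffOn contMDiffOn_extChartAt)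

omit [T2Space M] [IsManifold (𝓡 n) ∞ M] in
theorem transplant_eq_zero (χ : SmoothBumpFunction (𝓡 n) x₀) {f : Rn n → ℝ}
    (hf : tsupport f ⊆ (extChartAt (𝓡 n) x₀).symm ⁻¹' K) {x : M} (hx : x ∉ K) :
    transplant χ f x = 0 := by
  by_contra hne
  have h1 : χ x ≠ 0 := fun h => hne (by rw [transplant, h, zero_smul])
  have h2 : f (extChartAt (𝓡 n) x₀ x) ≠ 0 := fun h => hne (by rw [transplant, h, smul_zero])
  have h3 : x ∈ (extChartAt (𝓡 n) x₀).source := by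
    rw [extChartAt_source]; exact χ.support_subset_source h1
  have h4 := hf (subset_tsupport f h2)
  rw [mem_preimage, (extChartAt (𝓡 n) x₀).left_inv h3] at h4
  exact hx h4

omit [T2Space M] [IsManifold (𝓡 n) ∞ M] in
-- The bump is one wherever `f` is nonzero in the chart, so multiplying by it changes nothing there.
theorem transplant_extChartAt_symm (χ : SmoothBumpFunction (𝓡 n) x₀) {f : Rn n → ℝ}
    (hf : tsupport f ⊆ (extChartAt (𝓡 n) x₀).symm ⁻¹' K) (hK : ∀ x ∈ K, χ x = 1) {y : Rn n}
    (hy : y ∈ (extChartAt (𝓡 n) x₀).target) :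
    transplant χ f ((extChartAt (𝓡 n) x₀).symm y) = f y := by
  rw [transplant, (extChartAt (𝓡 n) x₀).right_inv hy]
  by_cases h : f y = 0
  · rw [h, smul_zero]
  · rw [hK _ (hf (subset_tsupport f h)), one_smul]

omit [T2Space M] [IsManifold (𝓡 n) ∞ M] in
theorem contMDiff_sum_mul {f : Fin m → M → ℝ} (hf : ∀ i, ContMDiff (𝓡 n) 𝓘(ℝ) ∞ (f i)) :
    ContMDiff (𝓘(ℝ, Rn m).prod (𝓡 n)) 𝓘(ℝ) ∞ (fun q : Rn m × M => ∑ i, q.1 i * f i q.2) := by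
  refine contMDiff_finsetSum fun i _ => ?_
  have h1 : ContMDiff (𝓘(ℝ, Rn m).prod (𝓡 n)) 𝓘(ℝ) ∞ (fun q : Rn m × M => q.1 i) :=
    (EuclideanSpace.proj i : Rn m →L[ℝ] ℝ).contDiff.contMDiff.comp contMDiff_fst
  exact h1.mul ((hf i).comp contMDiff_snd)

omit [T2Space M] [IsManifold (𝓡 n) ∞ M] in
-- On a compact manifold the `f i` are bounded, and a weighted $\ell^1$ ball of parameters keeps the
-- sum above $-1$.
theorem exists_isOpen_forall_pos [CompactSpace M] {f : Fin m → M → ℝ}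
    (hf : ∀ i, Continuous (f i)) : ∃ S : Set (Rn m), IsOpen S ∧ (0 : Rn m) ∈ S ∧
      ∀ s ∈ S, ∀ x, 0 < 1 + ∑ i, s i * f i x := by
  have hb : ∀ i, ∃ C, ∀ x, |f i x| ≤ C := fun i => by
    obtain ⟨C, hC⟩ := isCompact_univ.exists_bound_of_continuousOn (hf i).continuousOn
    exact ⟨C, fun x => hC x trivial⟩
  choose C hC using hb
  refine ⟨{s | ∑ i, |s i| * C i < 1}, isOpen_lt (by fun_prop) continuous_const, by simp,
    fun s hs x => ?_⟩
  have h1 : |∑ i, s i * f i x| ≤ ∑ i, |s i| * C i :=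
    (Finset.abs_sum_le_sum_abs _ _).trans (Finset.sum_le_sum fun i _ => by
      rw [abs_mul]; exact mul_le_mul_of_nonneg_left (hC i x) (abs_nonneg _))
  have h2 := (abs_lt.1 (h1.trans_lt hs)).1
  linarith

end ExtensionByZero

/-! ### Proof of the theorem. -/

set_option maxHeartbeats 2000000 in
theorem proposition3p7 {n : ℕ} {M : Type*} [TopologicalSpace M] [T2Space M] [CompactSpace M]
    [ChartedSpace (Rn n) M] [IsManifold (𝓡 n) ∞ M] (g : SmoothMetric n M)
    (x₀ : M) (ξ₀ : CotangentSpace n x₀) (hξ₀ : ξ₀ ≠ 0)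
    (hper : ∀ t ∈ Ioc (0 : ℝ) 1,
      expField (fun z => (t / 2) • hamiltonField (symbol g) z)
        (⟨x₀, ξ₀⟩ : CotangentBundle n M) ≠ ⟨x₀, ξ₀⟩) :
    ∃ (U : Set M) (S : Set (Rn (2 * n - 1))) (f : Rn (2 * n - 1) → M → ℝ),
      IsOpen U ∧ IsOpen S ∧ (0 : Rn (2 * n - 1)) ∈ S ∧
      ContMDiffOn (𝓘(ℝ, Rn (2 * n - 1)).prod (𝓡 n)) 𝓘(ℝ, ℝ) ∞
        (fun q : Rn (2 * n - 1) × M => f q.1 q.2) (S ×ˢ univ) ∧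
      (∃ K : Set M, IsCompact K ∧ K ⊆ U ∧ ∀ s ∈ S, ∀ x ∉ K, f s x = 0) ∧
      (∀ x, f 0 x = 0) ∧
      (∀ s ∈ S, ∀ x, 0 < 1 + f s x) ∧
      ∃ F : ℝ × Rn (2 * n - 1) → CotangentBundle n M,
        (∀ q, F q = expField
          (fun z => (1 / 2 : ℝ) • hamiltonField (conformalSymbol g (f q.2)) z) ⟨x₀, q.1 • ξ₀⟩) ∧
        (∀ᶠ q in 𝓝 ((1 : ℝ), (0 : Rn (2 * n - 1))), ∃ γ, IsUnitTimeCurve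
          (fun z => (1 / 2 : ℝ) • hamiltonField (conformalSymbol g (f q.2)) z)
          ⟨x₀, q.1 • ξ₀⟩ γ) ∧
        F (1, 0) = expField (fun z => (1 / 2 : ℝ) • hamiltonField (symbol g) z) ⟨x₀, ξ₀⟩ ∧
        MDifferentiableAt 𝓘(ℝ, ℝ × Rn (2 * n - 1)) (cotModel n) F (1, 0) ∧
        Function.Surjective
          (mfderiv 𝓘(ℝ, ℝ × Rn (2 * n - 1)) (cotModel n) F (1, 0)) := by
  set z₀ : CotangentBundle n M := ⟨x₀, ξ₀⟩ with hz₀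
  have hfree : (fun z => (1 / 2 : ℝ) • hamiltonField (symbol g) z) = freeField g := by
    funext z
    rw [freeField, geodesicField, conformalSymbol_zero]
  have hscale : ∀ t : ℝ, (fun z => (t / 2) • hamiltonField (symbol g) z) =
      fun z => t • freeField g z := by
    intro t
    funext z
    rw [← hfree, smul_smul, mul_one_div]
  simp only [hscale] at hper
  obtain ⟨γ, hγ⟩ : ∃ γ, IsUnitTimeCurve (freeField g) z₀ γ := by
    have h1 := exists_isUnitTimeCurve_of_expField_ne (hper 1 ⟨one_pos, le_rfl⟩)
    simpa only [one_smul] using h1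
  have hinj := hγ.injOn (isC1Field_freeField g) hper
  obtain ⟨hγ0, hγ⟩ := hγ
  have h0 : covector (γ 0) ≠ 0 := by rw [hγ0]; exact hξ₀
  set φ := extChartAt (𝓡 n) x₀ with hφ
  set c := extChartAt (cotModel n) z₀ with hc
  have hzc : z₀ ∈ c.source := mem_extChartAt_source _
  obtain ⟨χ⟩ : Nonempty (SmoothBumpFunction (𝓡 n) x₀) := inferInstance
  have hχ : {x | χ x = 1} ∈ 𝓝 x₀ := χ.eventuallyEq_one
  have hproj := continuousOn_proj hγ.continuousOn
  have h0I : (0 : ℝ) ∈ Icc (0 : ℝ) 1 := ⟨le_rfl, zero_le_one⟩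
  -- Up to time `e` the projected geodesic is injective and stays in the chart, where moreover the
  -- bump is one.
  obtain ⟨e, he0, he1, hinjx, hgood⟩ : ∃ e, 0 < e ∧ e < 1 ∧
      InjOn (fun t => (γ t).proj) (Icc 0 e) ∧
      ∀ t ∈ Icc 0 e, (γ t).proj ∈ interior {x | χ x = 1} ∩ φ.source := by
    have hev : ∀ᶠ t in 𝓝[≥] (0 : ℝ), (γ t).proj ∈ interior {x | χ x = 1} ∩ φ.source := by
      rw [← nhdsWithin_Icc_eq_nhdsGE (zero_lt_one (α := ℝ))]
      refine (hproj 0 h0I).preimage_mem_nhdsWithin ?_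
      rw [hγ0]
      exact inter_mem (interior_mem_nhds.2 hχ) (extChartAt_source_mem_nhds x₀)
    obtain ⟨d, hd0, hd⟩ := (mem_nhdsGE_iff_exists_Ico_subset).1 hev
    obtain ⟨e, ⟨he, he'⟩, he''⟩ := ((hγ.eventually_injOn_proj one_pos h0).and
      ((Ioo_mem_nhdsGT hd0 : ∀ᶠ e in 𝓝[>] (0 : ℝ), e ∈ Ioo 0 d)) |>.and
      (Ioo_mem_nhdsGT one_pos : ∀ᶠ e in 𝓝[>] (0 : ℝ), e ∈ Ioo 0 1)).exists
    exact ⟨e, he'.1, he''.2, he, fun t ht => hd ⟨ht.1, ht.2.trans_lt he'.2⟩⟩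
  -- Taking $t_1<e/2$ leaves the required gap before `e`. Returns to $x(t_1)$ during $[e,1]$ are
  -- excluded here, those during $[0,e]$ by `hinjx`.
  obtain ⟨t₁, ht₁, hsep⟩ := hγ.exists_simple_time h0 hinj (half_pos he0) (half_lt_self he0) he1.le
  have ht₁e : t₁ ∈ Ioo 0 e := ⟨ht₁.1, ht₁.2.trans (half_lt_self he0)⟩
  have hsub : Icc 0 e ⊆ Icc (0 : ℝ) 1 := Icc_subset_Icc le_rfl he1.le
  have hsub' : Icc e 1 ⊆ Icc (0 : ℝ) 1 := Icc_subset_Icc he0.le le_rfl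
  -- Removing this later arc from `U` ensures that the perturbations do not touch the geodesic after
  -- time `e`.
  set A : Set M := (fun t => (γ t).proj) '' Icc e 1 with hA
  have hAc : IsClosed A := (isCompact_Icc.image_of_continuousOn (hproj.mono hsub')).isClosed
  set U : Set M := (interior {x | χ x = 1} ∩ φ.source) ∩ Aᶜ with hU
  have hUo : IsOpen U :=
    (isOpen_interior.inter (isOpen_extChartAt_source x₀)).inter hAc.isOpen_compl
  obtain ⟨K, hK, htK, hKU⟩ := exists_compact_subset hUo (x := (γ t₁).proj)
    ⟨hgood t₁ (Ioo_subset_Icc_self ht₁e), fun ⟨t', ht', h⟩ => hsep t' ht' h.symm⟩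
  have hsrc : ∀ t ∈ Icc 0 e, γ t ∈ c.source := fun t ht =>
    mem_extChartAt_cotangent_source.2 (hgood t ht).2
  have hfst : ∀ t ∈ Icc 0 e, (c (γ t)).1 = φ (γ t).proj := fun t ht =>
    extChartAt_cotangent_fst (hsrc t ht)
  have hG := isCometricOn_cometric g x₀
  have hgeo : IsChartGeodesic (cometric g x₀) φ.target (c ∘ γ) 0 e :=
    { mem := fun t ht => extChartAt_cotangent_fst_mem (hsrc t ht)
      hasDerivWithinAt := fun t ht =>
        (hγ.mono hsub).hasDerivWithinAt_freeVector ht (hsrc t ht)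
      ne_zero := fun h => by
        have h1 := symbol_pos g h0
        rw [symbol_eq_symbolForm g (hsrc 0 ⟨le_rfl, he0.le⟩), symbolForm] at h1
        rw [Function.comp_apply] at h
        rw [h] at h1
        exact lt_irrefl _ h1 }
  set W : Set (Rn n) := φ.target ∩ φ.symm ⁻¹' interior K with hW
  have hWo : IsOpen W := (continuousOn_extChartAt_symm x₀).isOpen_inter_preimage
    (isOpen_extChartAt_target x₀) isOpen_interior
  have hsimple : ∀ᶠ s in 𝓝 t₁, ((c ∘ γ) s).1 ∈ W ∧
      ∀ t ∈ Icc 0 e, ((c ∘ γ) t).1 = ((c ∘ γ) s).1 → t = s := by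
    have h1 : ContinuousAt (fun t => (γ t).proj) t₁ :=
      (hproj.mono hsub).continuousAt (Icc_mem_nhds ht₁e.1 ht₁e.2)
    filter_upwards [h1.preimage_mem_nhds (isOpen_interior.mem_nhds htK),
      Ioo_mem_nhds ht₁e.1 ht₁e.2] with s hs hse
    have hsI := Ioo_subset_Icc_self hse
    have hss := (hgood s hsI).2
    refine ⟨?_, fun t ht hts => ?_⟩
    · rw [Function.comp_apply, hfst s hsI]
      refine ⟨φ.map_source hss, ?_⟩
      rw [mem_preimage, φ.left_inv hss]
      exact hs
    · rw [Function.comp_apply, Function.comp_apply, hfst s hsI, hfst t ht] at hts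
      exact hinjx ht hsI (φ.injOn (hgood t ht).2 hss hts)
  obtain ⟨f, hf, Φ, hΦ, hΦe, D, hD, hDs⟩ :=
    hgeo.exists_submersive_perturbation hG hWo ht₁e hsimple rfl
  have hfK : ∀ i, tsupport (f i) ⊆ φ.symm ⁻¹' K := fun i y hy =>
    (interior_subset : interior K ⊆ K) ((hf i).2.2 hy).2
  have hKχ : ∀ x ∈ K, χ x = 1 := fun x hx =>
    (interior_subset : interior {x | χ x = 1} ⊆ {x | χ x = 1}) (hKU hx).1.1
  have hsmooth : ∀ i, ContMDiff (𝓡 n) 𝓘(ℝ) ∞ (transplant χ (f i)) := fun i =>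
    contMDiff_transplant χ (hf i).1
  set F : Rn (2 * n - 1) → M → ℝ := fun s x => ∑ i, s i * transplant χ (f i) x with hF
  have hFs := contMDiff_sum_mul hsmooth
  have hFsmooth : ∀ s, ContMDiff (𝓡 n) 𝓘(ℝ) ∞ (F s) := fun s =>
    hFs.comp (contMDiff_const.prodMk contMDiff_id)
  have hFK : ∀ s, ∀ x ∉ K, F s x = 0 := fun s x hx =>
    Finset.sum_eq_zero fun i _ => by rw [transplant_eq_zero χ (hfK i) hx, mul_zero]
  have hF0 : ∀ x, F 0 x = 0 := fun x => by simp [hF]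
  obtain ⟨S, hSo, hS0, hS⟩ := exists_isOpen_forall_pos fun i => (hsmooth i).continuous
  -- The chart is linear on fibres, so scaling the covector can be done in coordinates.
  have hstart : ∀ τ : ℝ, c.symm ((c z₀).1, τ • (c z₀).2) = ⟨x₀, τ • ξ₀⟩ := by
    intro τ
    have h1 : (⟨x₀, τ • ξ₀⟩ : CotangentBundle n M) ∈ c.source := by
      rw [hc, mem_extChartAt_cotangent_source]; exact mem_extChartAt_source _
    rw [← c.left_inv h1]
    congr 1
    rw [hc, extChartAt_cotangent_apply hzc, extChartAt_cotangent_apply h1]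
    exact Prod.ext rfl (ContinuousLinearMap.smul_comp _ _ _).symm
  obtain ⟨hcurves, hmd, hms⟩ := mdifferentiableAt_expField_of_chart (g := g) (γ := γ) (e := e)
    (start := fun q => (⟨x₀, q.1 • ξ₀⟩ : CotangentBundle n M)) (z₀ := z₀) (w := Φ) hK.isClosed
    hFsmooth hFK he0.le he1 (hγ.mono hsub') (fun t ht h => (hKU h).2 ⟨t, ht, rfl⟩) (by
      filter_upwards [hΦ] with q hq
      refine ⟨?_, fun t ht => ⟨(hq.2 t ht).1, ?_⟩⟩
      · rw [hq.1, Function.comp_apply, hγ0]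
        exact hstart q.1
      · have h1 := (hq.2 t ht).2
        rw [geodesicVector_congr (f' := F q.2 ∘ φ.symm) (by
          filter_upwards [(isOpen_extChartAt_target x₀).mem_nhds (hq.2 t ht).1] with y hy
          refine Finset.sum_congr rfl fun i _ => ?_
          rw [transplant_extChartAt_symm χ (hfK i) hKχ hy])] at h1
        exact h1) hΦe (hsrc e ⟨he0.le, le_rfl⟩) hD hDs
  refine ⟨U, S, F, hUo, hSo, hS0, hFs.contMDiffOn, ⟨K, hK, hKU, fun s _ => hFK s⟩, hF0, hS,
    fun q => expField (geodesicField g (F q.2)) ⟨x₀, q.1 • ξ₀⟩, fun q => rfl, hcurves, ?_, hmd, hms⟩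
  have h1 : F 0 = fun _ => 0 := funext hF0
  simp only [h1, one_smul, hfree]
  rfl

end
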